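/- Let $\Lambda$ be a finitely generated free abelian group, $\mathfrak t=\Lambda\otimes\mathbb R$, $\mathbb T=\mathfrak t/\Lambda$, and let $K:\Lambda\times\Lambda\to\mathbb Z$ be an even, nondegenerate symmetric bilinear form, extended bilinearly to $\mathfrak t$. Let $G_K=\Lambda^*/K\Lambda$, where $\Lambda^*=\mathrm{Hom}(\Lambda,\mathbb Z)$ and $K\Lambda$ is the image of $x\mapsto K(x,\cdot)$. Let $\det K$ be the determinant of the Gram matrix of $K$ in any $\mathbb Z$-basis of $\Lambda$. Let $\Sigma$ be a closed connected oriented surface of genus $g\ge 0$. The phase space is the torus $\mathcal M=H^1(\Sigma;\mathfrak t)/H^1(\Sigma;\Lambda)$ with the symplectic form $\omega(x,y)=\int_\Sigma K(x\wedge y)$. A prequantum line bundle on $(\mathcal M,\omega)$ is a Hermitian line bundle with unitary connection of curvature $-2\pi i\,\omega$. It is presented as the quotient of the trivial Hermitian line bundle over $H^1(\Sigma;\mathfrak t)$ with connection $d+\alpha$, $\alpha_v(w)=-\pi i\,\omega(v,w)$, by a lift of the translation action of $H^1(\Sigma;\Lambda)$ to unitary, connection-preserving bundle automorphisms $(v,\zeta)\mapsto(v+\gamma,e_\gamma(v)\zeta)$.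 The canonical prequantum line bundle $\mathcal L_{\Sigma,K}$ is the one with $e_\gamma(v)=(-1)^{\int_\Sigma B(\gamma\cup\gamma)}\exp(\pi i\,\omega(\gamma,v))$, where $B$ is any integral bilinear form on $\Lambda$ with $B(x,y)+B(y,x)=K(x,y)$ (the sign does not depend on $B$). Let $L\subset H^1(\Sigma;\mathbb R)$ be a subspace that is Lagrangian for the cup product form and rational, i.e. spanned by the integral classes it contains. The translates of the image of $\mathcal P_L=L\otimes\mathfrak t$ are the leaves $\ell\subset\mathcal M$ of a real polarization. For a prequantum line bundle $\mathcal L$, a leaf $\ell$ is Bohr–Sommerfeld if the connection on $\mathcal L|_\ell$ has trivial holonomy. Put $$\mathcal H_{\mathcal L}(\Sigma,L)=\bigoplus_{\ell\ \text{Bohr–Sommerfeld}}\Gamma_{\mathrm{flat}}\bigl(\ell;\ \mathcal L\otimes|\det\mathcal P_L^*|^{1/2}\bigr),$$ where the bundle of half-densities $|\det\mathcal P_L^*|^{1/2}$ carries its translation-invariant flat connection, and let $\mathcal H_{\mathbb T,K}(\Sigma,L)$ be this space for $\mathcal L=\mathcal L_{\Sigma,K}$. Then $$\dim_{\mathbb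 C}\mathcal H_{\mathbb T,K}(\Sigma,L)=|G_K|^g=|\det K|^g .$$ Moreover $\dim_{\mathbb C}\mathcal H_{\mathcal L}(\Sigma,L)=|\det K|^g$ for every prequantum line bundle $\mathcal L$ on $(\mathcal M,\omega)$. -/

import Mathlib

open CategoryTheory TensorProduct DirectSum

noncomputable section

namespace ToralCS

universe u v

/-! ### Singular cohomology in degree one, singular homology in degree two, cup product

Everything is formulated for a simplicial set `S`; it is applied to the singular simplicial set of a
topological space. -/

section Simplicial

open Simplicial

variable (S : SSet.{u})

/-- The simplicial coboundary `Cⁿ(S; A) → Cⁿ⁺¹(S; A)`, where `Cⁿ(S; A)` is the module of all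
functions from the `n`-simplices to `A`. -/
def coboundary (R A : Type*) [CommRing R] [AddCommGroup A] [Module R A] (n : ℕ) :
    (S _⦋n⦌ → A) →ₗ[R] (S _⦋n + 1⦌ → A) :=
  ∑ i : Fin (n + 2), (-1 : ℤ) ^ (i : ℕ) • LinearMap.funLeft R A (fun σ => S.δ i σ)

/-- The simplicial boundary `Cₙ₊₁(S; ℤ) → Cₙ(S; ℤ)`. -/
def boundary (n : ℕ) : (S _⦋n + 1⦌ →₀ ℤ) →ₗ[ℤ] (S _⦋n⦌ →₀ ℤ) :=
  ∑ i : Fin (n + 2), (-1 : ℤ) ^ (i : ℕ) • Finsupp.lmapDomain ℤ ℤ (fun σ => S.δ i σ)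

/-- One-cocycles with coefficients in `A`. -/
abbrev Cocycle (R A : Type*) [CommRing R] [AddCommGroup A] [Module R A] :
    Submodule R (S _⦋1⦌ → A) :=
  LinearMap.ker (coboundary S R A 1)

/-- One-coboundaries, as a submodule of the one-cocycles. -/
abbrev Coboundary (R A : Type*) [CommRing R] [AddCommGroup A] [Module R A] :
    Submodule R (Cocycle S R A) :=
  (LinearMap.range (coboundary S R A 0)).comap (Cocycle S R A).subtype

/-- `H¹(S; A)`, as an `R`-module, for an `R`-module `A`. -/
abbrev H1 (R A : Type*) [CommRing R] [AddCommGroup A] [Module R A] : Type _ :=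
  Cocycle S R A ⧸ Coboundary S R A

/-- Two-cycles with integral coefficients. -/
abbrev Cycle : Submodule ℤ (S _⦋2⦌ →₀ ℤ) := LinearMap.ker (boundary S 1)

/-- `H₂(S; ℤ)`. -/
abbrev H2 : Type _ := Cycle S ⧸ (LinearMap.range (boundary S 2)).comap (Cycle S).subtype

/-- A fundamental cycle: a two-cycle whose class generates `H₂(S; ℤ)`. For a closed connected
orientable surface, `H₂ ≅ ℤ`, and the choice of such a class is the choice of an orientation. -/
def IsFundamentalCycle (z : Cycle S) : Prop :=
  Submodule.span ℤ {(Submodule.Quotient.mk z : H2 S)} = ⊤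

variable {S}

lemma coboundary_zero_apply {R A : Type*} [CommRing R] [AddCommGroup A] [Module R A]
    (f : S _⦋0⦌ → A) (σ : S _⦋1⦌) :
    coboundary S R A 0 f σ = f (S.δ 0 σ) - f (S.δ 1 σ) := by
  simp [coboundary, Fin.sum_univ_two, LinearMap.funLeft_apply, sub_eq_add_neg]

lemma coboundary_one_apply {R A : Type*} [CommRing R] [AddCommGroup A] [Module R A]
    (f : S _⦋1⦌ → A) (σ : S _⦋2⦌) :
    coboundary S R A 1 f σ = f (S.δ 0 σ) - f (S.δ 1 σ) + f (S.δ 2 σ) := by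
  simp [coboundary, Fin.sum_univ_three, LinearMap.funLeft_apply, sub_eq_add_neg]

lemma cocycle_eq {R A : Type*} [CommRing R] [AddCommGroup A] [Module R A]
    (a : Cocycle S R A) (σ : S _⦋2⦌) :
    a.1 (S.δ 1 σ) = a.1 (S.δ 2 σ) + a.1 (S.δ 0 σ) := by
  have h := congrFun (LinearMap.mem_ker.1 a.2) σ
  rw [coboundary_one_apply] at h
  have h' : a.1 (S.δ 0 σ) - a.1 (S.δ 1 σ) + a.1 (S.δ 2 σ) = 0 := h
  rw [← sub_eq_zero, ← neg_eq_zero, ← h']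
  abel

/-- The value `∑ nᵢ φ(σᵢ)` of a cochain `φ` on a chain `∑ nᵢ σᵢ`. -/
def evalChain {M : Type*} [AddCommGroup M] {n : ℕ} (φ : S _⦋n⦌ → M) (c : S _⦋n⦌ →₀ ℤ) : M :=
  Finsupp.linearCombination ℤ φ c

lemma evalChain_add {M : Type*} [AddCommGroup M] {n : ℕ} (φ ψ : S _⦋n⦌ → M)
    (c : S _⦋n⦌ →₀ ℤ) : evalChain (φ + ψ) c = evalChain φ c + evalChain ψ c := by
  simp [evalChain, Finsupp.linearCombination_apply, Finsupp.sum, Finset.sum_add_distrib]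

lemma evalChain_smul {R M : Type*} [CommRing R] [AddCommGroup M] [Module R M] {n : ℕ} (r : R)
    (φ : S _⦋n⦌ → M) (c : S _⦋n⦌ →₀ ℤ) : evalChain (r • φ) c = r • evalChain φ c := by
  simp only [evalChain, Finsupp.linearCombination_apply, Finsupp.sum, Finset.smul_sum,
    Pi.smul_apply]
  exact Finset.sum_congr rfl fun _ _ => smul_comm _ _ _

lemma evalChain_coboundary {M : Type*} [AddCommGroup M] (ψ : S _⦋1⦌ → M) (z : Cycle S) :
    evalChain (coboundary S ℤ M 1 ψ) z.1 = 0 := by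
  have h : evalChain (coboundary S ℤ M 1 ψ) z.1 = evalChain ψ (boundary S 1 z.1) := by
    have : Finsupp.linearCombination ℤ (coboundary S ℤ M 1 ψ)
        = (Finsupp.linearCombination ℤ ψ).comp (boundary S 1) := by
      ext σ
      rw [LinearMap.comp_apply, LinearMap.comp_apply, LinearMap.comp_apply]
      simp [boundary, coboundary_one_apply, Fin.sum_univ_three, sub_eq_add_neg]
    exact congrArg (fun f => f z.1) this
  rw [h, LinearMap.mem_ker.1 z.2]
  simp [evalChain]

/-- The cup product of two one-cochains, with respect to a bilinear map of the coefficients: the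
value on a two-simplex is the product of the values on its front and on its back edge. -/
def cup {R A B M : Type*} [CommRing R] [AddCommGroup A] [Module R A] [AddCommGroup B] [Module R B]
    [AddCommGroup M] [Module R M] (Q : A →ₗ[R] B →ₗ[R] M) (a : S _⦋1⦌ → A) (b : S _⦋1⦌ → B) :
    S _⦋2⦌ → M :=
  fun σ => Q (a (S.δ 2 σ)) (b (S.δ 0 σ))

/-- Evaluation of the cup product of two one-cocycles on a two-cycle. -/
def cupCocycle {R A B M : Type*} [CommRing R] [AddCommGroup A] [Module R A] [AddCommGroup B]
    [Module R B] [AddCommGroup M] [Module R M] (Q : A →ₗ[R] B →ₗ[R] M) (z : Cycle S) :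
    Cocycle S R A →ₗ[R] Cocycle S R B →ₗ[R] M :=
  LinearMap.mk₂ R (fun a b => evalChain (cup Q a.1 b.1) z.1)
    (fun a a' b => by
      rw [← evalChain_add]; congr 1; funext σ; simp [cup])
    (fun r a b => by
      rw [← evalChain_smul]; congr 1; funext σ; simp [cup])
    (fun a b b' => by
      rw [← evalChain_add]; congr 1; funext σ; simp [cup])
    (fun r a b => by
      rw [← evalChain_smul]; congr 1; funext σ; simp [cup])

/-- Graded commutativity of the cup product on one-cocycles, evaluated on a cycle. -/
lemma cupCocycle_flip {R A B M : Type*} [CommRing R] [AddCommGroup A] [Module R A]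
    [AddCommGroup B] [Module R B] [AddCommGroup M] [Module R M] (Q : A →ₗ[R] B →ₗ[R] M)
    (z : Cycle S) (a : Cocycle S R A) (b : Cocycle S R B) :
    cupCocycle Q.flip z b a = - cupCocycle Q z a b := by
  have h := evalChain_coboundary (fun e => - Q (a.1 e) (b.1 e)) z
  have h2 : coboundary S ℤ M 1 (fun e => - Q (a.1 e) (b.1 e))
      = cup Q.flip b.1 a.1 + cup Q a.1 b.1 := by
    funext σ
    rw [coboundary_one_apply, cocycle_eq a, cocycle_eq b]
    simp only [cup, Pi.add_apply, map_add, LinearMap.add_apply, LinearMap.flip_apply]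
    abel
  rw [h2, evalChain_add] at h
  exact eq_neg_of_add_eq_zero_left h

lemma cupCocycle_coboundary_left {R A B M : Type*} [CommRing R] [AddCommGroup A] [Module R A]
    [AddCommGroup B] [Module R B] [AddCommGroup M] [Module R M] (Q : A →ₗ[R] B →ₗ[R] M)
    (z : Cycle S) (a : Cocycle S R A) (ha : a ∈ Coboundary S R A) (b : Cocycle S R B) :
    cupCocycle Q z a b = 0 := by
  obtain ⟨f, hf⟩ := ha
  have hf' : ∀ e, a.1 e = f (S.δ 0 e) - f (S.δ 1 e) := fun e => by
    rw [← coboundary_zero_apply (R := R), hf]; rfl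
  have h := evalChain_coboundary (fun e => - Q (f (S.δ 1 e)) (b.1 e)) z
  have h2 : coboundary S ℤ M 1 (fun e => - Q (f (S.δ 1 e)) (b.1 e)) = - cup Q a.1 b.1 := by
    funext σ
    have e1 : S.δ 1 (S.δ 0 σ) = S.δ 0 (S.δ 2 σ) := by
      have := S.δ_comp_δ_apply (i := (0 : Fin 2)) (j := 1) (by decide) σ
      exact this.symm
    have e2 : S.δ 1 (S.δ 1 σ) = S.δ 1 (S.δ 2 σ) := by
      have := S.δ_comp_δ_apply (i := (1 : Fin 2)) (j := 1) le_rfl σ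
      exact this.symm
    rw [coboundary_one_apply, cocycle_eq b]
    simp only [cup, Pi.neg_apply, hf', map_sub, LinearMap.sub_apply, map_add]
    rw [e1, e2]
    abel
  rw [h2] at h
  have h3 : evalChain (-cup Q a.1 b.1) z.1 = - cupCocycle Q z a b := by
    have := evalChain_smul (-1 : ℤ) (cup Q a.1 b.1) z.1
    rw [neg_one_smul, neg_one_smul] at this
    exact this
  rw [h3] at h
  simpa using h

/-- The pairing `(x, y) ↦ ⟨Q(x ∪ y), [z]⟩` on first cohomology; when `z` is a fundamental cycle of a
closed oriented surface, this is `(x, y) ↦ ∫ Q(x ∧ y)`. -/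
def cupPairing {R A B M : Type*} [CommRing R] [AddCommGroup A] [Module R A] [AddCommGroup B]
    [Module R B] [AddCommGroup M] [Module R M] (Q : A →ₗ[R] B →ₗ[R] M) (z : Cycle S) :
    H1 S R A →ₗ[R] H1 S R B →ₗ[R] M :=
  LinearMap.liftQ₂ _ _ (cupCocycle Q z)
    (fun a ha => by
      ext b
      exact cupCocycle_coboundary_left Q z a ha b)
    (fun b hb => by
      ext a
      have := cupCocycle_flip Q z a b
      rw [cupCocycle_coboundary_left Q.flip z b hb a] at this
      simpa using this.symm)

@[simp] lemma cupPairing_mk {R A B M : Type*} [CommRing R] [AddCommGroup A] [Module R A]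
    [AddCommGroup B] [Module R B] [AddCommGroup M] [Module R M] (Q : A →ₗ[R] B →ₗ[R] M)
    (z : Cycle S) (a : Cocycle S R A) (b : Cocycle S R B) :
    cupPairing Q z (Submodule.Quotient.mk a) (Submodule.Quotient.mk b) = cupCocycle Q z a b := rfl

/-- The map of cocycles induced by a (semilinear) map of coefficients. -/
def Cocycle.map {R R' A A' : Type*} [CommRing R] [CommRing R'] {s : R →+* R'}
    [AddCommGroup A] [Module R A] [AddCommGroup A'] [Module R' A'] (f : A →ₛₗ[s] A') :
    Cocycle S R A →ₛₗ[s] Cocycle S R' A' where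
  toFun a := ⟨fun e => f (a.1 e), by
    rw [LinearMap.mem_ker]
    funext σ
    rw [coboundary_one_apply, cocycle_eq a]
    simp⟩
  map_add' a b := by ext e; simp
  map_smul' r a := by ext e; simp

/-- The map `H¹(S; A) → H¹(S; A')` induced by a (semilinear) map of coefficients. -/
def H1.map {R R' A A' : Type*} [CommRing R] [CommRing R'] {s : R →+* R'}
    [AddCommGroup A] [Module R A] [AddCommGroup A'] [Module R' A'] (f : A →ₛₗ[s] A') :
    H1 S R A →ₛₗ[s] H1 S R' A' :=
  Submodule.mapQ _ _ (Cocycle.map f) (by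
    rintro a ⟨g, hg⟩
    refine ⟨fun p => f (g p), ?_⟩
    funext e
    rw [coboundary_zero_apply]
    have : a.1 e = g (S.δ 0 e) - g (S.δ 1 e) := by
      rw [← coboundary_zero_apply (R := R), hg]; rfl
    change _ = f (a.1 e)
    rw [this, map_sub])

end Simplicial

/-! ### Closed surfaces -/

/-- The boundary point of the unit disc with parameter `t ∈ [0, 4g]`, the boundary circle being
divided into `4g` sides of length one. -/
def bdryPoint (g : ℕ) (t : ℝ) : Metric.closedBall (0 : ℂ) 1 :=
  ⟨Circle.exp (2 * Real.pi * t / (4 * g)), by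
    rw [mem_closedBall_zero_iff, Circle.norm_coe]⟩

/-- The side identifications of the `4g`-gon with boundary word `∏ aᵢ bᵢ aᵢ⁻¹ bᵢ⁻¹`. For `g = 0`, the
boundary circle is collapsed to a point. -/
inductive SideRel (g : ℕ) :
    Metric.closedBall (0 : ℂ) 1 → Metric.closedBall (0 : ℂ) 1 → Prop
  | sideA (k : Fin g) (s : ℝ) (hs : s ∈ Set.Icc (0 : ℝ) 1) :
      SideRel g (bdryPoint g (4 * k + s)) (bdryPoint g (4 * k + 3 - s))
  | sideB (k : Fin g) (s : ℝ) (hs : s ∈ Set.Icc (0 : ℝ) 1) :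
      SideRel g (bdryPoint g (4 * k + 1 + s)) (bdryPoint g (4 * k + 4 - s))
  | sphere (hg : g = 0) (z w : Metric.closedBall (0 : ℂ) 1) (hz : ‖(z : ℂ)‖ = 1)
      (hw : ‖(w : ℂ)‖ = 1) : SideRel g z w

/-- The standard closed orientable surface of genus `g`, with the quotient topology. -/
abbrev StdSurface (g : ℕ) : Type :=
  Quotient (Relation.EqvGen.setoid (SideRel g))

/-- `X` is a closed (connected, orientable) surface of genus `g`. -/
def IsClosedSurface (g : ℕ) (X : Type u) [TopologicalSpace X] : Prop :=
  Nonempty (X ≃ₜ StdSurface g)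

/-- The singular simplicial set of a topological space. -/
abbrev Sing (X : Type u) [TopologicalSpace X] : SSet.{u} := TopCat.toSSet.obj (TopCat.of X)

/-! ### Prequantum line bundles on `V / ι(G)` and quantization in a linear real polarization -/

section Quantization

variable {V : Type u} [AddCommGroup V] [Module ℝ V] {G : Type v} [AddCommGroup G]

/-- The connection one-form `α_v(w) = -πi ω(v, w)` on the trivial line bundle over `V`, so that
`dα = -2πi ω`. -/
def connForm (ω : V →ₗ[ℝ] V →ₗ[ℝ] ℝ) (v w : V) : ℂ := -(Real.pi * Complex.I * (ω v w : ℂ))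

/-- A prequantum line bundle on the symplectic torus `(V / ι(G), ω)`: a Hermitian line bundle with
unitary connection of curvature `-2πi ω`, presented as the quotient of the trivial Hermitian line
bundle `V × ℂ` with connection `d + α` by the lift `γ · (v, z) = (v + ι γ, factor γ v * z)` of the
translation action of the lattice to unitary bundle automorphisms preserving the connection. -/
structure PrequantumBundle (ι : G →+ V) (ω : V →ₗ[ℝ] V →ₗ[ℝ] ℝ) where
  /-- the automorphy factor -/
  factor : G → V → Circle
  factor_add : ∀ γ δ v, factor (γ + δ) v = factor γ (v + ι δ) * factor δ v
  preserves_conn : ∀ γ v w, HasDerivAt (fun t : ℝ => (factor γ (v + t • w) : ℂ))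
    ((connForm ω v w - connForm ω (v + ι γ) w) * factor γ v) 0

/-- The torus `V / ι(G)`. -/
abbrev Torus (ι : G →+ V) : Type u := V ⧸ ι.range

/-- The leaf through the point represented by `v` of the polarization of `V / ι(G)` by translates of
the image of `P`. -/
def leafThrough (ι : G →+ V) (P : Submodule ℝ V) (v : V) : Set (Torus ι) :=
  (fun w : V => (QuotientAddGroup.mk (v + w) : Torus ι)) '' (P : Set V)

/-- The set of leaves. -/
def leaves (ι : G →+ V) (P : Submodule ℝ V) : Set (Set (Torus ι)) :=
  Set.range (leafThrough ι P)

/-- The preimage in `V` of a subset of the torus. -/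
def preim (ι : G →+ V) (ℓ : Set (Torus ι)) : Set V :=
  (fun v : V => (QuotientAddGroup.mk v : Torus ι)) ⁻¹' ℓ

variable {ι : G →+ V} {ω : V →ₗ[ℝ] V →ₗ[ℝ] ℝ}

/-- The connection on `ℒ|_ℓ` has trivial holonomy: parallel transport along the closed straight
loop `t ↦ [v + t ι(γ)]`, for `γ` with `ι γ ∈ P`, is the identity. (Leaves are flat tori and the
connection is flat along them, so that these loops represent all loops up to homotopy.) A parallel
section `u` along the loop is written in the trivialization over `V`, in which the fibres over `v`
and `v + ι γ` are identified by `factor γ v`. -/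
def TrivialHolonomy (ℒ : PrequantumBundle ι ω) (P : Submodule ℝ V) (ℓ : Set (Torus ι)) : Prop :=
  ∀ v ∈ preim ι ℓ, ∀ γ : G, ι γ ∈ P → ∀ u : ℝ → ℂ,
    (∀ t, HasDerivAt u (-(connForm ω (v + t • ι γ) (ι γ) * u t)) t) → u 1 = ℒ.factor γ v * u 0

/-- The Bohr–Sommerfeld leaves. -/
def bohrSommerfeld (ℒ : PrequantumBundle ι ω) (P : Submodule ℝ V) : Set (Set (Torus ι)) :=
  {ℓ | ℓ ∈ leaves ι P ∧ TrivialHolonomy ℒ P ℓ}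

/-- The line `|det P*|^{1/2} ⊗ ℂ` of complex half-densities on `P`: functions `ν` of a frame of `P`
with `ν(e') = |det_e(e')|^{1/2} ν(e)`. -/
def HalfDensity (P : Submodule ℝ V) :
    Submodule ℂ (Module.Basis (Fin (Module.finrank ℝ P)) ℝ P → ℂ) where
  carrier := {ν | ∀ e e', ν e' = (Real.sqrt |e.det e'| : ℂ) * ν e}
  add_mem' {a b} ha hb e e' := by simp only [Pi.add_apply, ha e e', hb e e', mul_add]
  zero_mem' e e' := by simp
  smul_mem' c a ha e e' := by
    simp only [Pi.smul_apply, smul_eq_mul, ha e e']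
    ring

/-- The flat sections over the leaf `ℓ` of `ℒ ⊗ |det P*|^{1/2}`. The tangent space of a leaf is `P`
at each of its points, by translation, and the half-density bundle has the translation-invariant
connection. A section is written as an equivariant function on the preimage of `ℓ` in `V` (extended
by zero to `V`), and it is flat if its covariant derivative in each direction `w ∈ P` is zero. -/
def flatSections (ℒ : PrequantumBundle ι ω) (P : Submodule ℝ V) (ℓ : Set (Torus ι)) :
    Submodule ℂ (V → HalfDensity P) where
  carrier := {s | (∀ v, v ∉ preim ι ℓ → s v = 0) ∧
    (∀ v ∈ preim ι ℓ, ∀ γ : G, s (v + ι γ) = (ℒ.factor γ v : ℂ) • s v) ∧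
    ∀ v ∈ preim ι ℓ, ∀ w ∈ P, ∀ e, HasDerivAt (fun t : ℝ => (s (v + t • w)).1 e)
      (-(connForm ω v w * (s v).1 e)) 0}
  add_mem' {a b} ha hb := by
    refine ⟨fun v hv => ?_, fun v hv γ => ?_, fun v hv w hw e => ?_⟩
    · simp [ha.1 v hv, hb.1 v hv]
    · simp [ha.2.1 v hv γ, hb.2.1 v hv γ]
    · have := (ha.2.2 v hv w hw e).add (hb.2.2 v hv w hw e)
      refine (this.congr_deriv ?_)
      simp only [Pi.add_apply, Submodule.coe_add]
      ring
  zero_mem' := by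
    refine ⟨fun v hv => rfl, fun v hv γ => by simp, fun v hv w hw e => ?_⟩
    simpa using hasDerivAt_const (0 : ℝ) (0 : ℂ)
  smul_mem' c a ha := by
    refine ⟨fun v hv => ?_, fun v hv γ => ?_, fun v hv w hw e => ?_⟩
    · simp [ha.1 v hv]
    · simp only [Pi.smul_apply, ha.2.1 v hv γ]
      exact smul_comm _ _ _
    · have := (ha.2.2 v hv w hw e).const_mul c
      refine (this.congr_deriv ?_)
      simp only [Pi.smul_apply, Submodule.coe_smul, smul_eq_mul]
      ring

/-- The quantum space: the direct sum, over the Bohr–Sommerfeld leaves, of the spaces of flat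
sections. -/
abbrev QuantumSpace (ℒ : PrequantumBundle ι ω) (P : Submodule ℝ V) : Type _ :=
  ⨁ ℓ : bohrSommerfeld ℒ P, flatSections ℒ P ℓ.1

end Quantization

/-! ### The toral phase space -/

section Toral

variable {X : Type u} [TopologicalSpace X] {Λ : Type v} [AddCommGroup Λ]

/-- The Lie algebra `𝔱 = Λ ⊗ ℝ` of the torus `𝕋 = 𝔱 / Λ`. -/
abbrev LieAlg (Λ : Type v) [AddCommGroup Λ] : Type v := ℝ ⊗[ℤ] Λ

/-- The inclusion `Λ → 𝔱`. -/
def latticeIncl (Λ : Type v) [AddCommGroup Λ] : Λ →ₛₗ[Int.castRingHom ℝ] LieAlg Λ where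
  toFun x := 1 ⊗ₜ x
  map_add' x y := TensorProduct.tmul_add _ _ _
  map_smul' n x := by
    rw [TensorProduct.tmul_smul, eq_intCast, Int.cast_smul_eq_zsmul]

/-- The inclusion `ℤ → ℝ`. -/
def intIncl : ℤ →ₛₗ[Int.castRingHom ℝ] ℝ := (Int.castRingHom ℝ).toSemilinearMap

variable (X Λ) in
/-- `H¹(Σ; Λ) → H¹(Σ; 𝔱)`; the quotient `H¹(Σ; 𝔱) / H¹(Σ; Λ)` is the phase space. -/
def latticeMap : H1 (Sing X) ℤ Λ →+ H1 (Sing X) ℝ (LieAlg Λ) :=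
  (H1.map (latticeIncl Λ)).toAddMonoidHom

/-- The symplectic form `ω(x, y) = ∫_Σ K(x ∧ y)` on `H¹(Σ; 𝔱)`, where `z` is a fundamental cycle of
`Σ` and `K` is extended to `𝔱`. -/
def toralForm (K : LinearMap.BilinForm ℤ Λ) (z : Cycle (Sing X)) :
    H1 (Sing X) ℝ (LieAlg Λ) →ₗ[ℝ] H1 (Sing X) ℝ (LieAlg Λ) →ₗ[ℝ] ℝ :=
  cupPairing (LinearMap.BilinForm.baseChange ℝ K) z

/-- The cup product form `∫_Σ x ∧ y` on `H¹(Σ; ℝ)`. -/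
def cupForm (z : Cycle (Sing X)) : H1 (Sing X) ℝ ℝ →ₗ[ℝ] H1 (Sing X) ℝ ℝ →ₗ[ℝ] ℝ :=
  cupPairing (LinearMap.mul ℝ ℝ) z

/-- `L ⊂ H¹(Σ; ℝ)` is Lagrangian for the cup product form: it is equal to its orthogonal. -/
def IsLagrangian (z : Cycle (Sing X)) (L : Submodule ℝ (H1 (Sing X) ℝ ℝ)) : Prop :=
  ∀ x, x ∈ L ↔ ∀ y ∈ L, cupForm z x y = 0

/-- `L ⊂ H¹(Σ; ℝ)` is rational: it is spanned by the integral classes that it contains. -/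
def IsRational (L : Submodule ℝ (H1 (Sing X) ℝ ℝ)) : Prop :=
  Submodule.span ℝ ((L : Set (H1 (Sing X) ℝ ℝ)) ∩
    Set.range (H1.map intIncl : H1 (Sing X) ℤ ℤ → H1 (Sing X) ℝ ℝ)) = L

variable (Λ) in
/-- The polarization `L ⊗ 𝔱 ⊂ H¹(Σ; 𝔱)`, spanned by the classes `x ⊗ τ` with `x ∈ L`, `τ ∈ 𝔱`. -/
def polarization (L : Submodule ℝ (H1 (Sing X) ℝ ℝ)) :
    Submodule ℝ (H1 (Sing X) ℝ (LieAlg Λ)) :=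
  Submodule.span ℝ {y | ∃ x ∈ L, ∃ τ : LieAlg Λ, y = H1.map (LinearMap.toSpanSingleton ℝ _ τ) x}

/-- The discriminant group `G_K = Λ* / KΛ`. -/
abbrev DiscriminantGroup (K : LinearMap.BilinForm ℤ Λ) : Type _ :=
  Module.Dual ℤ Λ ⧸ LinearMap.range K

/-- For a symmetric even form `K`, an integral bilinear form `B` with `B(x,y) + B(y,x) = K(x,y)`: the
upper triangular part of the Gram matrix, with half the diagonal. -/
def halfForm [Module.Free ℤ Λ] [Module.Finite ℤ Λ] (K : LinearMap.BilinForm ℤ Λ) :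
    LinearMap.BilinForm ℤ Λ :=
  Matrix.toLinearMap₂ (Module.finBasis ℤ Λ) (Module.finBasis ℤ Λ)
    (Matrix.of fun i j => if i < j then K (Module.finBasis ℤ Λ i) (Module.finBasis ℤ Λ j)
      else if i = j then K (Module.finBasis ℤ Λ i) (Module.finBasis ℤ Λ i) / 2 else 0)

lemma halfForm_add_flip [Module.Free ℤ Λ] [Module.Finite ℤ Λ] {K : LinearMap.BilinForm ℤ Λ}
    (hs : K.IsSymm) (he : ∀ x, Even (K x x)) : halfForm K + LinearMap.flip (halfForm K) = K := by
  refine LinearMap.BilinForm.ext_basis (Module.finBasis ℤ Λ) fun i j => ?_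
  have key : ∀ i j, halfForm K (Module.finBasis ℤ Λ i) (Module.finBasis ℤ Λ j) =
      if i < j then K (Module.finBasis ℤ Λ i) (Module.finBasis ℤ Λ j)
      else if i = j then K (Module.finBasis ℤ Λ i) (Module.finBasis ℤ Λ i) / 2 else 0 := by
    intro i j
    rw [← LinearMap.toMatrix₂_apply, halfForm, LinearMap.toMatrix₂_toLinearMap₂, Matrix.of_apply]
  rw [LinearMap.add_apply, LinearMap.add_apply, LinearMap.flip_apply, key, key]
  rcases lt_trichotomy i j with h | h | h
  · simp [h, h.not_gt, h.ne']
  · subst h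
    have := he (Module.finBasis ℤ Λ i)
    simp
    obtain ⟨m, hm⟩ := this
    omega
  · simp [h, h.not_gt, h.ne', hs.eq]

lemma toralForm_latticeMap (K : LinearMap.BilinForm ℤ Λ) (z : Cycle (Sing X))
    (γ δ : H1 (Sing X) ℤ Λ) :
    toralForm K z (latticeMap X Λ γ) (latticeMap X Λ δ) = (cupPairing K z γ δ : ℤ) := by
  induction γ using Submodule.Quotient.induction_on with | _ a => ?_
  induction δ using Submodule.Quotient.induction_on with | _ b => ?_
  change cupCocycle (LinearMap.BilinForm.baseChange ℝ K) z (Cocycle.map (latticeIncl Λ) a)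
    (Cocycle.map (latticeIncl Λ) b) = _
  rw [cupPairing_mk]
  change evalChain (cup _ _ _) z.1 = ((evalChain (cup _ _ _) z.1 : ℤ) : ℝ)
  simp [evalChain, Finsupp.linearCombination_apply, Finsupp.sum, cup, Cocycle.map, latticeIncl]

lemma cupPairing_halfForm [Module.Free ℤ Λ] [Module.Finite ℤ Λ] {K : LinearMap.BilinForm ℤ Λ}
    (hs : K.IsSymm) (he : ∀ x, Even (K x x)) (z : Cycle (Sing X)) (γ δ : H1 (Sing X) ℤ Λ) :
    cupPairing K z γ δ = cupPairing (halfForm K) z γ δ - cupPairing (halfForm K) z δ γ := by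
  induction γ using Submodule.Quotient.induction_on with | _ a => ?_
  induction δ using Submodule.Quotient.induction_on with | _ b => ?_
  simp only [cupPairing_mk]
  have h := cupCocycle_flip (halfForm K) z b a
  have h2 : cupCocycle K z a b
      = cupCocycle (halfForm K) z a b + cupCocycle (LinearMap.flip (halfForm K)) z a b := by
    conv_lhs => rw [← halfForm_add_flip hs he]
    exact evalChain_add (cup (halfForm K) a.1 b.1) (cup (LinearMap.flip (halfForm K)) a.1 b.1) z.1
  rw [h2, h, sub_eq_add_neg]

/-- The canonical (Chern–Simons) prequantum line bundle on `H¹(Σ; 𝔱) / H¹(Σ; Λ)`, with automorphy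
factor `(-1)^{B(γ ∪ γ)} exp(πi ω(γ, v))`, where `B(x,y) + B(y,x) = K(x,y)`. The sign does not depend
on the choice of `B`, because `∪` is alternating on `H¹(Σ; ℤ)`, and it is `1` if `γ` lies in `L ⊗ Λ`
with `L` isotropic. It is the only choice of the sign character that is natural under orientation
preserving homeomorphisms of `Σ`. -/
def chernSimonsBundle [Module.Free ℤ Λ] [Module.Finite ℤ Λ] {K : LinearMap.BilinForm ℤ Λ}
    (hs : K.IsSymm) (he : ∀ x, Even (K x x)) (z : Cycle (Sing X)) :
    PrequantumBundle (latticeMap X Λ) (toralForm K z) where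
  factor γ v := Circle.exp (Real.pi *
    ((cupPairing (halfForm K) z γ γ : ℤ) + toralForm K z (latticeMap X Λ γ) v))
  factor_add γ δ v := by
    rw [← Circle.exp_add, Circle.exp_eq_exp]
    refine ⟨cupPairing (halfForm K) z δ γ, ?_⟩
    have h := toralForm_latticeMap K z γ δ
    rw [cupPairing_halfForm hs he] at h
    simp only [map_add, LinearMap.add_apply, h]
    push_cast
    ring
  preserves_conn γ v w := by
    set c : ℝ := Real.pi *
      ((cupPairing (halfForm K) z γ γ : ℤ) + toralForm K z (latticeMap X Λ γ) v) with hc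
    set d : ℝ := Real.pi * toralForm K z (latticeMap X Λ γ) w with hd
    have h1 : ∀ t : ℝ, Real.pi * ((cupPairing (halfForm K) z γ γ : ℤ)
        + toralForm K z (latticeMap X Λ γ) (v + t • w)) = c + t * d := by
      intro t
      simp only [hc, hd, map_add, map_smul, smul_eq_mul]
      ring
    simp only [h1, Circle.coe_exp]
    have h2 : HasDerivAt (fun t : ℝ => ((c + t * d : ℝ) : ℂ) * Complex.I) (d * Complex.I) 0 := by
      have h3 : HasDerivAt (fun t : ℝ => c + t * d) d 0 := by
        simpa using ((hasDerivAt_id (0 : ℝ)).mul_const d).const_add c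
      exact h3.ofReal_comp.mul_const Complex.I
    refine h2.cexp.congr_deriv ?_
    simp only [connForm, hd, map_add, LinearMap.add_apply]
    push_cast
    simp
    ring

end Toral

end ToralCS

end

/-! The count rests on linear coordinates transverse to the polarization. The integral classes in a
rational Lagrangian `L` form a saturated subgroup of `H¹(Σ; ℤ)` that equals its own annihilator.
Since the intersection form is unimodular, a basis `e i` of this subgroup has a dual family `f j`,
and together they form a basis (`exists_frame`). Contracting `v` with the `e i` gives `g`
coordinates in `𝔱`. Their kernel is `L ⊗ 𝔱` and they map the lattice onto `Λ^g`, so the space of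
leaves is `(𝔱/Λ)^g`.

Preservation of the connection is a linear ODE for the automorphy factor, which is therefore fixed
by its value at the origin (`PrequantumBundle.factor_eq`). On lattice vectors tangent to the leaves,
`ω` vanishes and these values form a character of `Λ^g`. As `K` is nondegenerate, the character is
`exp(-2πi ∑ K(l i, τ i))` for some `τ`. Trivial holonomy then says that every `K(x, coord v i - τ
i)` is an integer (`trivialHolonomy_leafThrough_iff`). Hence the Bohr–Sommerfeld leaves form a
translate of `(K⁻¹Λ*/Λ)^g ≅ G_K^g`. Another bundle only changes the translation `τ`, so the count is
the same for all of them. Over each such leaf a flat section is determined by its value at one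
point, and trivial holonomy lets every value extend (`finrank_flatSections`), so each leaf
contributes a line. Finally `|G_K| = |det K|`, the index of `KΛ` in `Λ*`.

The topological input is `H¹(Σ; A)` with its cup product, computed from the `4g`-gon. A singular
one-cocycle without periods along the sides is a coboundary (`mem_coboundary`): on paths from the
disc it has a potential, and any other path is cut into pieces that deform into such paths.
Circle-valued functions on the surface give integral cocycles with prescribed periods
(`exists_dual_cocycle`). The polygon, cut into sectors, is an explicit two-cycle on which their
products form the standard symplectic matrix. This cycle is homologous to a multiple of the
fundamental cycle, and the value `1` among the products forces the multiple to be `±1`, without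
computing `H₂`. -/

noncomputable section

namespace ToralCS

universe u v w

/-! ### Affine singular simplices -/

section AffineSimplices

open Simplicial

variable {X : Type u} [TopologicalSpace X] {E : Type*} [AddCommGroup E] [Module ℝ E]
  [TopologicalSpace E] [IsTopologicalAddGroup E] [ContinuousSMul ℝ E]

/-- The continuous map underlying a singular simplex. -/
def toMap {n : ℕ} (σ : (Sing X) _⦋n⦌) : C(stdSimplex ℝ (Fin (n + 1)), X) :=
  TopCat.toSSetObjEquiv (TopCat.of X) (Opposite.op ⦋n⦌) σ

lemma toMap_injective {n : ℕ} : Function.Injective (toMap (X := X) (n := n)) :=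
  (TopCat.toSSetObjEquiv (TopCat.of X) (Opposite.op ⦋n⦌)).injective

lemma toMap_δ {n : ℕ} (i : Fin (n + 2)) (σ : (Sing X) _⦋n + 1⦌)
    (x : stdSimplex ℝ (Fin (n + 1))) :
    toMap ((Sing X).δ i σ) x = toMap σ (stdSimplex.map i.succAbove x) := rfl

/-- The composition of the affine simplex with vertices `p i` with a continuous map `f`. -/
def aff {n : ℕ} (f : C(E, X)) (p : Fin (n + 1) → E) : (Sing X) _⦋n⦌ :=
  (TopCat.toSSetObjEquiv (TopCat.of X) (Opposite.op ⦋n⦌)).symm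
    ⟨fun x => f (∑ i, x i • p i), by
      refine f.continuous.comp (continuous_finsetSum _ fun i _ => Continuous.smul ?_ continuous_const)
      exact (continuous_apply i).comp continuous_subtype_val⟩

lemma toMap_aff {n : ℕ} (f : C(E, X)) (p : Fin (n + 1) → E) (x : stdSimplex ℝ (Fin (n + 1))) :
    toMap (aff f p) x = f (∑ i, x i • p i) := by
  unfold toMap aff
  rw [Equiv.apply_symm_apply]
  rfl

lemma toMap_aff₀ (f : C(E, X)) (p : Fin 1 → E) (x : stdSimplex ℝ (Fin 1)) :
    toMap (n := 0) (aff f p) x = f (x 0 • p 0) :=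
  (toMap_aff f p x).trans (congrArg f (Fin.sum_univ_one _))

lemma toMap_aff₁ (f : C(E, X)) (p q : E) (x : stdSimplex ℝ (Fin 2)) :
    toMap (n := 1) (aff f ![p, q]) x = f (x 0 • p + x 1 • q) :=
  (toMap_aff f _ x).trans (congrArg f (Fin.sum_univ_two _))

lemma toMap_aff₂ (f : C(E, X)) (p q r : E) (x : stdSimplex ℝ (Fin 3)) :
    toMap (n := 2) (aff f ![p, q, r]) x = f (x 0 • p + x 1 • q + x 2 • r) :=
  (toMap_aff f _ x).trans (congrArg f (Fin.sum_univ_three _))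

lemma δ_aff {n : ℕ} (f : C(E, X)) (p : Fin (n + 2) → E) (i : Fin (n + 2)) :
    (Sing X).δ i (aff f p) = aff f (p ∘ i.succAbove) := by
  apply toMap_injective
  ext x
  rw [toMap_δ, toMap_aff, toMap_aff]
  congr 1
  simp only [stdSimplex.map_coe, FunOnFinite.linearMap_apply_apply, Function.comp]
  simp only [Finset.sum_smul]
  -- Each vertex `j` of the face contributes to exactly one vertex `i.succAbove j` of the simplex.
  rw [Finset.sum_comm' (t' := Finset.univ) (s' := fun j => {i.succAbove j})]
  · simp
  · simp [eq_comm]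

lemma δ_zero_aff₂ (f : C(E, X)) (p q r : E) : (Sing X).δ 0 (aff f ![p, q, r]) = aff f ![q, r] := by
  rw [δ_aff]; congr 1

lemma δ_one_aff₂ (f : C(E, X)) (p q r : E) : (Sing X).δ 1 (aff f ![p, q, r]) = aff f ![p, r] := by
  rw [δ_aff]; congr 1; ext i; fin_cases i <;> rfl

lemma δ_two_aff₂ (f : C(E, X)) (p q r : E) : (Sing X).δ 2 (aff f ![p, q, r]) = aff f ![p, q] := by
  rw [δ_aff]; congr 1; ext i; fin_cases i <;> rfl

/-- The vertex of the singular set given by a point of `X`. -/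
def pt (x : X) : (Sing X) _⦋0⦌ := aff (E := ℝ) (.const ℝ x) ![0]

lemma aff_zero (f : C(E, X)) (p : Fin 1 → E) : aff f p = pt (f (p 0)) := by
  apply toMap_injective
  ext x
  have h : x 0 = 1 := (Fin.sum_univ_one _).symm.trans (stdSimplex.sum_eq_one x)
  refine (toMap_aff₀ f p x).trans (Eq.trans ?_ (toMap_aff₀ _ _ x).symm)
  rw [h, one_smul]; rfl

lemma toMap_pt (x : X) (y) : toMap (pt x) y = x := toMap_aff₀ _ _ y

lemma δ_zero_aff₁ (f : C(E, X)) (p q : E) : (Sing X).δ 0 (aff f ![p, q]) = pt (f q) := by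
  rw [δ_aff, aff_zero]; rfl

lemma δ_one_aff₁ (f : C(E, X)) (p q : E) : (Sing X).δ 1 (aff f ![p, q]) = pt (f p) := by
  rw [δ_aff, aff_zero]; rfl

lemma eq_pt (σ : (Sing X) _⦋0⦌) : ∃ x, σ = pt x := by
  refine ⟨toMap σ (default : stdSimplex ℝ (Fin 1)), toMap_injective ?_⟩
  ext x
  rw [toMap_pt]
  exact congrArg _ (Subsingleton.elim (α := stdSimplex ℝ (Fin 1)) _ _)

lemma pt_injective : Function.Injective (pt (X := X)) := by
  intro x y h
  have := congrArg (fun σ => toMap σ (default : stdSimplex ℝ (Fin 1))) h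
  exact (toMap_pt _ _).symm.trans (this.trans (toMap_pt _ _))

/-- Two affine edges agree if the two maps agree along the segments. -/
lemma aff_congr {E' : Type*} [AddCommGroup E'] [Module ℝ E'] [TopologicalSpace E']
    [IsTopologicalAddGroup E'] [ContinuousSMul ℝ E'] (f : C(E, X)) (f' : C(E', X))
    (p q : E) (p' q' : E')
    (h : ∀ t ∈ Set.Icc (0 : ℝ) 1, f ((1 - t) • p + t • q) = f' ((1 - t) • p' + t • q')) :
    aff f ![p, q] = aff f' ![p', q'] := by
  apply toMap_injective
  ext x
  refine (toMap_aff₁ f p q x).trans (Eq.trans ?_ (toMap_aff₁ f' p' q' x).symm)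
  have h1 : x 0 + x 1 = 1 := stdSimplex.add_eq_one x
  have h2 : x 0 = 1 - x 1 := by linarith
  have h3 := h (x 1) ⟨stdSimplex.zero_le x 1, stdSimplex.le_one x 1⟩
  rw [h2]; exact h3

/-- The segment from `p` to `q`, as a map `ℝ → E`. -/
def seg (p q : E) : C(ℝ, E) := ⟨fun t => (1 - t) • p + t • q, by fun_prop⟩

lemma aff_eq_comp_seg (f : C(E, X)) (p q : E) :
    aff f ![p, q] = aff (f.comp (seg p q)) ![(0 : ℝ), 1] :=
  aff_congr _ _ _ _ _ _ fun t _ => by simp [seg]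

/-- The point of the one-simplex with parameter `t`. -/
def edgePoint (t : ℝ) (ht : t ∈ Set.Icc (0 : ℝ) 1) : stdSimplex ℝ (Fin 2) :=
  ⟨![1 - t, t], by simp [stdSimplex, Fin.forall_fin_two, ht.1, ht.2]⟩

lemma aff_eq_iff (f f' : C(ℝ, X)) :
    aff f ![(0 : ℝ), 1] = aff f' ![(0 : ℝ), 1] ↔ ∀ t ∈ Set.Icc (0 : ℝ) 1, f t = f' t := by
  refine ⟨fun h t ht => ?_, fun h => aff_congr _ _ _ _ _ _ fun t ht => by simpa using h t ht⟩
  have := congrArg (fun σ => toMap σ (edgePoint t ht)) h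
  have := (toMap_aff₁ f 0 1 (edgePoint t ht)).symm.trans
    (this.trans (toMap_aff₁ f' 0 1 (edgePoint t ht)))
  have e0 : edgePoint t ht 0 = 1 - t := rfl
  have e1 : edgePoint t ht 1 = t := rfl
  simpa only [e0, e1, smul_eq_mul, mul_zero, zero_add, mul_one] using this

/-- Clamping to the unit interval. -/
def clamp (t : ℝ) : ℝ := max 0 (min 1 t)

lemma continuous_clamp : Continuous clamp := by unfold clamp; fun_prop

lemma clamp_mem (t : ℝ) : clamp t ∈ Set.Icc (0 : ℝ) 1 := by
  simp [clamp]

lemma clamp_of_mem {t : ℝ} (h : t ∈ Set.Icc (0 : ℝ) 1) : clamp t = t := by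
  simp [clamp, h.1, h.2]

/-- Clamping retracts the line onto the unit interval. Thus every singular edge extends to the line,
and identities between cochains need checking only on affine edges. -/
lemma eq_aff₁ (σ : (Sing X) _⦋1⦌) : ∃ f : C(ℝ, X), σ = aff f ![(0 : ℝ), 1] := by
  have hc := continuous_clamp
  let r : C(ℝ, stdSimplex ℝ (Fin 2)) := ⟨fun t => edgePoint (clamp t) (clamp_mem t), by
    refine Continuous.subtype_mk (continuous_pi fun i => ?_) _
    fin_cases i <;> simp <;> fun_prop⟩
  refine ⟨(toMap σ).comp r, toMap_injective ?_⟩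
  ext x
  refine Eq.trans ?_ (toMap_aff₁ _ _ _ x).symm
  have h1 : x 0 + x 1 = 1 := stdSimplex.add_eq_one x
  have h2 : clamp (x 1) = x 1 := clamp_of_mem ⟨stdSimplex.zero_le x 1, stdSimplex.le_one x 1⟩
  refine congrArg (toMap σ) (Subtype.ext ?_)
  ext i
  fin_cases i
  · simp [r, edgePoint, h2]; exact eq_sub_of_add_eq h1
  · simp [r, edgePoint, h2]; rfl

/-- The triangle `0 ≤ y ≤ x ≤ 1` is a retract of the plane. A point `(x, y)` of it has barycentric
coordinates `1 - x`, `x - y`, `y`; clamping and replacing `y` by `min x y` extends them to the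
plane. -/
lemma eq_aff₂ (σ : (Sing X) _⦋2⦌) :
    ∃ f : C(ℝ × ℝ, X), σ = aff f ![((0 : ℝ), (0 : ℝ)), (1, 0), (1, 1)] := by
  have hc := continuous_clamp
  let r : C(ℝ × ℝ, stdSimplex ℝ (Fin 3)) :=
    ⟨fun t => ⟨![1 - clamp t.1, clamp t.1 - min (clamp t.1) (clamp t.2),
      min (clamp t.1) (clamp t.2)], by
        have := clamp_mem t.1
        have := clamp_mem t.2
        simp_all [stdSimplex, Fin.forall_fin_succ, Fin.sum_univ_three]⟩, by
      refine Continuous.subtype_mk (continuous_pi fun i => ?_) _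
      fin_cases i <;> simp <;> fun_prop⟩
  refine ⟨(toMap σ).comp r, toMap_injective ?_⟩
  ext x
  refine Eq.trans ?_ (toMap_aff₂ _ _ _ _ x).symm
  have h1 : x 0 + x 1 + x 2 = 1 := (Fin.sum_univ_three _).symm.trans (stdSimplex.sum_eq_one x)
  have h0 := fun i => stdSimplex.zero_le x i
  have h2 : clamp (x 1 + x 2) = x 1 + x 2 :=
    clamp_of_mem ⟨add_nonneg (h0 1) (h0 2), by linarith [h0 0]⟩
  have h3 : clamp (x 2) = x 2 := clamp_of_mem ⟨h0 2, stdSimplex.le_one x 2⟩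
  refine congrArg (toMap σ) (Subtype.ext ?_)
  ext i
  fin_cases i
  · simp [r, h2]; change x 0 = _; linarith
  · simp [r, h2, h3, h0]; rfl
  · simp [r, h2, h3, h0]; rfl

end AffineSimplices

/-! ### Additivity and homotopy invariance of cocycles along affine paths -/

section CocyclesOnAffine

variable {X : Type u} [TopologicalSpace X] {E : Type*} [AddCommGroup E] [Module ℝ E]
  [TopologicalSpace E] [IsTopologicalAddGroup E] [ContinuousSMul ℝ E]
  {R A : Type*} [CommRing R] [AddCommGroup A] [Module R A]

lemma cocycle_aff_trans (c : Cocycle (Sing X) R A) (f : C(E, X)) (p q r : E) :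
    c.1 (aff f ![p, r]) = c.1 (aff f ![p, q]) + c.1 (aff f ![q, r]) := by
  have := cocycle_eq c (aff f ![p, q, r])
  rwa [δ_zero_aff₂, δ_one_aff₂, δ_two_aff₂] at this

lemma cocycle_aff_self (c : Cocycle (Sing X) R A) (f : C(E, X)) (p : E) :
    c.1 (aff f ![p, p]) = 0 := by
  simpa using cocycle_aff_trans c f p p p

lemma cocycle_aff_symm (c : Cocycle (Sing X) R A) (f : C(E, X)) (p q : E) :
    c.1 (aff f ![q, p]) = - c.1 (aff f ![p, q]) := by
  rw [eq_neg_iff_add_eq_zero, ← cocycle_aff_trans, cocycle_aff_self]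

lemma cocycle_aff_const (c : Cocycle (Sing X) R A) (f : C(E, X)) (p q : E)
    (h : ∀ t ∈ Set.Icc (0 : ℝ) 1, f ((1 - t) • p + t • q) = f p) :
    c.1 (aff f ![p, q]) = 0 := by
  rw [aff_congr f f p q p p fun t ht => by rw [h t ht, ← add_smul]; simp, cocycle_aff_self]

end CocyclesOnAffine

section HomotopyInvariance

variable {X : Type u} [TopologicalSpace X] {E W : Type*} [AddCommGroup E] [Module ℝ E]
  [TopologicalSpace E] [IsTopologicalAddGroup E] [ContinuousSMul ℝ E]
  [AddCommGroup W] [Module ℝ W]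
  [TopologicalSpace W] [IsTopologicalAddGroup W] [ContinuousSMul ℝ W]
  {R A : Type*} [CommRing R] [AddCommGroup A] [Module R A]

/-- A cocycle pulled back to a vector space `W` is the coboundary of its values on the segments
from the origin. -/
lemma cocycle_aff_comp (c : Cocycle (Sing X) R A) (F : C(W, X)) (τ : C(E, W)) (p q : E) :
    c.1 (aff (F.comp τ) ![p, q]) = c.1 (aff F ![0, τ q]) - c.1 (aff F ![0, τ p]) := by
  -- Radial contraction of `W`: the edge at height `1` is the given path, the edge at height `0` is
  -- constant, and the vertical edges are the segments from the origin.
  let H : C(E × ℝ, X) := ⟨fun x => F (x.2 • τ x.1), by fun_prop⟩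
  have hv : ∀ s : E, c.1 (aff H ![(s, (0 : ℝ)), (s, 1)]) = c.1 (aff F ![0, τ s]) := fun s => by
    rw [aff_congr H F _ _ 0 (τ s)]
    intro t _
    have : (1 - t) • s + t • s = s := by rw [← add_smul]; simp
    simp [H, this]
  have h1 : c.1 (aff H ![(p, (1 : ℝ)), (q, 1)]) = c.1 (aff (F.comp τ) ![p, q]) := by
    rw [aff_congr H (F.comp τ) _ _ p q]
    intro t _
    simp [H]
  have h0 : c.1 (aff H ![(p, (0 : ℝ)), (q, 0)]) = 0 :=
    cocycle_aff_const _ _ _ _ fun t _ => by simp [H]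
  rw [← h1, cocycle_aff_trans c H (p, 1) (p, 0) (q, 1), cocycle_aff_trans c H (p, 0) (q, 0) (q, 1),
    cocycle_aff_symm c H (p, 0) (p, 1), hv, hv, h0]
  abel

end HomotopyInvariance

/-! ### The polygon model and deformation of paths into the disc -/

section Polygon

/-- The closed unit disc. -/
abbrev Disc : Type := Metric.closedBall (0 : ℂ) 1

/-- A presentation of `X` as the quotient of the disc by the side identifications. -/
structure PolygonModel (g : ℕ) (X : Type u) [TopologicalSpace X] where
  /-- the quotient map -/
  q : Disc → X
  isQuotientMap : Topology.IsQuotientMap q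
  eq_iff : ∀ z w, q z = q w ↔ Relation.EqvGen (SideRel g) z w

lemma IsClosedSurface.polygonModel {g : ℕ} {X : Type u} [TopologicalSpace X]
    (h : IsClosedSurface g X) : Nonempty (PolygonModel g X) := by
  obtain ⟨e⟩ := h
  refine ⟨⟨fun z => e.symm (Quotient.mk _ z), e.symm.isQuotientMap.comp isQuotientMap_quotient_mk',
    fun z w => ?_⟩⟩
  rw [e.symm.injective.eq_iff]
  exact Quotient.eq

/-- The retraction of the plane onto the unit disc. -/
def toDisc : C(ℂ, Disc) :=
  ⟨fun z => ⟨((max 1 ‖z‖)⁻¹ : ℝ) • z, by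
    rw [mem_closedBall_zero_iff, norm_smul, Real.norm_of_nonneg (by positivity),
      inv_mul_le_one₀ (by positivity)]
    exact le_max_right _ _⟩, by
    have h : Continuous fun z : ℂ => ((max 1 ‖z‖)⁻¹ : ℝ) :=
      Continuous.inv₀ (by fun_prop) fun z => by positivity
    exact (h.smul continuous_id).subtype_mk _⟩

lemma toDisc_of_norm_le {z : ℂ} (h : ‖z‖ ≤ 1) : toDisc z = ⟨z, mem_closedBall_zero_iff.2 h⟩ := by
  apply Subtype.ext
  simp [toDisc, max_eq_left h]

lemma toDisc_coe (z : Disc) : toDisc z = z :=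
  toDisc_of_norm_le (mem_closedBall_zero_iff.1 z.2)

/-- The boundary of the polygon as a map to the plane. -/
def arc (g : ℕ) : C(ℝ, ℂ) := ⟨fun t => (Circle.exp (2 * Real.pi * t / (4 * g)) : ℂ), by fun_prop⟩

lemma norm_arc (g : ℕ) (t : ℝ) : ‖arc g t‖ = 1 := Circle.norm_coe _

lemma toDisc_arc (g : ℕ) (t : ℝ) : toDisc (arc g t) = bdryPoint g t := toDisc_coe (bdryPoint g t)

variable {g : ℕ} {X : Type u} [TopologicalSpace X] (M : PolygonModel g X)

namespace PolygonModel

lemma rel {z w : Disc} (h : SideRel g z w) : M.q z = M.q w :=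
  (M.eq_iff z w).2 (.rel _ _ h)

lemma lift {Y : Type*} {φ : Disc → Y} (h : ∀ z w, SideRel g z w → φ z = φ w) {z w : Disc}
    (hzw : M.q z = M.q w) : φ z = φ w := by
  induction (M.eq_iff z w).1 hzw with
  | rel z w hr => exact h z w hr
  | refl => rfl
  | symm z w hr ih => exact (ih ((M.eq_iff _ _).2 hr)).symm
  | trans x y z h1 h2 ih1 ih2 =>
    exact (ih1 ((M.eq_iff _ _).2 h1)).trans (ih2 ((M.eq_iff _ _).2 h2))

/-- The quotient map, extended to the plane by the retraction onto the disc. -/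
def Q : C(ℂ, X) := ⟨fun z => M.q (toDisc z), M.isQuotientMap.continuous.comp toDisc.continuous⟩

lemma Q_coe (z : Disc) : M.Q z = M.q z := congrArg M.q (toDisc_coe z)

lemma Q_arc (t : ℝ) : M.Q (arc g t) = M.q (bdryPoint g t) := M.Q_coe (bdryPoint g t)

lemma Q_sideA (k : Fin g) {s : ℝ} (hs : s ∈ Set.Icc (0 : ℝ) 1) :
    M.Q (arc g (4 * k + s)) = M.Q (arc g (4 * k + 3 - s)) := by
  rw [Q_arc, Q_arc]; exact M.rel (.sideA k s hs)

lemma Q_sideB (k : Fin g) {s : ℝ} (hs : s ∈ Set.Icc (0 : ℝ) 1) :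
    M.Q (arc g (4 * k + 1 + s)) = M.Q (arc g (4 * k + 4 - s)) := by
  rw [Q_arc, Q_arc]; exact M.rel (.sideB k s hs)

/-- The polygon boundary as a path in the surface. -/
def rim : C(ℝ, X) := M.Q.comp (arc g)

variable {R A : Type*} [CommRing R] [AddCommGroup A] [Module R A]

/-- A cocycle without periods along the sides of the polygon becomes trivial on paths coming from
the disc after subtraction of a coboundary. -/
lemma exists_potential (c : Cocycle (Sing X) R A)
    (ha : ∀ k : Fin g, c.1 (aff M.rim ![(4 * k : ℝ), 4 * k + 1]) = 0)
    (hb : ∀ k : Fin g, c.1 (aff M.rim ![(4 * k + 1 : ℝ), 4 * k + 2]) = 0) :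
    ∃ f : X → A, ∀ z : ℂ, c.1 (aff M.Q ![0, z]) = f (M.Q z) := by
  set pot : ℂ → A := fun z => c.1 (aff M.Q ![0, z]) with hpot
  have hrim : ∀ x y : ℝ, c.1 (aff M.rim ![x, y]) = pot (arc g y) - pot (arc g x) :=
    fun x y => cocycle_aff_comp c M.Q (arc g) x y
  -- The initial piece of a side and the piece of its partner traversed backwards are the same path
  -- in the surface, so the potential increases by the same amount.
  have hA : ∀ (k : Fin g), ∀ s ∈ Set.Icc (0 : ℝ) 1, pot (arc g (4 * k + s)) - pot (arc g (4 * k))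
      = pot (arc g (4 * k + 3 - s)) - pot (arc g (4 * k + 3)) := fun k s hs => by
    rw [← hrim, ← hrim, aff_congr M.rim M.rim _ _ (4 * k + 3 : ℝ) (4 * k + 3 - s)]
    intro t ht
    have hst : t * s ∈ Set.Icc (0 : ℝ) 1 :=
      ⟨mul_nonneg ht.1 hs.1, mul_le_one₀ ht.2 hs.1 hs.2⟩
    have := M.Q_sideA k hst
    simp only [rim, ContinuousMap.comp_apply, smul_eq_mul]
    convert this using 3 <;> ring
  have hB : ∀ (k : Fin g), ∀ s ∈ Set.Icc (0 : ℝ) 1,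
      pot (arc g (4 * k + 1 + s)) - pot (arc g (4 * k + 1))
      = pot (arc g (4 * k + 4 - s)) - pot (arc g (4 * k + 4)) := fun k s hs => by
    rw [← hrim, ← hrim, aff_congr M.rim M.rim _ _ (4 * k + 4 : ℝ) (4 * k + 4 - s)]
    intro t ht
    have hst : t * s ∈ Set.Icc (0 : ℝ) 1 :=
      ⟨mul_nonneg ht.1 hs.1, mul_le_one₀ ht.2 hs.1 hs.2⟩
    have := M.Q_sideB k hst
    simp only [rim, ContinuousMap.comp_apply, smul_eq_mul]
    convert this using 3 <;> ring
  -- Vanishing periods make the potential equal at all five corners of a handle. The equal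
  -- increments in `hA` and `hB` then become equal values at identified points.
  have h01 : ∀ k : Fin g, pot (arc g (4 * k + 1)) = pot (arc g (4 * k)) := fun k => by
    rw [← sub_eq_zero, ← hrim, ha]
  have h12 : ∀ k : Fin g, pot (arc g (4 * k + 2)) = pot (arc g (4 * k + 1)) := fun k => by
    rw [← sub_eq_zero, ← hrim, hb]
  have h03 : ∀ k : Fin g, pot (arc g (4 * k + 3)) = pot (arc g (4 * k)) := fun k => by
    have := hA k 1 (by simp)
    rw [h01, sub_self, eq_comm, sub_eq_zero] at this
    rw [← this, ← h01, ← h12]; congr 2; ring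
  have h14 : ∀ k : Fin g, pot (arc g (4 * k + 4)) = pot (arc g (4 * k + 1)) := fun k => by
    have := hB k 1 (by simp)
    rw [show (4 * k + 1 + 1 : ℝ) = 4 * k + 2 by ring, h12, sub_self, eq_comm, sub_eq_zero] at this
    rw [← this, show (4 * k + 4 - 1 : ℝ) = 4 * k + 3 by ring, h03, h01]
  have key : ∀ z w : Disc, SideRel g z w → pot z = pot w := by
    intro z w h
    cases h with
    | sideA k s hs =>
      have := hA k s hs
      rw [h03] at this
      exact sub_left_injective this
    | sideB k s hs =>
      have := hB k s hs
      rw [h14] at this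
      exact sub_left_injective this
    | sphere hg z w hz hw =>
      -- In genus zero, two boundary points are joined by interpolating their arguments. This arc
      -- stays on the collapsed circle, so its image is a constant path.
      have hc : Continuous fun t : ℝ =>
          Complex.exp ((((1 - t) * Complex.arg z + t * Complex.arg w : ℝ) : ℂ) * Complex.I) := by
        fun_prop
      have h := cocycle_aff_comp c M.Q ⟨_, hc⟩ 0 1
      rw [cocycle_aff_const, eq_comm, sub_eq_zero] at h
      · have e : ∀ x : Disc, ‖(x : ℂ)‖ = 1 → Complex.exp (Complex.arg x * Complex.I) = x :=
          fun x hx => by simpa [hx] using Complex.norm_mul_exp_arg_mul_I (x : ℂ)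
        have h' := h
        simp only [ContinuousMap.coe_mk, sub_self, zero_mul, one_mul, zero_add, sub_zero,
          add_zero, e z hz, e w hw] at h'
        exact h'.symm
      · intro t _
        simp only [ContinuousMap.comp_apply, ContinuousMap.coe_mk, Q]
        refine M.rel (.sphere hg _ _ ?_ ?_) <;>
        · rw [toDisc_of_norm_le (Complex.norm_exp_ofReal_mul_I _).le]
          exact Complex.norm_exp_ofReal_mul_I _
  refine ⟨fun x => pot (Function.surjInv M.isQuotientMap.surjective x : Disc), fun z => ?_⟩
  -- The radial segment between `z` and its retraction is sent by `M.Q` to a single point.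
  have h1 : pot z = pot (toDisc z) := by
    simp only [hpot]
    have := cocycle_aff_comp c M.Q (E := ℝ) (seg (toDisc z : ℂ) z) 0 1
    rw [cocycle_aff_const, eq_comm, sub_eq_zero] at this
    · simpa [seg] using this
    · intro t ht
      have : ∀ y ∈ Set.Icc (0 : ℝ) 1, toDisc (seg (toDisc z : ℂ) z y) = toDisc z := by
        intro y hy
        rcases le_total ‖z‖ 1 with h | h
        · rw [toDisc_of_norm_le h]
          simp [seg, toDisc_of_norm_le h, ← add_mul]
        · have hz : 0 < ‖z‖ := by linarith
          have e1 : seg (toDisc z : ℂ) z y = (((1 - y) * ‖z‖⁻¹ + y : ℝ)) • z := by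
            simp [seg, toDisc, max_eq_right h]; ring
          have h2 : 1 ≤ ((1 - y) * ‖z‖⁻¹ + y) * ‖z‖ := by
            rw [add_mul, mul_assoc, inv_mul_cancel₀ hz.ne']; nlinarith [hy.1, hy.2]
          have h3 : 0 < (1 - y) * ‖z‖⁻¹ + y := by
            by_contra h4
            nlinarith
          apply Subtype.ext
          rw [e1]
          simp only [toDisc, ContinuousMap.coe_mk, norm_smul, Real.norm_of_nonneg h3.le,
            max_eq_right h, max_eq_right h2, smul_smul]
          have h4 : 1 - y + y * ‖z‖ ≠ 0 := by nlinarith [mul_nonneg hy.1 (sub_nonneg.2 h)]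
          congr 1
          field_simp
      simp only [ContinuousMap.comp_apply, Q, ContinuousMap.coe_mk]
      rw [this, this]
      · simp
      · simpa using ht
  change pot z = _
  rw [h1]
  refine M.lift key ?_
  exact (Function.surjInv_eq M.isQuotientMap.surjective (M.Q z)).symm

/-- If a cocycle vanishes on the paths coming from the disc, then it vanishes on the paths in an
open set that can be contracted to a discrete set along paths coming from the disc. -/
lemma vanish_of_contraction (c : Cocycle (Sing X) R A)
    (hc : ∀ (τ : C(ℝ, ℂ)) (a b : ℝ), c.1 (aff (M.Q.comp τ) ![a, b]) = 0)
    (U : Set X) (hU : IsOpen U) (h : ℂ → ℝ → ℂ)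
    (h0 : ∀ z : Disc, M.q z ∈ U → h z 0 = z)
    (hcont : Continuous fun x : (M.q ⁻¹' U) × ℝ => h x.1 x.2)
    (hrel : ∀ z w : Disc, SideRel g z w → M.q z ∈ U → ∀ t ∈ Set.Icc (0 : ℝ) 1,
      M.Q (h z t) = M.Q (h w t))
    (hend : IsLocallyConstant fun z : M.q ⁻¹' U => M.Q (h z 1))
    (σ : C(ℝ, X)) {a b : ℝ} (hab : a ≤ b) (hσ : ∀ t ∈ Set.Icc a b, σ t ∈ U) :
    c.1 (aff σ ![a, b]) = 0 := by
  -- Over an open set the quotient map remains a quotient map, so the deformation can descend to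
  -- `U`.
  have hq := M.isQuotientMap.restrictPreimage_isOpen hU
  let k : U × ℝ → X := fun x => M.Q (h (Function.surjInv hq.surjective x.1 : M.q ⁻¹' U) (clamp x.2))
  have hk : ∀ (z : M.q ⁻¹' U) (t : ℝ), k (U.restrictPreimage M.q z, t) = M.Q (h z (clamp t)) := by
    intro z t
    -- The deformation is controlled only over `U`. The value `none` elsewhere makes it a total
    -- function on the disc, to which `M.lift` applies.
    let φ : Disc → Option X := fun w => by
      classical exact if M.q w ∈ U then some (M.Q (h w (clamp t))) else none
    have hφ : ∀ z w, SideRel g z w → φ z = φ w := by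
      intro z w hr
      have hqq := M.rel hr
      by_cases hz : M.q z ∈ U
      · have hw : M.q w ∈ U := hqq ▸ hz
        simp only [φ, if_pos hz, if_pos hw, hrel z w hr hz _ (clamp_mem t)]
      · have hw : M.q w ∉ U := hqq ▸ hz
        simp only [φ, if_neg hz, if_neg hw]
    have h1 : U.restrictPreimage M.q (Function.surjInv hq.surjective (U.restrictPreimage M.q z))
      = U.restrictPreimage M.q z := Function.surjInv_eq _ _
    have h2 := M.lift hφ (congrArg Subtype.val h1)
    have h3 : M.q (Function.surjInv hq.surjective (U.restrictPreimage M.q z) : M.q ⁻¹' U) ∈ U :=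
      (Function.surjInv hq.surjective (U.restrictPreimage M.q z) : M.q ⁻¹' U).2
    have h4 : M.q z ∈ U := z.2
    simpa [φ, h3, h4] using h2
  have hkc : Continuous k := by
    -- Since `ℝ` is locally compact, continuity on the product may be tested after pulling back
    -- along the quotient map.
    refine hq.continuous_lift_prod_left ?_
    simp only [hk]
    exact M.Q.continuous.comp
      (hcont.comp (continuous_fst.prodMk (continuous_clamp.comp continuous_snd)))
  -- Extending the path constantly beyond `[a, b]` keeps it in `U` and makes the homotopy `H`
  -- defined on the whole plane.
  let ρ : C(ℝ, U) := ⟨fun s => ⟨σ (Set.projIcc a b hab s), hσ _ (Set.projIcc a b hab s).2⟩, by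
    fun_prop⟩
  have hρ : ∀ s ∈ Set.Icc a b, (ρ s : X) = σ s := fun s hs => by
    simp [ρ, Set.projIcc_of_mem hab hs]
  let H : C(ℝ × ℝ, X) := ⟨fun x => k (ρ x.1, x.2), by fun_prop⟩
  have hH0 : ∀ s, H (s, 0) = ρ s := fun s => by
    obtain ⟨z, hz⟩ := hq.surjective (ρ s)
    simp only [H, ContinuousMap.coe_mk, ← hz, hk]
    rw [clamp_of_mem (by simp), h0 z z.2, M.Q_coe]; rfl
  have htrack : ∀ s x y, c.1 (aff H ![(s, x), (s, y)]) = 0 := fun s x y => by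
    obtain ⟨z, hz⟩ := hq.surjective (ρ s)
    let τ : C(ℝ, ℂ) := ⟨fun t => h z (clamp t),
      hcont.comp (continuous_const.prodMk continuous_clamp)⟩
    rw [aff_congr H (M.Q.comp τ) _ _ x y, hc]
    intro t _
    have e : (1 - t) * s + t * s = s := by ring
    simp only [H, τ, ContinuousMap.coe_mk, ContinuousMap.comp_apply, Prod.smul_mk, Prod.mk_add_mk,
      smul_eq_mul, e, ← hz, hk]
  have hend' : IsLocallyConstant fun x : U => k (x, 1) := by
    intro B
    rw [← hq.isOpen_preimage]
    have := hend B
    convert this using 1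
    ext z
    simp only [Set.mem_preimage, hk]
    rw [clamp_of_mem (by simp)]
  -- The end of the deformation is locally constant and the parameter line is connected.
  have hconst : ∀ s s', H (s, 1) = H (s', 1) := fun s s' =>
    (hend'.comp_continuous ρ.continuous).apply_eq_of_preconnectedSpace s s'
  have hbot : c.1 (aff H ![(a, (0 : ℝ)), (b, 0)]) = c.1 (aff σ ![a, b]) := by
    rw [aff_congr H σ _ _ a b]
    intro t ht
    have hm : (1 - t) * a + t * b ∈ Set.Icc a b := by
      constructor <;> nlinarith [ht.1, ht.2]
    simpa [hH0] using hρ _ hm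
  -- The bottom edge is compared with the other three sides of the rectangle: the vertical ones come
  -- from the disc and the top one is constant.
  rw [← hbot, cocycle_aff_trans c H (a, 0) (a, 1) (b, 0), cocycle_aff_trans c H (a, 1) (b, 1) (b, 0),
    htrack, htrack, cocycle_aff_const c H (a, 1) (b, 1)]
  · simp
  · intro t _
    have : (1 - t) * 1 + t * 1 = (1 : ℝ) := by ring
    simp only [Prod.smul_mk, Prod.mk_add_mk, smul_eq_mul, this]
    exact hconst _ _

end PolygonModel

end Polygon

/-! ### Contractions towards the corners and the midpoints of the sides -/

section Contractions

/-- The deformation of the punctured disc towards the points `x` of the boundary with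
`x ^ (4 * g) = ε`. -/
def push (g : ℕ) (ε : ℂ) (z : ℂ) (t : ℝ) : ℂ :=
  ((1 - t + t * ‖z‖⁻¹ : ℝ) : ℂ) * z *
    Complex.exp ((-(t * (Complex.arg (ε * z ^ (4 * g)) / (4 * g))) : ℝ) * Complex.I)

lemma push_zero (g : ℕ) (ε z : ℂ) : push g ε z 0 = z := by simp [push]

lemma arc_pow {g : ℕ} (hg : 0 < g) (x : ℝ) :
    arc g x ^ (4 * g) = Complex.exp ((2 * Real.pi * x : ℝ) * Complex.I) := by
  simp only [arc, ContinuousMap.coe_mk, Circle.coe_exp, ← Complex.exp_nat_mul]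
  congr 1
  push_cast
  have : (g : ℂ) ≠ 0 := by exact_mod_cast hg.ne'
  field_simp

lemma arc_mul_exp {g : ℕ} (hg : 0 < g) (x α : ℝ) :
    arc g x * Complex.exp ((α / (4 * g) : ℝ) * Complex.I) = arc g (x + α / (2 * Real.pi)) := by
  simp only [arc, ContinuousMap.coe_mk, Circle.coe_exp, ← Complex.exp_add]
  congr 1
  push_cast
  have : (g : ℂ) ≠ 0 := by exact_mod_cast hg.ne'
  have : (Real.pi : ℂ) ≠ 0 := by exact_mod_cast Real.pi_ne_zero
  field_simp

/-- On the boundary the deformation is a translation of the parameter. For `ε = 1` it moves towards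
the nearest corner (`x ∈ ℤ`), and for `ε = -1` towards the nearest midpoint of a side (`x ∈ ℤ +
1/2`). -/
lemma push_arc {g : ℕ} (hg : 0 < g) (ε : ℂ) (x t : ℝ) :
    push g ε (arc g x) t =
      arc g (x - t * (Complex.arg (ε * arc g x ^ (4 * g)) / (2 * Real.pi))) := by
  rw [push, norm_arc]
  have e : (((1 - t + t * (1 : ℝ)⁻¹ : ℝ)) : ℂ) = 1 := by simp
  have e2 : ∀ β : ℝ, -(t * (β / (4 * g))) = (-(t * β)) / (4 * g) := fun β => by ring
  rw [e, one_mul, e2, arc_mul_exp hg]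
  congr 1; ring

lemma exp_two_pi_add_int (m : ℤ) (s : ℝ) :
    Complex.exp ((2 * Real.pi * (m + s) : ℝ) * Complex.I)
      = Complex.exp ((2 * Real.pi * s : ℝ) * Complex.I) := by
  rw [Complex.exp_eq_exp_iff_exists_int]
  exact ⟨m, by push_cast; ring⟩

/-- Compatibility of the deformation with the gluing of two sides. -/
lemma push_arc_pair {g : ℕ} (hg : 0 < g) {ε : ℝ} (hε : ε * ε = 1) (m m' : ℤ) {s t : ℝ}
    (hs : s ∈ Set.Icc (0 : ℝ) 1) (ht : t ∈ Set.Icc (0 : ℝ) 1)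
    (h : (ε : ℂ) * arc g (m + s) ^ (4 * g) ∈ Complex.slitPlane) :
    ∃ s' ∈ Set.Icc (0 : ℝ) 1, push g ε (arc g (m + s)) t = arc g (m + s') ∧
      push g ε (arc g (m' - s)) t = arc g (m' - s') := by
  set x : ℂ := (ε : ℂ) * Complex.exp ((2 * Real.pi * s : ℝ) * Complex.I) with hx
  have hx1 : (ε : ℂ) * arc g (m + s) ^ (4 * g) = x := by
    rw [arc_pow hg, exp_two_pi_add_int]
  -- The partner side is traversed backwards, which conjugates the power. The argument changes sign,
  -- and the two points move consistently with the gluing.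
  have hx2 : (ε : ℂ) * arc g (m' - s) ^ (4 * g) = (starRingEnd ℂ) x := by
    rw [arc_pow hg, sub_eq_add_neg, exp_two_pi_add_int, hx, map_mul, Complex.conj_ofReal,
      ← Complex.exp_conj]
    simp [map_ofNat]
  rw [hx1] at h
  have hpi := Real.pi_pos
  have hε' : |ε| = 1 := by
    rcases mul_self_eq_one_iff.1 hε with h | h <;> simp [h]
  have hnx : ‖x‖ = 1 := by
    rw [hx, norm_mul, Complex.norm_exp_ofReal_mul_I, Complex.norm_real, Real.norm_eq_abs, hε',
      one_mul]
  have harg : Complex.arg ((starRingEnd ℂ) x) = - Complex.arg x := by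
    rw [Complex.arg_conj, if_neg (Complex.mem_slitPlane_iff_arg.1 h).1]
  set θ : ℝ := Complex.arg x / (2 * Real.pi) with hθ
  have hθ1 : Complex.arg x = 2 * Real.pi * θ := by rw [hθ]; field_simp
  have hlt : θ < 1 / 2 := by
    have := lt_of_le_of_ne (Complex.arg_le_pi x) (Complex.mem_slitPlane_iff_arg.1 h).1
    rw [hθ1] at this
    nlinarith
  have hgt : -1 / 2 < θ := by
    have := Complex.neg_pi_lt_arg x
    rw [hθ1] at this
    nlinarith
  have hxe : Complex.exp ((2 * Real.pi * θ : ℝ) * Complex.I) = x := by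
    rw [← hθ1]; simpa [hnx] using Complex.norm_mul_exp_arg_mul_I x
  -- Squaring removes the sign `ε`, so `2 (s - θ)` is an integer. As it lies strictly between `-1`
  -- and `3`, the target `s - θ` is `0`, `1/2` or `1`.
  have hsq : Complex.exp ((2 * (2 * Real.pi * θ) : ℝ) * Complex.I)
      = Complex.exp ((2 * (2 * Real.pi * s) : ℝ) * Complex.I) := by
    have e : ∀ y : ℝ, Complex.exp ((2 * y : ℝ) * Complex.I)
      = Complex.exp (y * Complex.I) * Complex.exp (y * Complex.I) := fun y => by
      rw [← Complex.exp_add]; congr 1; push_cast; ring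
    have hεc : (ε : ℂ) * ε = 1 := by exact_mod_cast hε
    rw [e, e, hxe, hx]
    linear_combination (Complex.exp ((2 * Real.pi * s : ℝ) * Complex.I)) ^ 2 * hεc
  rw [Complex.exp_eq_exp_iff_exists_int] at hsq
  obtain ⟨n, hn⟩ := hsq
  have hn' : 2 * s - 2 * θ = -n := by
    have := congrArg Complex.im hn
    simp at this
    have h2 : (2 * Real.pi) * (2 * s - 2 * θ) = (2 * Real.pi) * (-n) := by linarith
    exact mul_left_cancel₀ (by positivity) h2
  have hm1 : (-1 : ℝ) < -n := by rw [← hn']; linarith [hs.1]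
  have hm2 : (-n : ℝ) < 3 := by rw [← hn']; linarith [hs.2]
  have hn1 : 0 ≤ -n := by
    have : (-1 : ℤ) < -n := by exact_mod_cast hm1
    omega
  have hn2 : -n ≤ 2 := by
    have : (-n : ℤ) < 3 := by exact_mod_cast hm2
    omega
  have hn1' : (0 : ℝ) ≤ -n := by exact_mod_cast hn1
  have hn2' : (-n : ℝ) ≤ 2 := by exact_mod_cast hn2
  -- This is a convex combination of `s` and `s - θ`, both in the unit interval, so the point never
  -- leaves its side.
  refine ⟨s - t * θ, ?_, ?_, ?_⟩
  · have : s - t * θ = (1 - t) * s + t * (s - θ) := by ring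
    have h1 : 0 ≤ s - θ := by linarith
    have h2 : s - θ ≤ 1 := by linarith
    rw [this]
    constructor <;> nlinarith [ht.1, ht.2, hs.1, hs.2]
  · rw [push_arc hg, hx1]; congr 1; simp only [hθ]; ring
  · rw [push_arc hg, hx2, harg]; congr 1; simp only [hθ]; ring

lemma norm_push_one (g : ℕ) (ε : ℂ) {z : ℂ} (hz : z ≠ 0) : ‖push g ε z 1‖ = 1 := by
  rw [push, norm_mul, norm_mul, Complex.norm_exp_ofReal_mul_I]
  simp [hz]

lemma norm_push_of_norm_eq_one (g : ℕ) (ε : ℂ) {z : ℂ} (hz : ‖z‖ = 1) (t : ℝ) :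
    ‖push g ε z t‖ = 1 := by
  rw [push, norm_mul, norm_mul, Complex.norm_exp_ofReal_mul_I, hz]
  simp

/-- At time one the modulus is normalized, and the rotation removes the argument of `ε * z ^ (4 *
g)`, leaving only the sign. -/
lemma push_one_pow {g : ℕ} (hg : 0 < g) {ε : ℝ} (hε : ε * ε = 1) {z : ℂ} (hz : z ≠ 0) :
    push g ε z 1 ^ (4 * g) = ε := by
  have hε' : ‖(ε : ℂ)‖ = 1 := by
    rw [Complex.norm_real, Real.norm_eq_abs]
    rcases mul_self_eq_one_iff.1 hε with h | h <;> simp [h]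
  have hεc : (ε : ℂ) * ε = 1 := by exact_mod_cast hε
  set w := (ε : ℂ) * z ^ (4 * g) with hw
  have hgc : (g : ℂ) ≠ 0 := by exact_mod_cast hg.ne'
  have hzn : (‖z‖ : ℂ) ≠ 0 := by simpa using hz
  have h1 := Complex.norm_mul_exp_arg_mul_I w
  have h2 : ‖w‖ = ‖z‖ ^ (4 * g) := by rw [hw, norm_mul, hε', one_mul, norm_pow]
  have h3 : Complex.exp ((-(1 * (w.arg / (4 * g))) : ℝ) * Complex.I) ^ (4 * g)
      = (Complex.exp (w.arg * Complex.I))⁻¹ := by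
    rw [← Complex.exp_nat_mul, ← Complex.exp_neg]
    congr 1
    push_cast
    field_simp
  have h4 : (((1 - 1 + 1 * ‖z‖⁻¹ : ℝ)) : ℂ) = (‖z‖ : ℂ)⁻¹ := by simp
  rw [push, mul_pow, mul_pow, h3, h4, inv_pow]
  have h5 : Complex.exp (w.arg * Complex.I) ≠ 0 := Complex.exp_ne_zero _
  have h6 : z ^ (4 * g) = ε * ((‖z‖ : ℂ) ^ (4 * g) * Complex.exp (w.arg * Complex.I)) := by
    rw [h2] at h1
    push_cast at h1
    rw [h1, hw, ← mul_assoc, hεc, one_mul]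
  rw [h6]
  field_simp

end Contractions

namespace PolygonModel

variable {g : ℕ} {X : Type u} [TopologicalSpace X] (M : PolygonModel g X)
  {R A : Type*} [CommRing R] [AddCommGroup A] [Module R A]

lemma preimage_image_of_invariant {S : Set Disc} (hS : ∀ z w, SideRel g z w → (z ∈ S ↔ w ∈ S)) :
    M.q ⁻¹' (M.q '' S) = S := by
  refine Set.Subset.antisymm ?_ (Set.subset_preimage_image _ _)
  rintro z ⟨w, hw, hwz⟩
  have := M.lift (φ := fun z => z ∈ S) (fun z w h => propext (hS z w h)) hwz
  exact this ▸ hw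

lemma isOpen_image_of_invariant {S : Set Disc} (hS : ∀ z w, SideRel g z w → (z ∈ S ↔ w ∈ S))
    (ho : IsOpen S) : IsOpen (M.q '' S) := by
  rw [← M.isQuotientMap.isOpen_preimage, M.preimage_image_of_invariant hS]
  exact ho

end PolygonModel

lemma SideRel.norm_eq_one {g : ℕ} {z w : Disc} (h : SideRel g z w) :
    ‖(z : ℂ)‖ = 1 ∧ ‖(w : ℂ)‖ = 1 := by
  cases h with
  | sideA k s hs => exact ⟨norm_arc _ _, norm_arc _ _⟩
  | sideB k s hs => exact ⟨norm_arc _ _, norm_arc _ _⟩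
  | sphere hg z w hz hw => exact ⟨hz, hw⟩

/-- The part of the disc on which `push g ε` is defined. -/
def pushDomain (g : ℕ) (ε : ℂ) : Set Disc :=
  {z | (z : ℂ) ≠ 0 ∧ ε * (z : ℂ) ^ (4 * g) ∈ Complex.slitPlane}

lemma isOpen_pushDomain (g : ℕ) (ε : ℂ) : IsOpen (pushDomain g ε) :=
  (isOpen_ne_fun (by fun_prop) (by fun_prop)).inter
    (Complex.isOpen_slitPlane.preimage (by fun_prop))

lemma conj_mem_slitPlane {z : ℂ} : (starRingEnd ℂ) z ∈ Complex.slitPlane ↔ z ∈ Complex.slitPlane := by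
  simp [Complex.mem_slitPlane_iff]

lemma arc_ne_zero (g : ℕ) (t : ℝ) : arc g t ≠ 0 := by
  intro h
  have := norm_arc g t
  simp [h] at this

lemma pushDomain_arc_pair {g : ℕ} (hg : 0 < g) (ε : ℝ) (m m' : ℤ) (s : ℝ) :
    (ε : ℂ) * arc g (m + s) ^ (4 * g) ∈ Complex.slitPlane ↔
      (ε : ℂ) * arc g (m' - s) ^ (4 * g) ∈ Complex.slitPlane := by
  rw [arc_pow hg, arc_pow hg, sub_eq_add_neg, exp_two_pi_add_int, exp_two_pi_add_int,
    ← conj_mem_slitPlane, map_mul, Complex.conj_ofReal, ← Complex.exp_conj]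
  simp [map_ofNat]

lemma SideRel.pos_of_fin {g : ℕ} (k : Fin g) : 0 < g := lt_of_le_of_lt (Nat.zero_le _) k.2

/-- On paired sides identified points have conjugate `4g`-th powers, and the slit plane is stable
under conjugation. Saturation of the domain makes its image in the surface open. -/
lemma mem_pushDomain_iff_of_sideRel {g : ℕ} (ε : ℝ) {z w : Disc} (h : SideRel g z w) :
    z ∈ pushDomain g ε ↔ w ∈ pushDomain g ε := by
  cases h with
  | sideA k s hs =>
    have := pushDomain_arc_pair (SideRel.pos_of_fin k) ε (4 * k : ℤ) (4 * k + 3 : ℤ) s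
    push_cast at this
    exact and_congr (iff_of_true (arc_ne_zero _ _) (arc_ne_zero _ _)) this
  | sideB k s hs =>
    have := pushDomain_arc_pair (SideRel.pos_of_fin k) ε (4 * k + 1 : ℤ) (4 * k + 4 : ℤ) s
    push_cast at this
    exact and_congr (iff_of_true (arc_ne_zero _ _) (arc_ne_zero _ _)) this
  | sphere hg z w hz hw =>
    subst hg
    have : ∀ x : Disc, ‖(x : ℂ)‖ = 1 → (x : ℂ) ≠ 0 := fun x hx h => by simp [h] at hx
    exact and_congr (iff_of_true (this z hz) (this w hw)) (by simp)

lemma continuous_push {g : ℕ} {ε : ℂ} {S : Set Disc} (hS : S ⊆ pushDomain g ε) :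
    Continuous fun x : S × ℝ => push g ε x.1 x.2 := by
  rw [continuous_iff_continuousAt]
  intro x
  have h := hS x.1.2
  have h1 : ContinuousAt (fun x : S × ℝ => Complex.arg (ε * (x.1 : ℂ) ^ (4 * g))) x := by
    refine ContinuousAt.comp (f := fun x : S × ℝ => ε * (x.1 : ℂ) ^ (4 * g))
      (Complex.continuousAt_arg h.2) ?_
    fun_prop
  have h2 : ContinuousAt (fun x : S × ℝ => ‖(x.1 : ℂ)‖⁻¹) x :=
    ContinuousAt.inv₀ (by fun_prop) (by simpa using h.1)
  unfold push
  fun_prop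

namespace PolygonModel

variable {g : ℕ} {X : Type u} [TopologicalSpace X] (M : PolygonModel g X)
  {R A : Type*} [CommRing R] [AddCommGroup A] [Module R A]

lemma Q_eq_of_norm_eq_one (hg : g = 0) {z w : ℂ} (hz : ‖z‖ = 1) (hw : ‖w‖ = 1) :
    M.Q z = M.Q w := by
  have := M.rel (.sphere hg ⟨z, mem_closedBall_zero_iff.2 hz.le⟩
    ⟨w, mem_closedBall_zero_iff.2 hw.le⟩ hz hw)
  rwa [← M.Q_coe, ← M.Q_coe] at this

lemma Q_push_eq {ε : ℝ} (hε : ε * ε = 1) {z w : Disc} (h : SideRel g z w)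
    (hz : z ∈ pushDomain g ε) {t : ℝ} (ht : t ∈ Set.Icc (0 : ℝ) 1) :
    M.Q (push g ε z t) = M.Q (push g ε w t) := by
  cases h with
  | sideA k s hs =>
    have h := push_arc_pair (SideRel.pos_of_fin k) hε (4 * k : ℤ) (4 * k + 3 : ℤ) hs ht
      (by push_cast; exact hz.2)
    push_cast at h
    obtain ⟨s', hs', h1, h2⟩ := h
    exact (congrArg M.Q h1).trans ((M.Q_sideA k hs').trans (congrArg M.Q h2).symm)
  | sideB k s hs =>
    have h := push_arc_pair (SideRel.pos_of_fin k) hε (4 * k + 1 : ℤ) (4 * k + 4 : ℤ) hs ht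
      (by push_cast; exact hz.2)
    push_cast at h
    obtain ⟨s', hs', h1, h2⟩ := h
    exact (congrArg M.Q h1).trans ((M.Q_sideB k hs').trans (congrArg M.Q h2).symm)
  | sphere hg z w hz hw =>
    exact M.Q_eq_of_norm_eq_one hg (norm_push_of_norm_eq_one _ _ hz _)
      (norm_push_of_norm_eq_one _ _ hw _)

/-- For `g > 0` the endpoints lie in the finite, hence discrete, set of `4g`-th roots of `ε`. For `g
= 0` they lie on the circle that is collapsed to a point. -/
lemma isLocallyConstant_push_one {ε : ℝ} (hε : ε * ε = 1) {S : Set Disc}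
    (hS : S ⊆ pushDomain g ε) : IsLocallyConstant fun z : S => M.Q (push g ε z 1) := by
  rcases Nat.eq_zero_or_pos g with hg | hg
  · exact .of_constant _ fun z w => M.Q_eq_of_norm_eq_one hg (norm_push_one _ _ (hS z.2).1)
      (norm_push_one _ _ (hS w.2).1)
  · have hfin : {x : ℂ | x ^ (4 * g) = ε}.Finite := by
      refine (Polynomial.nthRoots (4 * g) (ε : ℂ)).toFinset.finite_toSet.subset fun x hx => ?_
      simpa [Polynomial.mem_nthRoots (show 0 < 4 * g by omega)] using hx
    have := hfin.to_subtype
    let e : S → {x : ℂ | x ^ (4 * g) = ε} := fun z => ⟨push g ε z 1, push_one_pow hg hε (hS z.2).1⟩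
    have he : Continuous e :=
      ((continuous_push hS).comp (continuous_id.prodMk continuous_const)).subtype_mk _
    exact (IsLocallyConstant.iff_continuous e).2 he |>.comp fun x => M.Q x

/-- A cocycle which vanishes on the paths coming from the disc is zero. -/
lemma eq_zero_of_vanish (c : Cocycle (Sing X) R A)
    (hc : ∀ (τ : C(ℝ, ℂ)) (a b : ℝ), c.1 (aff (M.Q.comp τ) ![a, b]) = 0) (σ : C(ℝ, X)) :
    c.1 (aff σ ![(0 : ℝ), 1]) = 0 := by
  -- An open cover by saturated sets: the open disc, contracted to its centre, and the two domains
  -- retracting to the corners and to the midpoints of the sides.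
  let S : Option Bool → Set Disc := fun i => match i with
    | none => {z | ‖(z : ℂ)‖ < 1}
    | some b => pushDomain g ((cond b 1 (-1) : ℝ) : ℂ)
  have hS : ∀ i, ∀ z w, SideRel g z w → (z ∈ S i ↔ w ∈ S i) := by
    rintro (_ | b) z w h
    · have := h.norm_eq_one
      simp [S, this.1, this.2]
    · exact mem_pushDomain_iff_of_sideRel _ h
  have hSo : ∀ i, IsOpen (S i) := by
    rintro (_ | b)
    · exact isOpen_lt (by fun_prop) (by fun_prop)
    · exact isOpen_pushDomain _ _
  have hcov : ∀ z : Disc, ∃ i, z ∈ S i := by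
    intro z
    by_cases hz : ‖(z : ℂ)‖ < 1
    · exact ⟨none, hz⟩
    · have hz0 : (z : ℂ) ≠ 0 := fun h => hz (by simp [h])
      have hp : (z : ℂ) ^ (4 * g) ≠ 0 := pow_ne_zero _ hz0
      by_cases h : (z : ℂ) ^ (4 * g) ∈ Complex.slitPlane
      · exact ⟨some true, hz0, by simpa using h⟩
      -- A nonzero number outside the slit plane is a negative real, so its negative lies in the
      -- slit plane.
      · refine ⟨some false, hz0, ?_⟩
        rw [Complex.mem_slitPlane_iff] at h ⊢
        push Not at h
        left
        have : ((z : ℂ) ^ (4 * g)).re ≠ 0 := fun h' => hp (Complex.ext h' h.2)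
        simpa using lt_of_le_of_ne h.1 this
  have key : ∀ i (a b : ℝ), a ≤ b → (∀ t ∈ Set.Icc a b, σ t ∈ M.q '' S i) →
      c.1 (aff σ ![a, b]) = 0 := by
    intro i a b hab h
    have hpre := M.preimage_image_of_invariant (hS i)
    have hmem : ∀ z, M.q z ∈ M.q '' S i → z ∈ S i := fun z hz => by
      rw [← hpre]; exact hz
    have hopen := M.isOpen_image_of_invariant (hS i) (hSo i)
    rcases i with _ | ε
    · refine M.vanish_of_contraction c hc _ hopen (fun z t => ((1 - t : ℝ) : ℂ) * z) ?_ ?_ ?_ ?_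
        σ hab h
      · simp
      · fun_prop
      · intro z w hr hz
        have := hmem z hz
        simp [S, hr.norm_eq_one.1] at this
      · simp only [sub_self, Complex.ofReal_zero, zero_mul]
        exact .const _
    · have hε : (cond ε 1 (-1) : ℝ) * cond ε 1 (-1) = 1 := by cases ε <;> simp
      refine M.vanish_of_contraction c hc _ hopen (push g ((cond ε 1 (-1) : ℝ) : ℂ)) ?_ ?_ ?_ ?_
        σ hab h
      · exact fun z _ => push_zero _ _ _
      · exact continuous_push hpre.subset
      · exact fun z w hr hz t ht => M.Q_push_eq hε hr (hmem z hz) ht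
      · exact M.isLocallyConstant_push_one hε hpre.subset
  -- A Lebesgue subdivision: each piece of the path lies in one member of the cover, and the cocycle
  -- is additive over the pieces.
  obtain ⟨t, ht0, htm, ⟨n, hn⟩, hti⟩ := exists_monotone_Icc_subset_open_cover_unitInterval
    (c := fun i => (fun x : unitInterval => σ x) ⁻¹' (M.q '' S i))
    (fun i => (M.isOpen_image_of_invariant (hS i) (hSo i)).preimage (by fun_prop)) (by
      intro x _
      obtain ⟨z, hz⟩ := M.isQuotientMap.surjective (σ x)
      obtain ⟨i, hi⟩ := hcov z
      exact Set.mem_iUnion.2 ⟨i, z, hi, hz⟩)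
  have hind : ∀ m, c.1 (aff σ ![(0 : ℝ), t m]) = 0 := by
    intro m
    induction m with
    | zero => rw [ht0]; exact cocycle_aff_self _ _ _
    | succ m ih =>
      obtain ⟨i, hi⟩ := hti m
      rw [cocycle_aff_trans c σ _ (t m : ℝ), ih, zero_add]
      refine key i _ _ (htm (Nat.le_succ m)) fun x hx => ?_
      have hx' : x ∈ unitInterval := ⟨(t m).2.1.trans hx.1, hx.2.trans (t (m + 1)).2.2⟩
      exact hi (show (⟨x, hx'⟩ : unitInterval) ∈ _ from hx)
  have := hind n
  rwa [hn n le_rfl] at this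

/-- A cocycle without periods along the sides of the polygon is a coboundary. -/
theorem mem_coboundary (c : Cocycle (Sing X) R A)
    (ha : ∀ k : Fin g, c.1 (aff M.rim ![(4 * k : ℝ), 4 * k + 1]) = 0)
    (hb : ∀ k : Fin g, c.1 (aff M.rim ![(4 * k + 1 : ℝ), 4 * k + 2]) = 0) :
    c ∈ Coboundary (Sing X) R A := by
  obtain ⟨f, hf⟩ := M.exists_potential c ha hb
  choose p hp using eq_pt (X := X)
  have hp' : ∀ x, p (pt x) = x := fun x => (pt_injective (hp (pt x))).symm
  have hδ : coboundary (Sing X) R A 1 (coboundary (Sing X) R A 0 (f ∘ p)) = 0 := by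
    funext σ
    obtain ⟨F, rfl⟩ := eq_aff₂ σ
    rw [coboundary_one_apply, δ_zero_aff₂, δ_one_aff₂, δ_two_aff₂]
    simp only [coboundary_zero_apply, δ_zero_aff₁, δ_one_aff₁]
    simp
  let d : Cocycle (Sing X) R A := ⟨_, LinearMap.mem_ker.2 hδ⟩
  have hd : ∀ (F : C(ℝ, X)) (x y : ℝ), d.1 (aff F ![x, y]) = f (F y) - f (F x) := fun F x y => by
    simp only [d, coboundary_zero_apply, δ_zero_aff₁, δ_one_aff₁, Function.comp, hp']
  -- After subtracting the coboundary of the potential, the cocycle vanishes on all paths from the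
  -- disc, hence on all paths.
  have hcd : c = d := by
    rw [← sub_eq_zero]
    apply Subtype.ext
    funext σ
    obtain ⟨F, rfl⟩ := eq_aff₁ σ
    refine M.eq_zero_of_vanish (c - d) (fun τ a b => ?_) F
    change c.1 _ - d.1 _ = 0
    rw [hd, cocycle_aff_comp, hf, hf, sub_eq_zero]
    rfl
  rw [hcd]
  exact ⟨f ∘ p, rfl⟩

end PolygonModel

/-! ### Integral cocycles from maps to the circle -/

section Winding

open Simplicial

lemma exists_lift {E : Type*} [TopologicalSpace E] [SimplyConnectedSpace E]
    [LocallyPathConnectedSpace E] (F : C(E, Circle)) :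
    ∃ φ : C(E, ℝ), ∀ x, Circle.exp (2 * Real.pi * φ x) = F x := by
  obtain ⟨x₀⟩ : Nonempty E := inferInstance
  obtain ⟨ψ, ⟨-, hψ⟩, -⟩ := Circle.isCoveringMap_exp.existsUnique_continuousMap_lifts F (a₀ := x₀)
    (e₀ := Complex.arg (F x₀)) (Circle.exp_arg _)
  refine ⟨⟨fun x => ψ x / (2 * Real.pi), by fun_prop⟩, fun x => ?_⟩
  rw [← congrFun hψ x]
  simp only [ContinuousMap.coe_mk, Function.comp]
  congr 1
  field_simp

lemma exp_two_pi_eq_iff {x y : ℝ} :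
    Circle.exp (2 * Real.pi * x) = Circle.exp (2 * Real.pi * y) ↔ ∃ n : ℤ, x - y = n := by
  rw [Circle.exp_eq_exp]
  refine exists_congr fun n => ?_
  have := Real.pi_pos
  constructor
  · intro h
    have : (2 * Real.pi) * (x - y) = (2 * Real.pi) * n := by linarith
    exact mul_left_cancel₀ (by positivity) this
  · intro h
    linear_combination 2 * Real.pi * h

/-- Two logarithms of the same path differ by a continuous integer-valued function, which is
constant. -/
lemma lift_sub_eq {φ ψ : C(ℝ, ℝ)} (h : ∀ t ∈ Set.Icc (0 : ℝ) 1,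
    Circle.exp (2 * Real.pi * φ t) = Circle.exp (2 * Real.pi * ψ t)) :
    φ 1 - φ 0 = ψ 1 - ψ 0 := by
  have h' : ∀ t : ℝ, ∃ n : ℤ, φ (clamp t) - ψ (clamp t) = n := fun t =>
    exp_two_pi_eq_iff.1 (h _ (clamp_mem t))
  choose m hm using h'
  have hmc : Continuous m := by
    rw [Int.isClosedEmbedding_coe_real.isEmbedding.continuous_iff]
    have : ((↑) ∘ m : ℝ → ℝ) = fun t => φ (clamp t) - ψ (clamp t) := funext fun t => (hm t).symm
    rw [this]
    have := continuous_clamp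
    fun_prop
  have h01 : m 0 = m 1 := PreconnectedSpace.constant inferInstance hmc
  have e0 := hm 0
  have e1 := hm 1
  rw [clamp_of_mem (by simp)] at e0 e1
  rw [h01] at e0
  linarith

variable {X : Type u} [TopologicalSpace X] (f : C(X, Circle))

/-- A (discontinuous) logarithm of a map to the circle, with values in `(-1/2, 1/2]`. -/
def height (x : X) : ℝ := Complex.arg (f x) / (2 * Real.pi)

lemma exp_height (x : X) : Circle.exp (2 * Real.pi * height f x) = f x := by
  rw [height, mul_div_cancel₀ _ (by positivity), Circle.exp_arg]

lemma height_eq_zero {x : X} (h : f x = 1) : height f x = 0 := by simp [height, h]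

/-- The winding number of the image of an edge under `f`, closed up by the logarithm `height f`. -/
def winding (σ : (Sing X) _⦋1⦌) : ℤ :=
  let F := (eq_aff₁ σ).choose
  let φ := (exists_lift (f.comp F)).choose
  ⌊φ 1 - height f (F 1) - (φ 0 - height f (F 0))⌋

/-- The extension of the edge and the lift chosen in `winding` do not matter, because only the
increment over the unit interval enters. `φ` and `height f` are logarithms of the same value, so the
quantity under the floor is already an integer. -/
lemma winding_aff {E : Type*} [AddCommGroup E] [Module ℝ E]
    [TopologicalSpace E] [IsTopologicalAddGroup E] [ContinuousSMul ℝ E] (F : C(E, X)) (φ : C(E, ℝ))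
    (h : ∀ x, Circle.exp (2 * Real.pi * φ x) = f (F x)) (p q : E) :
    (winding f (aff F ![p, q]) : ℝ) = φ q - height f (F q) - (φ p - height f (F p)) := by
  have hF := (eq_aff₁ (aff F ![p, q])).choose_spec
  set F' := (eq_aff₁ (aff F ![p, q])).choose with hF'
  have hφ := (exists_lift (f.comp F')).choose_spec
  set φ' := (exists_lift (f.comp F')).choose with hφ'
  rw [aff_eq_comp_seg, aff_eq_iff] at hF
  have e1 : F' 1 = F q := by simpa [seg] using (hF 1 (by simp)).symm
  have e0 : F' 0 = F p := by simpa [seg] using (hF 0 (by simp)).symm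
  have hs : φ' 1 - φ' 0 = φ q - φ p := by
    have := lift_sub_eq (φ := φ') (ψ := φ.comp (seg p q)) fun t ht => by
      rw [hφ, ContinuousMap.comp_apply, ← hF t ht, ContinuousMap.comp_apply]
      exact (h _).symm
    simpa [seg] using this
  have hint : ∀ x, ∃ n : ℤ, φ x - height f (F x) = n := fun x =>
    exp_two_pi_eq_iff.1 ((h x).trans (exp_height f _).symm)
  obtain ⟨n, hn⟩ := hint q
  obtain ⟨m, hm⟩ := hint p
  have hw : winding f (aff F ![p, q]) = ⌊φ' 1 - height f (F' 1) - (φ' 0 - height f (F' 0))⌋ := rfl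
  have : φ' 1 - height f (F' 1) - (φ' 0 - height f (F' 0)) = ((n - m : ℤ) : ℝ) := by
    rw [e1, e0]
    push_cast
    linarith
  rw [hw, this, Int.floor_intCast, hn, hm]
  push_cast
  rfl

/-- The integral cocycle defined by a map to the circle. -/
def windingCocycle : Cocycle (Sing X) ℤ ℤ := ⟨winding f, by
  rw [LinearMap.mem_ker]
  funext σ
  obtain ⟨F, rfl⟩ := eq_aff₂ σ
  -- A single lift over the plane serves all three edges, and the sum telescopes.
  obtain ⟨φ, hφ⟩ := exists_lift (f.comp F)
  rw [coboundary_one_apply, δ_zero_aff₂, δ_one_aff₂, δ_two_aff₂]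
  have h := winding_aff f F φ hφ
  have : ((winding f (aff F ![((1 : ℝ), (0 : ℝ)), (1, 1)]) - winding f (aff F ![(0, 0), (1, 1)])
      + winding f (aff F ![(0, 0), (1, 0)]) : ℤ) : ℝ) = (0 : ℤ) := by
    push_cast
    rw [h, h, h]
    ring
  exact_mod_cast this⟩

end Winding

/-! ### Trapezoid functions and cocycles dual to the sides -/

section Bump

/-- The trapezoid function. -/
def trap (x : ℝ) : ℝ := max 0 (min 1 (3 / 2 - |x|))

lemma trap_eq_one {x : ℝ} (h : |x| ≤ 1 / 2) : trap x = 1 := by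
  rw [trap, min_eq_left (by linarith)]; simp

lemma trap_eq_zero {x : ℝ} (h : 3 / 2 ≤ |x|) : trap x = 0 := by
  rw [trap, max_eq_left]
  exact (min_le_right _ _).trans (by linarith)

lemma trap_neg (x : ℝ) : trap (-x) = trap x := by simp [trap]

/-- A function on the disc whose restriction to the boundary is a trapezoid around the point with
parameter `c`. -/
def bump (g : ℕ) (c : ℝ) : C(Disc, ℝ) :=
  ⟨fun z => ‖(z : ℂ)‖ * max 0 (min 1 (3 / 2 - 2 * g / Real.pi *
    Real.arccos ((z : ℂ) * (starRingEnd ℂ) (arc g c)).re)), by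
    have := Real.continuous_arccos
    fun_prop⟩

lemma bump_zero (g : ℕ) (c : ℝ) {z : Disc} (hz : (z : ℂ) = 0) : bump g c z = 0 := by simp [bump, hz]

/-- The arccosine measures the distance along the circle, which is `|t - c|` or `4g - |t - c|`. In
the second case the bound makes this distance at least `3/2`, and both sides vanish. -/
lemma bump_bdryPoint {g : ℕ} (hg : 0 < g) {c t : ℝ} (h : |t - c| ≤ 4 * g - 3 / 2) :
    bump g c (bdryPoint g t) = trap (t - c) := by
  have hg' : (1 : ℝ) ≤ g := by exact_mod_cast hg
  have hpi := Real.pi_pos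
  have hre : ((arc g t) * (starRingEnd ℂ) (arc g c)).re
      = Real.cos (Real.pi * |t - c| / (2 * g)) := by
    have : (arc g t) * (starRingEnd ℂ) (arc g c)
        = Complex.exp ((Real.pi * (t - c) / (2 * g) : ℝ) * Complex.I) := by
      simp only [arc, ContinuousMap.coe_mk, Circle.coe_exp, ← Complex.exp_conj, ← Complex.exp_add]
      congr 1
      simp [map_ofNat]
      have : (g : ℂ) ≠ 0 := by exact_mod_cast hg.ne'
      field_simp
      ring
    rw [this, Complex.exp_ofReal_mul_I_re, ← Real.cos_abs, abs_div, abs_mul, abs_of_pos hpi,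
      abs_of_pos (by positivity : (0 : ℝ) < 2 * g)]
  have hnorm : ‖((bdryPoint g t : Disc) : ℂ)‖ = 1 := norm_arc g t
  have hb : bump g c (bdryPoint g t) = max 0 (min 1 (3 / 2 - 2 * g / Real.pi *
      Real.arccos (Real.cos (Real.pi * |t - c| / (2 * g))))) := by
    rw [← hre]
    change ‖((bdryPoint g t : Disc) : ℂ)‖ * _ = _
    rw [hnorm, one_mul]; rfl
  rw [hb]
  rcases le_total |t - c| (2 * g) with h1 | h1
  · rw [Real.arccos_cos (by positivity) (by rw [div_le_iff₀ (by positivity)]; nlinarith), trap]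
    congr 3
    field_simp
  · have e : Real.cos (Real.pi * |t - c| / (2 * g))
        = Real.cos (Real.pi * (4 * g - |t - c|) / (2 * g)) := by
      rw [← Real.cos_two_pi_sub]
      congr 1
      field_simp
      ring
    have h2 : 0 ≤ 4 * g - |t - c| := by linarith
    rw [e, Real.arccos_cos (by positivity) (by rw [div_le_iff₀ (by positivity)]; nlinarith),
      trap_eq_zero (by linarith), max_eq_left]
    refine (min_le_right _ _).trans ?_
    have : 2 * g / Real.pi * (Real.pi * (4 * g - |t - c|) / (2 * g)) = 4 * g - |t - c| := by
      field_simp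
    rw [this]; linarith

end Bump

namespace PolygonModel

variable {g : ℕ} {X : Type u} [TopologicalSpace X] (M : PolygonModel g X)

/-- A function on the disc compatible modulo `ℤ` with the side identifications defines an
integral cocycle. -/
lemma exists_cocycle (F : C(Disc, ℝ)) (h0 : F (toDisc 0) = 0)
    (hF : ∀ z w, SideRel g z w → ∃ n : ℤ, F z - F w = n) :
    ∃ c : Cocycle (Sing X) ℤ ℤ, ∀ (z : ℂ) (n : ℤ), F (toDisc z) = n → c.1 (aff M.Q ![0, z]) = n := by
  have hsurj := M.isQuotientMap.surjective
  have hlift : ∀ z, Circle.exp (2 * Real.pi * F (Function.surjInv hsurj (M.q z)))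
      = Circle.exp (2 * Real.pi * F z) := fun z =>
    M.lift (φ := fun z => Circle.exp (2 * Real.pi * F z))
      (fun z w h => exp_two_pi_eq_iff.2 (hF z w h)) (Function.surjInv_eq hsurj (M.q z))
  let f : C(X, Circle) := ⟨fun x => Circle.exp (2 * Real.pi * F (Function.surjInv hsurj x)), by
    rw [M.isQuotientMap.continuous_iff]
    have : ((fun x => Circle.exp (2 * Real.pi * F (Function.surjInv hsurj x))) ∘ M.q)
        = fun z => Circle.exp (2 * Real.pi * F z) := funext hlift
    rw [this]
    fun_prop⟩
  have hf : ∀ z, f (M.Q z) = Circle.exp (2 * Real.pi * F (toDisc z)) := fun z => hlift _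
  refine ⟨windingCocycle f, fun z n hn => ?_⟩
  have h := winding_aff f M.Q (F.comp toDisc) (fun x => (hf x).symm) 0 z
  -- At points where `F` is an integer the height correction vanishes, so the winding number from
  -- the centre is `F` itself.
  have hz : ∀ (z : ℂ) (n : ℤ), F (toDisc z) = n → height f (M.Q z) = 0 := fun z n hn => by
    apply height_eq_zero
    rw [hf, hn, ← Circle.exp_zero, Circle.exp_eq_exp]
    exact ⟨n, by ring⟩
  rw [hz z n hn, hz 0 0 (by simpa using h0)] at h
  simp only [ContinuousMap.comp_apply, hn, h0, sub_zero] at h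
  exact_mod_cast h

/-- The cocycle with period one along the side `a i` or `b i`, according to whether `τ` is zero or
one, and no other periods along the sides. -/
lemma exists_dual_cocycle (i : Fin g) (τ : Fin 2) :
    ∃ c : Cocycle (Sing X) ℤ ℤ, ∀ (k : Fin g) (m : Fin 5),
      c.1 (aff M.Q ![0, arc g (4 * (k : ℕ) + (m : ℕ))])
        = if k = i ∧ ((m : ℕ) = τ + 1 ∨ (m : ℕ) = τ + 2) then 1 else 0 := by
  have hg : 0 < g := SideRel.pos_of_fin i
  -- The centre of the trapezoid is the midpoint of the side `b i` if `τ = 0`, and of the inverse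
  -- side of `a i` if `τ = 1`. The function is one on this side and has its ramps on the two
  -- neighbours, which are the copies of `a i`, respectively of `b i`.
  set c : ℝ := 4 * (i : ℕ) + 3 / 2 + (τ : ℕ) with hc
  have hτ : ((τ : ℕ) : ℝ) = 0 ∨ ((τ : ℕ) : ℝ) = 1 := by
    fin_cases τ <;> simp
  have hi1 : ((i : ℕ) : ℝ) + 1 ≤ g := by exact_mod_cast i.2
  have hi0 : (0 : ℝ) ≤ ((i : ℕ) : ℝ) := Nat.cast_nonneg _
  have hbump : ∀ (k : Fin g) (s : ℝ), s ∈ Set.Icc (0 : ℝ) 4 →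
      bump g c (bdryPoint g (4 * (k : ℕ) + s)) = trap (4 * (k : ℕ) + s - c) := by
    intro k s hs
    have hk1 : ((k : ℕ) : ℝ) + 1 ≤ g := by exact_mod_cast k.2
    have hk0 : (0 : ℝ) ≤ ((k : ℕ) : ℝ) := Nat.cast_nonneg _
    refine bump_bdryPoint hg ?_
    rw [abs_le]
    rcases hτ with h | h <;> constructor <;> rw [hc, h] <;> linarith [hs.1, hs.2]
  have hne : ∀ (k : Fin g), k ≠ i → ∀ s ∈ Set.Icc (0 : ℝ) 4, trap (4 * (k : ℕ) + s - c) = 0 := by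
    intro k hk s hs
    apply trap_eq_zero
    rw [le_abs]
    rcases lt_or_gt_of_ne hk with h | h
    · have h' : ((k : ℕ) : ℝ) + 1 ≤ ((i : ℕ) : ℝ) := by exact_mod_cast h
      right
      rcases hτ with h | h <;> rw [hc, h] <;> linarith [hs.1, hs.2]
    · have h' : ((i : ℕ) : ℝ) + 1 ≤ ((k : ℕ) : ℝ) := by exact_mod_cast h
      left
      rcases hτ with h | h <;> rw [hc, h] <;> linarith [hs.1, hs.2]
  have heq : ∀ s : ℝ, trap (4 * (i : ℕ) + s - c) = trap (s - 3 / 2 - (τ : ℕ)) := fun s => by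
    congr 1; rw [hc]; ring
  have hval : ∀ (k : Fin g) (m : Fin 5), bump g c (bdryPoint g (4 * (k : ℕ) + (m : ℕ)))
      = ((if k = i ∧ ((m : ℕ) = τ + 1 ∨ (m : ℕ) = τ + 2) then 1 else 0 : ℤ) : ℝ) := by
    intro k m
    have hm : ((m : ℕ) : ℝ) ∈ Set.Icc (0 : ℝ) 4 :=
      ⟨Nat.cast_nonneg _, by exact_mod_cast Nat.lt_succ_iff.1 m.2⟩
    rw [hbump k _ hm]
    by_cases hk : k = i
    · subst hk
      rw [heq]
      have h1 : ∀ x : ℝ, |x| ≤ 1 / 2 → trap x = ((1 : ℤ) : ℝ) := fun x hx => by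
        rw [trap_eq_one hx]; simp
      have h0 : ∀ x : ℝ, 3 / 2 ≤ |x| → trap x = ((0 : ℤ) : ℝ) := fun x hx => by
        rw [trap_eq_zero hx]; simp
      split_ifs with h
      · apply h1
        rcases h.2 with h | h <;> rw [h] <;> push_cast <;> rw [abs_le] <;> constructor <;> linarith
      · apply h0
        have h : ¬ ((m : ℕ) = τ + 1 ∨ (m : ℕ) = τ + 2) := fun h' => h ⟨rfl, h'⟩
        push Not at h
        rw [le_abs]
        rcases Nat.lt_or_ge m (τ + 1) with hlt | hge
        · right
          have : ((m : ℕ) : ℝ) ≤ (τ : ℕ) := by exact_mod_cast Nat.lt_succ_iff.1 hlt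
          linarith
        · left
          have : (τ : ℕ) + 3 ≤ (m : ℕ) := by omega
          have : ((τ : ℕ) : ℝ) + 3 ≤ (m : ℕ) := by exact_mod_cast this
          linarith
    · rw [hne k hk _ hm]
      simp [hk]
  -- The gluing of the two ramps is the reflection in `c`, so the values agree. Of the other pair of
  -- sides in this handle, one carries the constant one and its partner the constant zero; this
  -- gives the integers `1` and `-1` below.
  have hside : ∀ z w, SideRel g z w → ∃ n : ℤ, bump g c z - bump g c w = n := by
    intro z w h
    cases h with
    | sideA k s hs =>
      have e1 := hbump k s ⟨hs.1, by linarith [hs.2]⟩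
      have e2 := hbump k (3 - s) ⟨by linarith [hs.2], by linarith [hs.1]⟩
      rw [← add_sub_assoc] at e2
      rw [e1, e2]
      by_cases hk : k = i
      · subst hk
        rw [add_sub_assoc (4 * _) 3 s, heq, heq]
        rcases hτ with h | h
        · refine ⟨0, ?_⟩
          rw [h, ← trap_neg]
          simp only [Int.cast_zero, sub_eq_zero]
          congr 1; ring
        · refine ⟨-1, ?_⟩
          rw [h, trap_eq_zero, trap_eq_one]
          · simp
          · rw [abs_le]; constructor <;> linarith [hs.1, hs.2]
          · rw [le_abs]; right; linarith [hs.1, hs.2]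
      · refine ⟨0, ?_⟩
        rw [hne k hk s ⟨hs.1, by linarith [hs.2]⟩, add_sub_assoc (4 * _) 3 s,
          hne k hk (3 - s) ⟨by linarith [hs.2], by linarith [hs.1]⟩]
        simp
    | sideB k s hs =>
      have e1 := hbump k (1 + s) ⟨by linarith [hs.1], by linarith [hs.2]⟩
      have e2 := hbump k (4 - s) ⟨by linarith [hs.2], by linarith [hs.1]⟩
      rw [← add_assoc] at e1
      rw [← add_sub_assoc] at e2
      rw [e1, e2]
      by_cases hk : k = i
      · subst hk
        rw [add_sub_assoc (4 * _) 4 s, add_assoc, heq, heq]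
        rcases hτ with h | h
        · refine ⟨1, ?_⟩
          rw [h, trap_eq_one, trap_eq_zero]
          · simp
          · rw [le_abs]; left; linarith [hs.1, hs.2]
          · rw [abs_le]; constructor <;> linarith [hs.1, hs.2]
        · refine ⟨0, ?_⟩
          rw [h, ← trap_neg]
          simp only [Int.cast_zero, sub_eq_zero]
          congr 1; ring
      · refine ⟨0, ?_⟩
        rw [add_assoc, hne k hk (1 + s) ⟨by linarith [hs.1], by linarith [hs.2]⟩,
          add_sub_assoc (4 * _) 4 s,
          hne k hk (4 - s) ⟨by linarith [hs.2], by linarith [hs.1]⟩]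
        simp
    | sphere hg' => omega
  obtain ⟨d, hd⟩ := M.exists_cocycle (bump g c)
    (bump_zero _ _ (by rw [toDisc_of_norm_le (by simp)])) hside
  refine ⟨d, fun k m => hd _ _ ?_⟩
  rw [toDisc_arc]
  exact hval k m

end PolygonModel

/-! ### Cup products on boundaries, and the polygon as a two-cycle -/

section CupBoundary

open Simplicial

variable {S : SSet.{u}}

lemma evalChain_single {M : Type*} [AddCommGroup M] {n : ℕ} (φ : S _⦋n⦌ → M) (σ : S _⦋n⦌) (m : ℤ) :
    evalChain φ (Finsupp.single σ m) = m • φ σ := by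
  simp [evalChain]

lemma evalChain_add_chain {M : Type*} [AddCommGroup M] {n : ℕ} (φ : S _⦋n⦌ → M)
    (c d : S _⦋n⦌ →₀ ℤ) : evalChain φ (c + d) = evalChain φ c + evalChain φ d := map_add _ _ _

lemma evalChain_sub_chain {M : Type*} [AddCommGroup M] {n : ℕ} (φ : S _⦋n⦌ → M)
    (c d : S _⦋n⦌ →₀ ℤ) : evalChain φ (c - d) = evalChain φ c - evalChain φ d := map_sub _ _ _

lemma evalChain_sum_chain {M ι : Type*} [AddCommGroup M] {n : ℕ} (φ : S _⦋n⦌ → M)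
    (s : Finset ι) (c : ι → S _⦋n⦌ →₀ ℤ) :
    evalChain φ (∑ i ∈ s, c i) = ∑ i ∈ s, evalChain φ (c i) := map_sum _ _ _

lemma boundary_one_single (σ : S _⦋2⦌) : boundary S 1 (Finsupp.single σ 1) =
    Finsupp.single (S.δ 0 σ) 1 - Finsupp.single (S.δ 1 σ) 1 + Finsupp.single (S.δ 2 σ) 1 := by
  simp [boundary, Fin.sum_univ_three, sub_eq_add_neg]

/-- The cup product of two one-cocycles is a cocycle. -/
lemma evalChain_cup_boundary {R A B M : Type*} [CommRing R] [AddCommGroup A] [Module R A]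
    [AddCommGroup B] [Module R B] [AddCommGroup M] [Module R M] (Q : A →ₗ[R] B →ₗ[R] M)
    (a : Cocycle S R A) (b : Cocycle S R B) (e : S _⦋3⦌ →₀ ℤ) :
    evalChain (cup Q a.1 b.1) (boundary S 2 e) = 0 := by
  have : (Finsupp.linearCombination ℤ (cup Q a.1 b.1)).comp (boundary S 2) = 0 := by
    ext σ
    have e12 : S.δ 2 (S.δ 0 σ) = S.δ 0 (S.δ 3 σ) :=
      (S.δ_comp_δ_apply (i := (0 : Fin 3)) (j := 2) (by decide) σ).symm
    have e23 : S.δ 0 (S.δ 0 σ) = S.δ 0 (S.δ 1 σ) :=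
      (S.δ_comp_δ_apply (i := (0 : Fin 3)) (j := 0) le_rfl σ).symm
    have e01 : S.δ 2 (S.δ 2 σ) = S.δ 2 (S.δ 3 σ) :=
      (S.δ_comp_δ_apply (i := (2 : Fin 3)) (j := 2) le_rfl σ).symm
    have e02 : S.δ 2 (S.δ 1 σ) = S.δ 1 (S.δ 3 σ) :=
      (S.δ_comp_δ_apply (i := (1 : Fin 3)) (j := 2) (by decide) σ).symm
    have e13 : S.δ 0 (S.δ 2 σ) = S.δ 1 (S.δ 0 σ) :=
      (S.δ_comp_δ_apply (i := (0 : Fin 3)) (j := 1) (by decide) σ)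
    have ha := cocycle_eq a (S.δ 3 σ)
    have hb := cocycle_eq b (S.δ 0 σ)
    have h : cup Q a.1 b.1 (S.δ 0 σ) - cup Q a.1 b.1 (S.δ 1 σ) + cup Q a.1 b.1 (S.δ 2 σ)
        - cup Q a.1 b.1 (S.δ 3 σ) = 0 := by
      simp only [cup]
      rw [e02, ha, e13, hb, e12, ← e23, e01]
      simp only [map_add, LinearMap.add_apply]
      abel
    simp only [LinearMap.comp_apply, Finsupp.lsingle_apply, LinearMap.zero_apply]
    rw [← h]
    simp [boundary, Fin.sum_univ_four, sub_eq_add_neg]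
  exact congrArg (fun f => f e) this

/-- Cup products evaluated on two-cycles are multiples of those evaluated on a fundamental cycle. -/
lemma IsFundamentalCycle.exists_mul {z : Cycle S} (hz : IsFundamentalCycle S z) (w : Cycle S) :
    ∃ m : ℤ, ∀ a b : Cocycle S ℤ ℤ, cupCocycle (LinearMap.mul ℤ ℤ) w a b
      = m * cupCocycle (LinearMap.mul ℤ ℤ) z a b := by
  have hw : (Submodule.Quotient.mk w : H2 S) ∈ Submodule.span ℤ {(Submodule.Quotient.mk z : H2 S)} := by
    rw [hz]; trivial
  obtain ⟨m, hm⟩ := Submodule.mem_span_singleton.1 hw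
  refine ⟨m, fun a b => ?_⟩
  rw [← Submodule.Quotient.mk_smul, Submodule.Quotient.eq] at hm
  obtain ⟨e, he⟩ := hm
  have h := evalChain_cup_boundary (LinearMap.mul ℤ ℤ) a b e
  rw [he] at h
  have h' : m * evalChain (cup (LinearMap.mul ℤ ℤ) a.1 b.1) z.1
      - evalChain (cup (LinearMap.mul ℤ ℤ) a.1 b.1) w.1 = 0 := by
    have h1 : evalChain (cup (LinearMap.mul ℤ ℤ) a.1 b.1) (m • z.1 - w.1) = 0 := h
    rw [evalChain_sub_chain] at h1
    have h2 : evalChain (cup (LinearMap.mul ℤ ℤ) a.1 b.1) (m • z.1)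
      = m • evalChain (cup (LinearMap.mul ℤ ℤ) a.1 b.1) z.1 := map_smul _ _ _
    rwa [h2] at h1
  exact (sub_eq_zero.1 h').symm

end CupBoundary

section Square

variable {X : Type u} [TopologicalSpace X]

/-- The chain of a singular square, divided into two triangles. -/
def squareChain (H : C(ℝ × ℝ, X)) :=
  Finsupp.single (aff H ![((0 : ℝ), (0 : ℝ)), (0, 1), (1, 1)]) (1 : ℤ)
    - Finsupp.single (aff H ![((0 : ℝ), (0 : ℝ)), (1, 0), (1, 1)]) 1

lemma boundary_squareChain (H : C(ℝ × ℝ, X)) :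
    boundary (Sing X) 1 (squareChain H) =
      Finsupp.single (aff H ![((0 : ℝ), (1 : ℝ)), (1, 1)]) 1
      + Finsupp.single (aff H ![((0 : ℝ), (0 : ℝ)), (0, 1)]) 1
      - Finsupp.single (aff H ![((1 : ℝ), (0 : ℝ)), (1, 1)]) 1
      - Finsupp.single (aff H ![((0 : ℝ), (0 : ℝ)), (1, 0)]) 1 := by
  rw [squareChain, map_sub, boundary_one_single, boundary_one_single]
  simp only [δ_zero_aff₂, δ_one_aff₂, δ_two_aff₂]
  abel

end Square

lemma arc_four_mul (g : ℕ) : arc g (4 * g) = arc g 0 := by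
  rcases Nat.eq_zero_or_pos g with rfl | hg
  · simp
  · refine congrArg (fun c : Circle => (c : ℂ)) (Circle.exp_eq_exp.2 ⟨1, ?_⟩)
    have : (g : ℝ) ≠ 0 := by exact_mod_cast hg.ne'
    field_simp
    push_cast
    ring

namespace PolygonModel

variable {g : ℕ} {X : Type u} [TopologicalSpace X] (M : PolygonModel g X)

/-- The sector of the polygon between the parameters `x` and `y`. -/
def sector (x y : ℝ) : C(ℝ × ℝ, X) :=
  ⟨fun p => M.Q (p.2 • arc g (x + p.1 * (y - x))), by fun_prop⟩

lemma sector_left (x y : ℝ) :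
    aff (M.sector x y) ![((0 : ℝ), (0 : ℝ)), (0, 1)] = aff M.Q ![0, arc g x] :=
  aff_congr _ _ _ _ _ _ fun t _ => by simp [sector]

lemma sector_right (x y : ℝ) :
    aff (M.sector x y) ![((1 : ℝ), (0 : ℝ)), (1, 1)] = aff M.Q ![0, arc g y] :=
  aff_congr _ _ _ _ _ _ fun t _ => by simp [sector]

lemma sector_bottom (x y : ℝ) :
    aff (M.sector x y) ![((0 : ℝ), (0 : ℝ)), (1, 0)] = aff M.Q ![0, 0] :=
  aff_congr _ _ _ _ _ _ fun t _ => by simp [sector]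

lemma sector_top (x y : ℝ) :
    aff (M.sector x y) ![((0 : ℝ), (1 : ℝ)), (1, 1)] = aff M.rim ![x, y] :=
  aff_congr _ _ _ _ _ _ fun t _ => by
    simp only [sector, rim, ContinuousMap.coe_mk, ContinuousMap.comp_apply, Prod.smul_mk,
      Prod.mk_add_mk, smul_eq_mul]
    rw [show (1 - t) * 1 + t * 1 = (1 : ℝ) by ring, one_smul]
    congr 2; ring

lemma boundary_sector (x y : ℝ) :
    boundary (Sing X) 1 (squareChain (M.sector x y)) =
      Finsupp.single (aff M.rim ![x, y]) 1 + Finsupp.single (aff M.Q ![0, arc g x]) 1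
      - Finsupp.single (aff M.Q ![0, arc g y]) 1 - Finsupp.single (aff M.Q ![0, 0]) 1 := by
  rw [boundary_squareChain, sector_left, sector_right, sector_bottom, sector_top]

variable {R A B N : Type*} [CommRing R] [AddCommGroup A] [Module R A]
    [AddCommGroup B] [Module R B] [AddCommGroup N] [Module R N]

/-- Of the two triangles, the one through `(1, 0)` has a constant front edge and contributes
nothing. The other has the spoke at `x` as front edge and the boundary arc as back edge. -/
lemma evalChain_sector (Q : A →ₗ[R] B →ₗ[R] N) (a : Cocycle (Sing X) R A) (b : Cocycle (Sing X) R B)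
    (x y : ℝ) : evalChain (cup Q a.1 b.1) (squareChain (M.sector x y)) =
      Q (a.1 (aff M.Q ![0, arc g x]))
        (b.1 (aff M.Q ![0, arc g y]) - b.1 (aff M.Q ![0, arc g x])) := by
  rw [squareChain, evalChain_sub_chain, evalChain_single, evalChain_single, one_smul, one_smul]
  simp only [cup, δ_zero_aff₂, δ_two_aff₂]
  rw [sector_left, sector_bottom, sector_top, cocycle_aff_self a, map_zero, LinearMap.zero_apply,
    sub_zero]
  exact congrArg _ (cocycle_aff_comp b M.Q (arc g) x y)

lemma rim_sideA (k : Fin g) :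
    aff M.rim ![(4 * (k : ℕ) : ℝ), 4 * (k : ℕ) + 1]
      = aff M.rim ![(4 * (k : ℕ) + 3 : ℝ), 4 * (k : ℕ) + 2] :=
  aff_congr _ _ _ _ _ _ fun t ht => by
    have := M.Q_sideA k ht
    simp only [rim, ContinuousMap.comp_apply, smul_eq_mul]
    convert this using 3 <;> ring

lemma rim_sideB (k : Fin g) :
    aff M.rim ![(4 * (k : ℕ) + 1 : ℝ), 4 * (k : ℕ) + 2]
      = aff M.rim ![(4 * (k : ℕ) + 4 : ℝ), 4 * (k : ℕ) + 3] :=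
  aff_congr _ _ _ _ _ _ fun t ht => by
    have := M.Q_sideB k ht
    simp only [rim, ContinuousMap.comp_apply, smul_eq_mul]
    convert this using 3 <;> ring

/-- The part of the polygon belonging to one handle, as a chain. -/
def handleChain (k : ℕ) :=
  squareChain (M.sector (4 * k) (4 * k + 1)) + squareChain (M.sector (4 * k + 1) (4 * k + 2))
    - squareChain (M.sector (4 * k + 3) (4 * k + 2)) - squareChain (M.sector (4 * k + 4) (4 * k + 3))

/-- Inverse sides enter as sectors taken backwards with a minus sign, so the four boundary arcs
cancel in pairs under the gluing. The constant edges cancel too, and the spokes telescope. -/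
lemma boundary_handleChain (k : Fin g) :
    boundary (Sing X) 1 (M.handleChain k) =
      Finsupp.single (aff M.Q ![0, arc g (4 * (k : ℕ))]) 1
      - Finsupp.single (aff M.Q ![0, arc g (4 * ((k + 1 : ℕ) : ℝ))]) 1 := by
  rw [handleChain, map_sub, map_sub, map_add]
  simp only [boundary_sector]
  rw [rim_sideA, rim_sideB, show (4 * ((k + 1 : ℕ) : ℝ)) = 4 * (k : ℕ) + 4 by push_cast; ring]
  abel

/-- The polygon as a two-cycle. -/
def polygonCycle : Cycle (Sing X) := ⟨∑ k : Fin g, M.handleChain k, by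
  rw [LinearMap.mem_ker, map_sum]
  simp only [boundary_handleChain]
  rw [Fin.sum_univ_eq_sum_range (fun k : ℕ => Finsupp.single (aff M.Q ![0, arc g (4 * (k : ℝ))]) (1 : ℤ)
      - Finsupp.single (aff M.Q ![0, arc g (4 * ((k + 1 : ℕ) : ℝ))]) 1), Finset.sum_range_sub']
  -- After summation over the handles only the first and the last spoke remain, and they coincide.
  rw [arc_four_mul]
  simp⟩

lemma cupCocycle_polygonCycle (Q : A →ₗ[R] B →ₗ[R] N) (a : Cocycle (Sing X) R A)
    (b : Cocycle (Sing X) R B) (α : Fin g → Fin 5 → A) (β : Fin g → Fin 5 → B)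
    (hα : ∀ (k : Fin g) (m : Fin 5), a.1 (aff M.Q ![0, arc g (4 * (k : ℕ) + (m : ℕ))]) = α k m)
    (hβ : ∀ (k : Fin g) (m : Fin 5), b.1 (aff M.Q ![0, arc g (4 * (k : ℕ) + (m : ℕ))]) = β k m) :
    cupCocycle Q M.polygonCycle a b = ∑ k, (Q (α k 0) (β k 1 - β k 0) + Q (α k 1) (β k 2 - β k 1)
      - Q (α k 3) (β k 2 - β k 3) - Q (α k 4) (β k 3 - β k 4)) := by
  change evalChain (cup Q a.1 b.1) (∑ k : Fin g, M.handleChain k) = _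
  rw [evalChain_sum_chain]
  refine Finset.sum_congr rfl fun k _ => ?_
  have a0 := hα k 0
  have a1 := hα k 1
  have a3 := hα k 3
  have a4 := hα k 4
  have b0 := hβ k 0
  have b1 := hβ k 1
  have b2 := hβ k 2
  have b3 := hβ k 3
  have b4 := hβ k 4
  simp only [Fin.coe_ofNat_eq_mod, Nat.zero_mod, Nat.cast_zero, add_zero] at a0 b0
  simp only [Fin.coe_ofNat_eq_mod, Nat.one_mod, Nat.cast_one] at a1 b1
  norm_num at b2 a3 b3 a4 b4
  rw [handleChain, evalChain_sub_chain, evalChain_sub_chain, evalChain_add_chain]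
  simp only [evalChain_sector]
  rw [a0, a1, a3, a4, b0, b1, b2, b3, b4]

end PolygonModel

/-! ### Classes `x ⊗ τ`, generators of cohomology and the intersection form -/

section Coefficients

variable {S : SSet.{u}} (R : Type*) {A : Type*} [CommRing R] [AddCommGroup A] [Module R A]

/-- The map `n ↦ n • τ`. -/
def smulMap (τ : A) : ℤ →ₛₗ[Int.castRingHom R] A where
  toFun n := n • τ
  map_add' _ _ := add_smul _ _ _
  map_smul' m n := by rw [smul_eq_mul, mul_smul, eq_intCast, Int.cast_smul_eq_zsmul]

/-- The class `x ⊗ τ` of `H¹(S; A)`, for `x ∈ H¹(S; ℤ)` and `τ ∈ A`. -/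
def tens (x : H1 S ℤ ℤ) (τ : A) : H1 S R A := H1.map (smulMap R τ) x

lemma tens_mk (c : Cocycle S ℤ ℤ) (τ : A) :
    tens R (Submodule.Quotient.mk c) τ = Submodule.Quotient.mk (Cocycle.map (smulMap R τ) c) := rfl

lemma tens_add_left (x y : H1 S ℤ ℤ) (τ : A) : tens R (x + y) τ = tens R x τ + tens R y τ :=
  map_add _ _ _

lemma tens_add_right (x : H1 S ℤ ℤ) (τ τ' : A) : tens R x (τ + τ') = tens R x τ + tens R x τ' := by
  induction x using Submodule.Quotient.induction_on with | _ c => ?_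
  simp only [tens_mk, ← Submodule.Quotient.mk_add]
  congr 1
  apply Subtype.ext
  funext σ
  exact smul_add (c.1 σ) τ τ'

lemma tens_smul_right (x : H1 S ℤ ℤ) (r : R) (τ : A) : tens R x (r • τ) = r • tens R x τ := by
  induction x using Submodule.Quotient.induction_on with | _ c => ?_
  simp only [tens_mk, ← Submodule.Quotient.mk_smul]
  congr 1
  apply Subtype.ext
  funext σ
  exact smul_comm (c.1 σ) r τ

/-- `τ ↦ x ⊗ τ`. -/
def tensHom (x : H1 S ℤ ℤ) : A →ₗ[R] H1 S R A where
  toFun := tens R x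
  map_add' := tens_add_right R x
  map_smul' := tens_smul_right R x

lemma tens_zsmul_left (m : ℤ) (x : H1 S ℤ ℤ) (τ : A) : tens R (m • x) τ = tens R x (m • τ) := by
  induction x using Submodule.Quotient.induction_on with | _ c => ?_
  simp only [tens_mk, ← Submodule.Quotient.mk_smul]
  congr 1
  apply Subtype.ext
  funext σ
  change (m * c.1 σ) • τ = c.1 σ • m • τ
  rw [mul_comm, mul_smul]

lemma tens_sum_left {ι : Type*} (s : Finset ι) (x : ι → H1 S ℤ ℤ) (τ : A) :
    tens R (∑ i ∈ s, x i) τ = ∑ i ∈ s, tens R (x i) τ := map_sum (H1.map (smulMap R τ)) _ _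

lemma tens_int (x : H1 S ℤ ℤ) (m : ℤ) : tens ℤ x m = m • x := by
  induction x using Submodule.Quotient.induction_on with | _ c => ?_
  rw [tens_mk, ← Submodule.Quotient.mk_smul]
  congr 1
  apply Subtype.ext
  funext σ
  change c.1 σ • m = m * c.1 σ
  rw [smul_eq_mul, mul_comm]

end Coefficients

section Pairing

variable {S : SSet.{u}} {R A B N : Type*} [CommRing R] [AddCommGroup A] [Module R A]
    [AddCommGroup B] [Module R B] [AddCommGroup N] [Module R N]

/-- The cup product pairing on `H¹(S; ℤ)`. -/
abbrev intPairing (z : Cycle S) : H1 S ℤ ℤ →ₗ[ℤ] H1 S ℤ ℤ →ₗ[ℤ] ℤ := cupPairing (LinearMap.mul ℤ ℤ) z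

lemma cupPairing_swap (Q : A →ₗ[R] B →ₗ[R] N) (z : Cycle S) (x : H1 S R A) (y : H1 S R B) :
    cupPairing Q.flip z y x = - cupPairing Q z x y := by
  induction x using Submodule.Quotient.induction_on with | _ a => ?_
  induction y using Submodule.Quotient.induction_on with | _ b => ?_
  exact cupCocycle_flip Q z a b

lemma intPairing_swap (z : Cycle S) (x y : H1 S ℤ ℤ) :
    intPairing z y x = - intPairing z x y := by
  have h : (LinearMap.mul ℤ ℤ).flip = LinearMap.mul ℤ ℤ := by ext; simp
  have := cupPairing_swap (LinearMap.mul ℤ ℤ) z x y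
  rwa [h] at this

end Pairing

namespace PolygonModel

variable {g : ℕ} {X : Type u} [TopologicalSpace X] (M : PolygonModel g X)
  {R A : Type*} [CommRing R] [AddCommGroup A] [Module R A]

/-- The cocycle with period one along the side `a i` or `b i`. -/
def dualCocycle (i : Fin g) (τ : Fin 2) : Cocycle (Sing X) ℤ ℤ := (M.exists_dual_cocycle i τ).choose

lemma dualCocycle_apply (i : Fin g) (τ : Fin 2) (k : Fin g) (m : Fin 5) :
    (M.dualCocycle i τ).1 (aff M.Q ![0, arc g (4 * (k : ℕ) + (m : ℕ))])
        = if k = i ∧ ((m : ℕ) = τ + 1 ∨ (m : ℕ) = τ + 2) then 1 else 0 :=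
  (M.exists_dual_cocycle i τ).choose_spec k m

/-- The cohomology class with period one along the side `a i` or `b i`. -/
def dualClass (i : Fin g) (τ : Fin 2) : H1 (Sing X) ℤ ℤ := Submodule.Quotient.mk (M.dualCocycle i τ)

lemma period_a (i : Fin g) (τ : Fin 2) (k : Fin g) :
    (M.dualCocycle i τ).1 (aff M.rim ![(4 * (k : ℕ) : ℝ), 4 * (k : ℕ) + 1])
      = if k = i ∧ τ = 0 then 1 else 0 := by
  rw [rim, cocycle_aff_comp]
  have h0 := M.dualCocycle_apply i τ k 0
  have h1 := M.dualCocycle_apply i τ k 1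
  simp only [Fin.coe_ofNat_eq_mod, Nat.zero_mod, Nat.one_mod, Nat.cast_zero, Nat.cast_one, add_zero]
    at h0 h1
  rw [h0, h1]
  by_cases hk : k = i <;> fin_cases τ <;> simp [hk]

lemma period_b (i : Fin g) (τ : Fin 2) (k : Fin g) :
    (M.dualCocycle i τ).1 (aff M.rim ![(4 * (k : ℕ) + 1 : ℝ), 4 * (k : ℕ) + 2])
      = if k = i ∧ τ = 1 then 1 else 0 := by
  rw [rim, cocycle_aff_comp]
  have h0 := M.dualCocycle_apply i τ k 1
  have h1 := M.dualCocycle_apply i τ k 2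
  simp only [Fin.coe_ofNat_eq_mod, Nat.one_mod, Nat.cast_one, Nat.reduceMod, Nat.cast_ofNat]
    at h0 h1
  rw [h0, h1]
  by_cases hk : k = i <;> fin_cases τ <;> simp [hk]

/-- Every class with coefficients in `A` is a combination of the dual classes. -/
lemma exists_eq_sum_dualClass (v : H1 (Sing X) R A) : ∃ α β : Fin g → A,
    v = ∑ i, tens R (M.dualClass i 0) (α i) + ∑ i, tens R (M.dualClass i 1) (β i) := by
  induction v using Submodule.Quotient.induction_on with | _ c => ?_
  set α : Fin g → A := fun i => c.1 (aff M.rim ![(4 * (i : ℕ) : ℝ), 4 * (i : ℕ) + 1]) with hα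
  set β : Fin g → A := fun i => c.1 (aff M.rim ![(4 * (i : ℕ) + 1 : ℝ), 4 * (i : ℕ) + 2]) with hβ
  refine ⟨α, β, ?_⟩
  let d : Cocycle (Sing X) R A :=
    ∑ i, Cocycle.map (smulMap R (α i)) (M.dualCocycle i 0)
      + ∑ i, Cocycle.map (smulMap R (β i)) (M.dualCocycle i 1)
  have hd : (∑ i, tens R (M.dualClass i 0) (α i) + ∑ i, tens R (M.dualClass i 1) (β i))
      = (Submodule.Quotient.mk d : H1 (Sing X) R A) := by
    simp only [dualClass, tens_mk, d, Submodule.Quotient.mk_add]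
    congr 1 <;> exact (map_sum (Submodule.mkQ (Coboundary (Sing X) R A)) _ _).symm
  have hdv : ∀ σ, d.1 σ = ∑ i, (M.dualCocycle i 0).1 σ • α i + ∑ i, (M.dualCocycle i 1).1 σ • β i := by
    intro σ
    simp only [d, Submodule.coe_add, Submodule.coe_sum, Pi.add_apply, Finset.sum_apply]
    rfl
  rw [hd, Submodule.Quotient.eq]
  -- The coefficients were chosen as the periods of `c`, so the difference has no periods.
  refine M.mem_coboundary _ (fun k => ?_) (fun k => ?_)
  · change c.1 _ - d.1 _ = 0
    rw [hdv]
    simp [period_a, hα]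
  · change c.1 _ - d.1 _ = 0
    rw [hdv]
    simp [period_b, hβ]

lemma cupCocycle_polygonCycle_dual (i j : Fin g) (τ τ' : Fin 2) :
    cupCocycle (LinearMap.mul ℤ ℤ) M.polygonCycle (M.dualCocycle i τ) (M.dualCocycle j τ')
      = if i = j then (τ' : ℤ) - (τ : ℤ) else 0 := by
  rw [M.cupCocycle_polygonCycle _ _ _ _ _ (M.dualCocycle_apply i τ) (M.dualCocycle_apply j τ')]
  by_cases hij : i = j
  · subst hij
    rw [Finset.sum_eq_single i]
    · fin_cases τ <;> fin_cases τ' <;> simp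
    · intro k _ hk
      simp [hk]
    · simp
  · rw [if_neg hij]
    refine Finset.sum_eq_zero fun k _ => ?_
    by_cases hk : k = i
    · have : k ≠ j := fun h => hij (hk.symm.trans h)
      simp [this]
    · simp [hk]

/-- The intersection form with respect to a fundamental cycle is the standard one, up to sign. -/
lemma exists_sign_intPairing {z : Cycle (Sing X)} (hz : IsFundamentalCycle (Sing X) z) :
    ∃ ε : ℤ, ε * ε = 1 ∧ ∀ (i j : Fin g) (τ τ' : Fin 2),
      intPairing z (M.dualClass i τ) (M.dualClass j τ')
        = if i = j then ε * ((τ' : ℤ) - (τ : ℤ)) else 0 := by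
  obtain ⟨m, hm⟩ := hz.exists_mul M.polygonCycle
  rcases Nat.eq_zero_or_pos g with rfl | hg
  · exact ⟨1, by simp, fun i => i.elim0⟩
  · have hm' := fun i j τ τ' => hm (M.dualCocycle i τ) (M.dualCocycle j τ')
    simp only [cupCocycle_polygonCycle_dual] at hm'
    have h1 := hm' ⟨0, hg⟩ ⟨0, hg⟩ 0 1
    simp at h1
    -- The product of the first dual pair is `1` on the polygon and `m` times an integer by
    -- comparison with `z`, so `m` is a unit.
    have hmm : m * m = 1 := by
      rcases Int.isUnit_iff.1 (IsUnit.of_mul_eq_one _ h1.symm) with h | h <;> simp [h]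
    refine ⟨m, hmm, fun i j τ τ' => ?_⟩
    change cupCocycle _ _ _ _ = _
    have h := hm' i j τ τ'
    have h2 : cupCocycle (LinearMap.mul ℤ ℤ) z (M.dualCocycle i τ) (M.dualCocycle j τ')
        = m * if i = j then (τ' : ℤ) - (τ : ℤ) else 0 := by
      rw [h, ← mul_assoc, hmm, one_mul]
    rw [h2]
    split_ifs <;> simp

end PolygonModel

/-! ### Frames adapted to rational Lagrangians -/

section Frames

variable {H : Type*} [AddCommGroup H]

/-- The combination `∑ mᵢ uᵢ + ∑ nᵢ wᵢ`. -/
def frameMap {k : ℕ} (u w : Fin k → H) : ((Fin k → ℤ) × (Fin k → ℤ)) →ₗ[ℤ] H :=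
  (Fintype.linearCombination ℤ u).coprod (Fintype.linearCombination ℤ w)

lemma frameMap_apply {k : ℕ} (u w : Fin k → H) (m n : Fin k → ℤ) :
    frameMap u w (m, n) = ∑ i, m i • u i + ∑ i, n i • w i := by
  simp [frameMap, Fintype.linearCombination_apply]

variable (B : H →ₗ[ℤ] H →ₗ[ℤ] ℤ)

/-- Pairing a relation with the isotropic vectors `u` kills the coefficients of `w`; pairing with
`w` then kills the others. Nothing is needed about `B (w i) (w j)`. -/
lemma frameMap_injective {k : ℕ} {u w : Fin k → H} {ε : ℤ} (hε : ε * ε = 1)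
    (huw : ∀ i j, B (u i) (w j) = if i = j then ε else 0) (huu : ∀ i j, B (u i) (u j) = 0) :
    Function.Injective (frameMap u w) := by
  rw [injective_iff_map_eq_zero]
  rintro ⟨m, n⟩ h
  rw [frameMap_apply] at h
  have hε0 : ε ≠ 0 := fun h => by simp [h] at hε
  have hn : n = 0 := by
    funext j
    have := congrArg (B (u j)) h
    simpa [huu, huw, hε0] using this
  have hm : m = 0 := by
    funext j
    have := congrArg (fun x => B x (w j)) h
    simpa [huw, hn, hε0, LinearMap.sum_apply] using this
  rw [hm, hn]; rfl

lemma finrank_of_frame {k : ℕ} {u w : Fin k → H} {ε : ℤ} (hε : ε * ε = 1)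
    (huw : ∀ i j, B (u i) (w j) = if i = j then ε else 0) (huu : ∀ i j, B (u i) (u j) = 0)
    (hs : Function.Surjective (frameMap u w)) : Module.finrank ℤ H = k + k := by
  rw [← (LinearEquiv.ofBijective _ ⟨frameMap_injective B hε huw huu, hs⟩).finrank_eq]
  simp

/-- A saturated subgroup that is equal to its annihilator for a unimodular alternating form has a
basis that is part of a frame. -/
lemma exists_frame [Module.Finite ℤ H] [Module.IsTorsionFree ℤ H] {g : ℕ}
    (hg : Module.finrank ℤ H = g + g) (huni : ∀ φ : H →ₗ[ℤ] ℤ, ∃ f, ∀ x, B x f = φ x)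
    (N : Submodule ℤ H) (hsat : ∀ (n : ℤ) (x : H), n ≠ 0 → n • x ∈ N → x ∈ N)
    (hiso : ∀ x ∈ N, ∀ y ∈ N, B x y = 0) (hmax : ∀ x, (∀ y ∈ N, B y x = 0) → x ∈ N) :
    ∃ e f : Fin g → H, (∀ i, e i ∈ N) ∧ (∀ i j, B (e i) (f j) = if i = j then 1 else 0) ∧
      Function.Surjective (frameMap e f) := by
  -- Saturation makes the quotient torsion-free, hence free. The projection to it splits, and the
  -- splitting gives a retraction `π` of `H` onto `N`.
  have : Module.IsTorsionFree ℤ (H ⧸ N) := by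
    rw [Module.isTorsionFree_iff_smul_eq_zero]
    intro n x hx
    induction x using Submodule.Quotient.induction_on with | _ x => ?_
    rw [or_iff_not_imp_left]
    intro hn
    rw [← Submodule.Quotient.mk_smul, Submodule.Quotient.mk_eq_zero] at hx
    exact (Submodule.Quotient.mk_eq_zero N).2 (hsat n x hn hx)
  have : Module.Free ℤ (H ⧸ N) := inferInstance
  have : Module.Free ℤ N := inferInstance
  obtain ⟨s, hs⟩ := Module.projective_lifting_property N.mkQ LinearMap.id N.mkQ_surjective
  let π : H →ₗ[ℤ] N := (LinearMap.id - s.comp N.mkQ).codRestrict N fun x => by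
    have h1 : N.mkQ (s (N.mkQ x)) = N.mkQ x := congrArg (fun f => f (N.mkQ x)) hs
    rw [← Submodule.Quotient.mk_eq_zero]
    change N.mkQ (x - s (N.mkQ x)) = 0
    rw [map_sub, h1, sub_self]
  have hπ : ∀ x : N, π x = x := fun x => by
    apply Subtype.ext
    have h1 : N.mkQ (x : H) = 0 := (Submodule.Quotient.mk_eq_zero N).2 x.2
    change (x : H) - s (N.mkQ x) = x
    rw [h1, map_zero, sub_zero]
  obtain ⟨k, ⟨e⟩⟩ : ∃ k, Nonempty (Module.Basis (Fin k) ℤ N) := ⟨_, ⟨Module.finBasis ℤ N⟩⟩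
  -- The coordinate functionals of `N`, extended to `H` by `π`, are represented by unimodularity.
  -- The vectors `f i` need not be isotropic.
  choose f hf using fun i => huni ((e.coord i).comp π)
  have hef : ∀ i j, B (e i) (f j) = if i = j then 1 else 0 := fun i j => by
    rw [hf, LinearMap.comp_apply, hπ]
    simp [Finsupp.single_apply]
  have hsurj : Function.Surjective (frameMap (fun i => (e i : H)) f) := by
    intro x
    -- The remainder is orthogonal to the basis of `N`, so it lies in `N` by maximality.
    have hx : x - ∑ i, B (e i) x • f i ∈ N := by
      refine hmax _ fun y hy => ?_
      have hy' : (∑ i, e.repr ⟨y, hy⟩ i • (e i : H)) = y := by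
        have := congrArg Subtype.val (e.sum_repr ⟨y, hy⟩)
        simpa only [Submodule.coe_sum, Submodule.coe_smul] using this
      have h0 : ∀ i, B (e i) (x - ∑ i, B (e i) x • f i) = 0 := fun i => by simp [hef]
      rw [← hy', map_sum, LinearMap.sum_apply]
      refine Finset.sum_eq_zero fun i _ => ?_
      rw [map_smul, LinearMap.smul_apply, h0, smul_zero]
    refine ⟨(fun i => e.repr ⟨_, hx⟩ i, fun i => B (e i) x), ?_⟩
    have := congrArg Subtype.val (e.sum_repr ⟨_, hx⟩)
    rw [frameMap_apply]
    simp only [Submodule.coe_sum, Submodule.coe_smul] at this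
    rw [this]
    abel
  have hkg : k = g := by
    have := finrank_of_frame B (u := fun i => (e i : H)) (w := f) (ε := 1) rfl hef
      (fun i j => hiso _ (e i).2 _ (e j).2) hsurj
    omega
  subst hkg
  exact ⟨fun i => e i, f, fun i => (e i).2, hef, hsurj⟩

end Frames

namespace PolygonModel

variable {g : ℕ} {X : Type u} [TopologicalSpace X] (M : PolygonModel g X)

lemma frameMap_dualClass_surjective :
    Function.Surjective (frameMap (fun i => M.dualClass i 0) (fun i => M.dualClass i 1)) := by
  intro x
  obtain ⟨m, n, h⟩ := M.exists_eq_sum_dualClass x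
  refine ⟨(m, n), ?_⟩
  rw [frameMap_apply, h]
  simp only [tens_int]

lemma exists_equiv_int {z : Cycle (Sing X)} (hz : IsFundamentalCycle (Sing X) z) :
    ∃ e : ((Fin g → ℤ) × (Fin g → ℤ)) ≃ₗ[ℤ] H1 (Sing X) ℤ ℤ,
    ∀ x, e x = frameMap (fun i => M.dualClass i 0) (fun i => M.dualClass i 1) x := by
  obtain ⟨ε, hε, h⟩ := M.exists_sign_intPairing hz
  exact ⟨LinearEquiv.ofBijective _ ⟨frameMap_injective (intPairing z) hε
    (fun i j => by simp [h]) (fun i j => by simp [h]), M.frameMap_dualClass_surjective⟩,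
    fun x => rfl⟩

/-- In the basis of dual classes the form is `ε` times the standard symplectic one, so the
representing vector can be written down from the values of `φ`. -/
lemma intPairing_unimodular (M : PolygonModel g X) {z : Cycle (Sing X)} (hz : IsFundamentalCycle (Sing X) z)
    (φ : H1 (Sing X) ℤ ℤ →ₗ[ℤ] ℤ) : ∃ f, ∀ x, intPairing z x f = φ x := by
  obtain ⟨ε, hε, h⟩ := M.exists_sign_intPairing hz
  refine ⟨ε • (∑ i, φ (M.dualClass i 0) • M.dualClass i 1
    - ∑ i, φ (M.dualClass i 1) • M.dualClass i 0), fun x => ?_⟩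
  obtain ⟨⟨m, n⟩, rfl⟩ := M.frameMap_dualClass_surjective x
  rw [frameMap_apply]
  simp only [map_add, map_sum, map_smul, map_sub, LinearMap.add_apply, LinearMap.sum_apply,
    LinearMap.smul_apply, h]
  simp only [Fin.isValue, Fin.val_one, Fin.val_zero, Nat.cast_one, Nat.cast_zero, sub_self, sub_zero,
    zero_sub, mul_zero, mul_one, mul_neg, smul_eq_mul, ite_self, Finset.sum_const_zero, mul_ite,
    Finset.sum_ite_eq', Finset.mem_univ, if_true, mul_add,
    Finset.mul_sum, Finset.sum_neg_distrib, sub_neg_eq_add, add_zero, zero_add]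
  congr 1 <;> refine Finset.sum_congr rfl fun i _ => ?_
  · linear_combination m i * φ (M.dualClass i 0) * hε
  · linear_combination n i * φ (M.dualClass i 1) * hε

end PolygonModel

section Lagrangian

variable {g : ℕ} {X : Type u} [TopologicalSpace X]

/-- The map `H¹(Σ; ℤ) → H¹(Σ; ℝ)`. -/
def toReal : H1 (Sing X) ℤ ℤ →ₛₗ[Int.castRingHom ℝ] H1 (Sing X) ℝ ℝ := H1.map intIncl

lemma cupForm_toReal (z : Cycle (Sing X)) (x y : H1 (Sing X) ℤ ℤ) :
    cupForm z (toReal x) (toReal y) = (intPairing z x y : ℝ) := by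
  induction x using Submodule.Quotient.induction_on with | _ a => ?_
  induction y using Submodule.Quotient.induction_on with | _ b => ?_
  change evalChain (cup _ _ _) z.1 = ((evalChain (cup _ _ _) z.1 : ℤ) : ℝ)
  simp [evalChain, Finsupp.linearCombination_apply, Finsupp.sum, cup, Cocycle.map, intIncl]

/-- The subgroup is that of the integral classes in `L`. It is saturated because `L` is a real
subspace. By rationality an integral class orthogonal to this subgroup is orthogonal to `L`, hence
lies in `L`. -/
lemma IsLagrangian.exists_frame (M : PolygonModel g X) {z : Cycle (Sing X)} (hz : IsFundamentalCycle (Sing X) z)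
    {L : Submodule ℝ (H1 (Sing X) ℝ ℝ)} (hL : IsLagrangian z L) (hLrat : IsRational L) :
    ∃ e f : Fin g → H1 (Sing X) ℤ ℤ, (∀ i, toReal (e i) ∈ L) ∧
      (∀ i j, intPairing z (e i) (f j) = if i = j then 1 else 0) ∧
      Function.Surjective (frameMap e f) := by
  obtain ⟨E, -⟩ := M.exists_equiv_int hz
  have : Module.Finite ℤ (H1 (Sing X) ℤ ℤ) := Module.Finite.equiv E
  have : Module.Free ℤ (H1 (Sing X) ℤ ℤ) := Module.Free.of_equiv E
  have hrank : Module.finrank ℤ (H1 (Sing X) ℤ ℤ) = g + g := by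
    rw [← E.finrank_eq]; simp
  have hzs : ∀ (n : ℤ) (x : H1 (Sing X) ℤ ℤ), toReal (n • x) = (n : ℝ) • toReal x :=
    fun n x => map_smulₛₗ toReal n x
  let N : Submodule ℤ (H1 (Sing X) ℤ ℤ) :=
    { carrier := {x | toReal x ∈ L}
      add_mem' := fun {x y} hx hy => by
        change toReal (x + y) ∈ L
        rw [map_add]; exact L.add_mem hx hy
      zero_mem' := by
        change toReal 0 ∈ L
        rw [map_zero]; exact L.zero_mem
      smul_mem' := fun n x hx => by
        change toReal (n • x) ∈ L
        rw [hzs]; exact L.smul_mem _ hx }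
  refine ToralCS.exists_frame (intPairing z) hrank (M.intPairing_unimodular hz) N ?_ ?_ ?_
  · intro n x hn hx
    change toReal (n • x) ∈ L at hx
    rw [hzs] at hx
    exact (L.smul_mem_iff (Int.cast_ne_zero.2 hn)).1 hx
  · intro x hx y hy
    have := (hL _).1 hx _ hy
    rw [cupForm_toReal] at this
    exact_mod_cast this
  · intro x hx
    refine (hL _).2 fun y hy => ?_
    rw [← hLrat] at hy
    induction hy using Submodule.span_induction with
    | mem y hy =>
      obtain ⟨hyL, y, rfl⟩ := hy
      change cupForm z (toReal x) (toReal y) = 0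
      rw [cupForm_toReal, intPairing_swap, hx y hyL]
      simp
    | zero => simp
    | add y y' _ _ h h' => rw [map_add, h, h', add_zero]
    | smul r y _ h => rw [map_smul, h, smul_zero]

end Lagrangian

/-! ### Automorphy factors, holonomy and flat sections -/

lemma hasDerivAt_of_shift {f : ℝ → ℂ} {f' : ℂ} {t : ℝ} (h : HasDerivAt (fun s => f (t + s)) f' 0) :
    HasDerivAt f f' t := by
  rw [← sub_self t] at h
  simpa using h.comp_sub_const t t

lemma eq_exp_of_hasDerivAt {c : ℂ} {u : ℝ → ℂ} (h : ∀ t, HasDerivAt u (c * u t) t) (t : ℝ) :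
    u t = Complex.exp (t * c) * u 0 := by
  have hd : ∀ t, HasDerivAt (fun t : ℝ => Complex.exp (-(t * c)) * u t) 0 t := fun t => by
    have h1 : HasDerivAt (fun t : ℝ => -((t : ℂ) * c)) (-c) t := by
      have h2 : HasDerivAt (fun t : ℝ => (t : ℂ) * c) c t := by
        simpa using (hasDerivAt_id t).ofReal_comp.mul_const c
      exact h2.fun_neg
    refine (h1.cexp.mul (h t)).congr_deriv ?_
    ring
  have := is_const_of_deriv_eq_zero (fun t => (hd t).differentiableAt) (fun t => (hd t).deriv) t 0
  simp only [Complex.ofReal_zero, zero_mul, neg_zero, Complex.exp_zero, one_mul] at this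
  rw [← this, ← mul_assoc, ← Complex.exp_add]
  simp

section Bundle

variable {V : Type u} [AddCommGroup V] [Module ℝ V] {G : Type v} [AddCommGroup G]
  {ι : G →+ V} {ω : V →ₗ[ℝ] V →ₗ[ℝ] ℝ}

/-- Along the line `t ↦ t • v`, preservation of the connection is a linear ODE with the constant
coefficient `πi ω(ι γ, v)`. -/
lemma PrequantumBundle.factor_eq (ℒ : PrequantumBundle ι ω) (γ : G) (v : V) :
    ℒ.factor γ v = ℒ.factor γ 0 * Circle.exp (Real.pi * ω (ι γ) v) := by
  have hd : ∀ t : ℝ, HasDerivAt (fun t : ℝ => (ℒ.factor γ (t • v) : ℂ))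
      ((Real.pi * ω (ι γ) v * Complex.I) * ℒ.factor γ (t • v)) t := by
    intro t
    have h := ℒ.preserves_conn γ (t • v) v
    simp only [← add_smul] at h
    have h' := hasDerivAt_of_shift (f := fun t : ℝ => (ℒ.factor γ (t • v) : ℂ)) h
    refine h'.congr_deriv ?_
    simp only [connForm, map_add, LinearMap.add_apply]
    push_cast
    ring
  have := eq_exp_of_hasDerivAt hd 1
  apply Circle.coe_injective
  simp only [one_smul, zero_smul, Complex.ofReal_one, one_mul] at this
  rw [this, Circle.coe_mul, Circle.coe_exp, mul_comm]
  push_cast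
  rfl

/-- Reformulation of the condition of trivial holonomy in terms of the automorphy factor. -/
lemma trivialHolonomy_iff (hω : ∀ x y, ω x y = - ω y x) (ℒ : PrequantumBundle ι ω)
    (P : Submodule ℝ V) (ℓ : Set (Torus ι)) : TrivialHolonomy ℒ P ℓ ↔
      ∀ v ∈ preim ι ℓ, ∀ γ : G, ι γ ∈ P → ℒ.factor γ 0 = Circle.exp (2 * Real.pi * ω v (ι γ)) := by
  have hself : ∀ x, ω x x = 0 := fun x => by linarith [hω x x]
  refine forall₂_congr fun v _ => forall₂_congr fun γ _ => ?_
  have hc : ∀ t : ℝ, -connForm ω (v + t • ι γ) (ι γ) = Real.pi * ω v (ι γ) * Complex.I := fun t => by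
    simp only [connForm, map_add, map_smul, LinearMap.add_apply, LinearMap.smul_apply, hself,
      smul_zero, add_zero, neg_neg]
    ring
  have hexp : ∀ x : ℝ, Complex.exp (Real.pi * x * Complex.I) = Circle.exp (Real.pi * x) := fun x => by
    rw [Circle.coe_exp]; push_cast; rfl
  have key : ℒ.factor γ v = Circle.exp (Real.pi * ω v (ι γ)) ↔
      ℒ.factor γ 0 = Circle.exp (2 * Real.pi * ω v (ι γ)) := by
    rw [ℒ.factor_eq, ← eq_mul_inv_iff_mul_eq, ← Circle.exp_neg, ← Circle.exp_add, hω (ι γ) v]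
    have e : Real.pi * ω v (ι γ) + -(Real.pi * -ω v (ι γ)) = 2 * Real.pi * ω v (ι γ) := by ring
    rw [e]
  rw [← key]
  constructor
  · intro h
    have := h (fun t => Complex.exp (t * (Real.pi * ω v (ι γ) * Complex.I))) fun t => by
      rw [← neg_mul, hc]
      have h1 : HasDerivAt (fun t : ℝ => (t : ℂ) * (Real.pi * ω v (ι γ) * Complex.I))
          (Real.pi * ω v (ι γ) * Complex.I) t := by
        simpa using (hasDerivAt_id t).ofReal_comp.mul_const (Real.pi * ω v (ι γ) * Complex.I)
      refine h1.cexp.congr_deriv ?_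
      ring
    apply Circle.coe_injective
    rw [← hexp]
    simpa using this.symm
  · intro h u hu
    have := eq_exp_of_hasDerivAt (c := Real.pi * ω v (ι γ) * Complex.I) (u := u) (fun t => by
      rw [← hc t, neg_mul]; exact hu t) 1
    rw [this, h, ← hexp]
    simp

lemma mem_preim_leafThrough {P : Submodule ℝ V} {v₀ v : V} :
    v ∈ preim ι (leafThrough ι P v₀) ↔ ∃ w ∈ P, ∃ γ : G, v = v₀ + w + ι γ := by
  constructor
  · rintro ⟨w, hw, h⟩
    obtain ⟨γ, hγ⟩ := QuotientAddGroup.eq.1 h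
    exact ⟨w, hw, γ, by rw [hγ]; abel⟩
  · rintro ⟨w, hw, γ, rfl⟩
    exact ⟨w, hw, QuotientAddGroup.eq.2 ⟨γ, by abel⟩⟩

lemma mem_preim_self {P : Submodule ℝ V} (v₀ : V) : v₀ ∈ preim ι (leafThrough ι P v₀) :=
  mem_preim_leafThrough.2 ⟨0, P.zero_mem, 0, by simp⟩

lemma leafThrough_eq_iff {P : Submodule ℝ V} {v v' : V} :
    leafThrough ι P v = leafThrough ι P v' ↔ ∃ γ : G, v - v' - ι γ ∈ P := by
  constructor
  · intro h
    have := mem_preim_self (ι := ι) (P := P) v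
    rw [h, mem_preim_leafThrough] at this
    obtain ⟨w, hw, γ, rfl⟩ := this
    exact ⟨γ, by convert hw using 1; abel⟩
  · rintro ⟨γ, hγ⟩
    have key : ∀ x : V, x ∈ preim ι (leafThrough ι P v) ↔ x ∈ preim ι (leafThrough ι P v') := by
      intro x
      rw [mem_preim_leafThrough, mem_preim_leafThrough]
      constructor
      · rintro ⟨w, hw, δ, rfl⟩
        exact ⟨_, P.add_mem hw hγ, δ + γ, by rw [map_add]; abel⟩
      · rintro ⟨w, hw, δ, rfl⟩
        exact ⟨_, P.sub_mem hw hγ, δ - γ, by rw [map_sub]; abel⟩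
    ext x
    obtain ⟨x, rfl⟩ := QuotientAddGroup.mk_surjective x
    exact key x

/-- A half-density is determined by its value on one frame; every value occurs because determinants
of base changes multiply. -/
lemma finrank_halfDensity (P : Submodule ℝ V) [Module.Finite ℝ P] :
    Module.finrank ℂ (HalfDensity P) = 1 := by
  let e₀ := Module.finBasis ℝ P
  have hdet : ∀ e e' : Module.Basis (Fin (Module.finrank ℝ P)) ℝ P,
      e₀.det e' = e.det e' * e₀.det e := fun e e' => by
    rw [mul_comm]; exact (e₀.det_mul_det e e').symm
  let φ : HalfDensity P →ₗ[ℂ] ℂ :=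
    { toFun := fun ν => ν.1 e₀
      map_add' := fun _ _ => rfl
      map_smul' := fun _ _ => rfl }
  have hφ : Function.Bijective φ := by
    constructor
    · rw [injective_iff_map_eq_zero]
      intro ν hν
      apply Subtype.ext
      funext e
      have h1 : ν.1 e₀ = 0 := hν
      rw [ν.2 e₀ e, h1, mul_zero]
      rfl
    · intro c
      refine ⟨⟨fun e => Real.sqrt |e₀.det e| * c, fun e e' => ?_⟩, ?_⟩
      · change (Real.sqrt |e₀.det e'| : ℂ) * c = Real.sqrt |e.det e'| * (Real.sqrt |e₀.det e| * c)
        rw [hdet e e', abs_mul, Real.sqrt_mul (abs_nonneg _)]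
        push_cast
        ring
      · change (Real.sqrt |e₀.det e₀| : ℂ) * c = c
        rw [e₀.det_self]
        simp
  rw [(LinearEquiv.ofBijective φ hφ).finrank_eq, Module.finrank_self]

variable {ℒ : PrequantumBundle ι ω} {P : Submodule ℝ V}

/-- Along a line in the leaf, flatness is a linear ODE with constant coefficient because `ω w w =
0`, so a zero propagates. -/
lemma flatSections_transport (hω : ∀ x y, ω x y = - ω y x) {ℓ : Set (Torus ι)}
    (hℓ : ∀ v ∈ preim ι ℓ, ∀ w ∈ P, v + w ∈ preim ι ℓ)
    (s : flatSections ℒ P ℓ) {v : V} (hv : v ∈ preim ι ℓ) {w : V} (hw : w ∈ P) (h : s.1 v = 0) :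
    s.1 (v + w) = 0 := by
  have hself : ∀ x, ω x x = 0 := fun x => by linarith [hω x x]
  apply Subtype.ext
  funext e
  have hd : ∀ t : ℝ, HasDerivAt (fun t : ℝ => (s.1 (v + t • w)).1 e)
      ((Real.pi * ω v w * Complex.I) * (s.1 (v + t • w)).1 e) t := fun t => by
    have h1 := s.2.2.2 (v + t • w) (hℓ v hv _ (P.smul_mem t hw)) w hw e
    simp only [add_assoc, ← add_smul] at h1
    have h3 := hasDerivAt_of_shift (f := fun t : ℝ => (s.1 (v + t • w)).1 e) h1
    refine h3.congr_deriv ?_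
    simp only [connForm, map_add, map_smul, LinearMap.add_apply, LinearMap.smul_apply, hself,
      smul_zero, add_zero]
    ring
  have := eq_exp_of_hasDerivAt hd 1
  simp only [one_smul, zero_smul, add_zero, h] at this
  rw [this]
  simp

/-- The flat sections over a Bohr–Sommerfeld leaf form a line. -/
lemma finrank_flatSections [Module.Finite ℝ V] (hω : ∀ x y, ω x y = - ω y x)
    (hP : ∀ x ∈ P, ∀ y ∈ P, ω x y = 0) (v₀ : V)
    (hhol : TrivialHolonomy ℒ P (leafThrough ι P v₀)) :
    Module.finrank ℂ (flatSections ℒ P (leafThrough ι P v₀)) = 1 := by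
  rw [trivialHolonomy_iff hω] at hhol
  set ℓ := leafThrough ι P v₀ with hℓ
  let φ : flatSections ℒ P ℓ →ₗ[ℂ] HalfDensity P :=
    { toFun := fun s => s.1 v₀
      map_add' := fun _ _ => rfl
      map_smul' := fun _ _ => rfl }
  have hadd : ∀ v ∈ preim ι ℓ, ∀ w ∈ P, v + w ∈ preim ι ℓ := by
    intro v hv w hw
    obtain ⟨w', hw', γ, rfl⟩ := mem_preim_leafThrough.1 hv
    exact mem_preim_leafThrough.2 ⟨w' + w, P.add_mem hw' hw, γ, by abel⟩
  have hinj : Function.Injective φ := by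
    rw [injective_iff_map_eq_zero]
    intro s hs
    apply Subtype.ext
    funext v
    by_cases hv : v ∈ preim ι ℓ
    · obtain ⟨w, hw, γ, rfl⟩ := mem_preim_leafThrough.1 hv
      have h1 := flatSections_transport hω hadd s (mem_preim_self v₀) hw hs
      rw [s.2.2.1 _ (hadd _ (mem_preim_self v₀) w hw), h1, smul_zero]
      rfl
    · exact s.2.1 v hv
  -- The ratio of the values of a flat section at `v₀ + w + ι γ` and at `v₀`: parallel transport
  -- along `w`, then the automorphy factor of `γ`.
  let Φ : V → G → Circle := fun w γ => ℒ.factor γ (v₀ + w) * Circle.exp (Real.pi * ω v₀ w)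
  -- Two presentations of a point differ by a lattice vector in `P`, and trivial holonomy along it
  -- makes the two ratios agree.
  have hΦ : ∀ w ∈ P, ∀ w' ∈ P, ∀ γ γ', w + ι γ = w' + ι γ' → Φ w γ = Φ w' γ' := by
    intro w hw w' hw' γ γ' h
    have hδ : ι (γ - γ') = w' - w := by
      rw [map_sub, sub_eq_sub_iff_add_eq_add, add_comm, h, add_comm]
    have hδP : ι (γ - γ') ∈ P := hδ ▸ P.sub_mem hw' hw
    have h1 : ℒ.factor γ (v₀ + w) = ℒ.factor γ' (v₀ + w') * ℒ.factor (γ - γ') (v₀ + w) := by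
      have := ℒ.factor_add γ' (γ - γ') (v₀ + w)
      rw [hδ] at this
      rw [add_sub_cancel] at this
      rw [this]
      congr 2
      abel
    simp only [Φ]
    rw [h1, ℒ.factor_eq (γ - γ'), hhol v₀ (mem_preim_self v₀) _ hδP, mul_assoc, ← Circle.exp_add,
      ← Circle.exp_add]
    congr 2
    rw [map_add (ω (ι (γ - γ'))), hP _ hδP _ hw, hω (ι (γ - γ')) v₀, hδ, map_sub]
    ring
  have hΦt : ∀ (w x : V) (γ : G) (t : ℝ), w ∈ P → x ∈ P → Φ (w + t • x) γ
      = Circle.exp (t * (Real.pi * ω (v₀ + w + ι γ) x)) * Φ w γ := by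
    intro w x γ t hw hx
    simp only [Φ]
    rw [ℒ.factor_eq, ℒ.factor_eq γ (v₀ + w), mul_assoc, ← Circle.exp_add, mul_assoc,
      ← Circle.exp_add, mul_left_comm, ← Circle.exp_add]
    congr 2
    simp only [map_add, map_smul, LinearMap.add_apply, smul_eq_mul, hP w hw x hx]
    ring
  have hsurj : Function.Surjective φ := by
    intro ν
    choose w hw γ hγ using fun v : preim ι ℓ => mem_preim_leafThrough.1 v.2
    let s : V → HalfDensity P := fun v => by
      classical exact if h : v ∈ preim ι ℓ then ((Φ (w ⟨v, h⟩) (γ ⟨v, h⟩) : Circle) : ℂ) • ν else 0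
    have hs : ∀ w' ∈ P, ∀ γ', s (v₀ + w' + ι γ') = ((Φ w' γ' : Circle) : ℂ) • ν := by
      intro w' hw' γ'
      have hmem : v₀ + w' + ι γ' ∈ preim ι ℓ := mem_preim_leafThrough.2 ⟨w', hw', γ', rfl⟩
      simp only [s, dif_pos hmem]
      rw [hΦ _ (hw _) w' hw' _ γ']
      have := hγ ⟨_, hmem⟩
      rw [add_assoc v₀ (w _)] at this
      exact (add_left_cancel ((add_assoc v₀ w' (ι γ')).symm.trans this)).symm
    refine ⟨⟨s, fun v hv => ?_, fun v hv δ => ?_, fun v hv x hx e => ?_⟩, ?_⟩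
    · simp only [s, dif_neg hv]
    · obtain ⟨w', hw', γ', rfl⟩ := mem_preim_leafThrough.1 hv
      rw [add_assoc, ← map_add, hs w' hw', hs w' hw', smul_smul, ← Circle.coe_mul]
      congr 2
      simp only [Φ]
      rw [add_comm γ' δ, ℒ.factor_add, mul_assoc]
    · obtain ⟨w', hw', γ', rfl⟩ := mem_preim_leafThrough.1 hv
      have e1 : (fun t : ℝ => (s (v₀ + w' + ι γ' + t • x)).1 e) = fun t : ℝ =>
          Complex.exp ((t : ℂ) * (Real.pi * ω (v₀ + w' + ι γ') x * Complex.I))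
            * (s (v₀ + w' + ι γ')).1 e := by
        funext t
        have : v₀ + w' + ι γ' + t • x = v₀ + (w' + t • x) + ι γ' := by abel
        rw [this, hs _ (P.add_mem hw' (P.smul_mem t hx)), hs w' hw', hΦt w' x γ' t hw' hx]
        simp only [Submodule.coe_smul, Pi.smul_apply, smul_eq_mul, Circle.coe_mul, Circle.coe_exp]
        push_cast
        ring_nf
      rw [e1]
      have h1 : HasDerivAt (fun t : ℝ => (t : ℂ) * (Real.pi * ω (v₀ + w' + ι γ') x * Complex.I))
          (Real.pi * ω (v₀ + w' + ι γ') x * Complex.I) 0 := by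
        simpa using (hasDerivAt_id (0 : ℝ)).ofReal_comp.mul_const
          (Real.pi * ω (v₀ + w' + ι γ') x * Complex.I)
      refine (h1.cexp.mul_const _).congr_deriv ?_
      simp only [connForm, Complex.ofReal_zero, zero_mul, Complex.exp_zero]
      ring
    · change s v₀ = ν
      have := hs 0 P.zero_mem 0
      simp only [map_zero, add_zero] at this
      rw [this]
      simp only [Φ]
      have h0 : ℒ.factor 0 (v₀ + 0) = 1 := by
        have := ℒ.factor_add 0 0 (v₀ + 0)
        simpa using this
      rw [h0]
      simp
  rw [(LinearEquiv.ofBijective φ ⟨hinj, hsurj⟩).finrank_eq, finrank_halfDensity]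

end Bundle

/-! ### The lattice, its real form and the discriminant group -/

section Lattice

variable {Λ : Type w} [AddCommGroup Λ] {K : LinearMap.BilinForm ℤ Λ}

/-- The extension of an integral form to the Lie algebra. -/
abbrev realForm (K : LinearMap.BilinForm ℤ Λ) : LinearMap.BilinForm ℝ (LieAlg Λ) :=
  LinearMap.BilinForm.baseChange ℝ K

lemma realForm_tmul (x y : Λ) : realForm K (1 ⊗ₜ x) (1 ⊗ₜ y) = (K x y : ℝ) := by
  simp [realForm]

lemma realForm_comm (hs : K.IsSymm) (x y : LieAlg Λ) : realForm K x y = realForm K y x := by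
  induction x using TensorProduct.induction_on with
  | zero => simp
  | add x x' h h' => simp [h, h']
  | tmul r a =>
    induction y using TensorProduct.induction_on with
    | zero => simp
    | add y y' h h' => simp [h, h']
    | tmul s b => simp [realForm, hs.eq a b, mul_comm]

lemma realForm_flip (hs : K.IsSymm) : LinearMap.flip (realForm K) = realForm K := by
  ext x y
  simp [realForm_comm hs]

lemma det_toMatrix_ne_zero {ι : Type*} [Fintype ι] [DecidableEq ι] (hK : K.Nondegenerate)
    (b : Module.Basis ι ℤ Λ) : (LinearMap.BilinForm.toMatrix b K).det ≠ 0 :=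
  (LinearMap.BilinForm.nondegenerate_iff_det_ne_zero b).1 hK

variable [Module.Free ℤ Λ] [Module.Finite ℤ Λ]

/-- Every real functional on the lattice is represented by a unique element of the Lie algebra. -/
lemma existsUnique_realForm_eq (hK : K.Nondegenerate) (μ : Λ →ₗ[ℤ] ℝ) :
    ∃! τ : LieAlg Λ, ∀ x, realForm K (1 ⊗ₜ x) τ = μ x := by
  let b := Module.finBasis ℤ Λ
  let bR := b.baseChange ℝ
  have hdet := det_toMatrix_ne_zero hK b
  set N : Matrix _ _ ℝ := (LinearMap.BilinForm.toMatrix b K).map (Int.castRingHom ℝ) with hN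
  have hNdet : IsUnit N.det := by
    have : N.det = ((LinearMap.BilinForm.toMatrix b K).det : ℝ) := by
      rw [hN, ← RingHom.mapMatrix_apply, ← RingHom.map_det]; rfl
    rw [this]
    exact isUnit_iff_ne_zero.2 (Int.cast_ne_zero.2 hdet)
  have hNij : ∀ i j, N i j = realForm K (1 ⊗ₜ b i) (bR j) := fun i j => by
    rw [Module.Basis.baseChange_apply, realForm_tmul]
    simp [hN, LinearMap.BilinForm.toMatrix_apply]
  have hexp : ∀ (τ : LieAlg Λ) i, realForm K (1 ⊗ₜ b i) τ = N.mulVec (bR.repr τ) i := fun τ i => by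
    conv_lhs => rw [← bR.sum_repr τ]
    simp only [map_sum, map_smul, Matrix.mulVec, dotProduct, hNij, smul_eq_mul]
    exact Finset.sum_congr rfl fun j _ => mul_comm _ _
  have hiff : ∀ τ : LieAlg Λ, (∀ x, realForm K (1 ⊗ₜ x) τ = μ x) ↔
      N.mulVec (bR.repr τ) = fun i => μ (b i) := by
    intro τ
    constructor
    · intro h
      funext i
      rw [← hexp, h]
    · intro h x
      let l : Λ →ₗ[ℤ] ℝ :=
        { toFun := fun x => realForm K (1 ⊗ₜ x) τ
          map_add' := fun x y => by rw [TensorProduct.tmul_add, map_add, LinearMap.add_apply]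
          map_smul' := fun n x => by
            rw [TensorProduct.tmul_smul, map_zsmul]; rfl }
      have : l = μ := b.ext fun i => by
        change realForm K (1 ⊗ₜ b i) τ = _
        rw [hexp, h]
      exact congrArg (fun f => f x) this
  refine ⟨bR.repr.symm (Finsupp.equivFunOnFinite.symm (N⁻¹.mulVec fun i => μ (b i))), ?_, ?_⟩
  · refine (hiff _).2 ?_
    rw [LinearEquiv.apply_symm_apply]
    change N.mulVec (N⁻¹.mulVec _) = _
    rw [Matrix.mulVec_mulVec, Matrix.mul_nonsing_inv _ hNdet, Matrix.one_mulVec]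
  · intro τ hτ
    rw [LinearEquiv.eq_symm_apply]
    apply Finsupp.ext
    intro i
    have := congrArg (N⁻¹.mulVec) ((hiff τ).1 hτ)
    rw [Matrix.mulVec_mulVec, Matrix.nonsing_inv_mul _ hNdet, Matrix.one_mulVec] at this
    exact congrFun this i

lemma eq_zero_of_realForm (hK : K.Nondegenerate) {τ : LieAlg Λ}
    (h : ∀ x, realForm K (1 ⊗ₜ x) τ = 0) : τ = 0 :=
  (existsUnique_realForm_eq hK 0).unique (by simpa using h) (by simp)

lemma eq_zero_of_one_tmul {x : Λ}
    (h : (1 : ℝ) ⊗ₜ[ℤ] x = (0 : LieAlg Λ)) : x = 0 := by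
  let b := Module.finBasis ℤ Λ
  apply b.repr.injective
  rw [map_zero]
  apply Finsupp.ext
  intro i
  have := congrArg (fun y => (b.baseChange ℝ).repr y i) h
  simpa [Module.Basis.baseChange_repr_tmul] using this

/-- The order is the index of `KΛ` in `Λ*`. The vectors `K (b i)` form a basis of `KΛ`, and their
coordinates in the dual basis are the entries of the Gram matrix. -/
lemma card_discriminantGroup (hK : K.Nondegenerate) {n : ℕ} (b : Module.Basis (Fin n) ℤ Λ) :
    Nat.card (DiscriminantGroup K) = (LinearMap.BilinForm.toMatrix b K).det.natAbs := by
  let e : Λ ≃ₗ[ℤ] LinearMap.range K :=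
    LinearEquiv.ofInjective K (LinearMap.ker_eq_bot.1 hK.ker_eq_bot)
  rw [← Submodule.natAbs_det_basis_change b.dualBasis (LinearMap.range K) (b.map e),
    Module.Basis.det_apply, ← Matrix.det_transpose]
  congr 2
  ext i j
  simp only [Matrix.transpose_apply, Module.Basis.toMatrix_apply, Function.comp,
    Module.Basis.map_apply, Module.Basis.dualBasis_repr, LinearMap.BilinForm.toMatrix_apply]
  rfl

lemma finite_discriminantGroup (hK : K.Nondegenerate) : Finite (DiscriminantGroup K) := by
  refine Nat.finite_of_card_ne_zero ?_
  rw [card_discriminantGroup hK (Module.finBasis ℤ Λ)]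
  exact Int.natAbs_ne_zero.2 (det_toMatrix_ne_zero hK _)

end Lattice

/-! ### Counting Bohr–Sommerfeld leaves in transverse coordinates -/

lemma card_eq_of_surjective_of_fibers {α β γ : Type*} {f : α → β} {h : α → γ}
    (hf : Function.Surjective f) (hh : Function.Surjective h)
    (H : ∀ x y, f x = f y ↔ h x = h y) : Nat.card β = Nat.card γ := by
  have : Setoid.ker f = Setoid.ker h := Setoid.ext H
  refine Nat.card_congr ((Setoid.quotientKerEquivOfSurjective f hf).symm.trans ?_)
  rw [this]
  exact Setoid.quotientKerEquivOfSurjective h hh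

/-- Linear coordinates transverse to a polarization `P` of the symplectic torus `V / ι(G)`, dual
with respect to the symplectic form to the lattice vectors in `P`. -/
structure TransverseCoordinates {Λ : Type w} [AddCommGroup Λ] (K : LinearMap.BilinForm ℤ Λ) (g : ℕ)
    {V : Type u} [AddCommGroup V] [Module ℝ V] {G : Type v} [AddCommGroup G]
    (ι : G →+ V) (ω : V →ₗ[ℝ] V →ₗ[ℝ] ℝ) (P : Submodule ℝ V) where
  /-- the coordinates -/
  coord : V →ₗ[ℝ] (Fin g → LieAlg Λ)
  coord_surjective : Function.Surjective coord
  ker_coord : LinearMap.ker coord = P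
  coord_lattice : ∀ γ, ∃ l : Fin g → Λ, coord (ι γ) = fun i => 1 ⊗ₜ l i
  exists_coord_eq : ∀ l : Fin g → Λ, ∃ γ, coord (ι γ) = fun i => 1 ⊗ₜ l i
  /-- the lattice vectors in the polarization -/
  tangent : (Fin g → Λ) →+ G
  tangent_mem : ∀ l, ι (tangent l) ∈ P
  exists_tangent_eq : ∀ γ, ι γ ∈ P → ∃ l, γ = tangent l
  form_tangent : ∀ l v, ω (ι (tangent l)) v = ∑ i, realForm K (1 ⊗ₜ l i) (coord v i)
  form_swap : ∀ x y, ω x y = - ω y x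
  form_isotropic : ∀ x ∈ P, ∀ y ∈ P, ω x y = 0

namespace TransverseCoordinates

variable {Λ : Type w} [AddCommGroup Λ] {K : LinearMap.BilinForm ℤ Λ} {g : ℕ}
  {V : Type u} [AddCommGroup V] [Module ℝ V] {G : Type v} [AddCommGroup G]
  {ι : G →+ V} {ω : V →ₗ[ℝ] V →ₗ[ℝ] ℝ} {P : Submodule ℝ V}
  (T : TransverseCoordinates K g ι ω P) (ℒ : PrequantumBundle ι ω)

/-- The character of the lattice vectors in the polarization given by the automorphy factor. -/
def character : (Fin g → Λ) →+ Additive Circle where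
  toFun l := Additive.ofMul (ℒ.factor (T.tangent l) 0)
  map_zero' := by
    rw [map_zero, ofMul_eq_zero]
    have := ℒ.factor_add 0 0 0
    simpa using this
  map_add' l l' := by
    -- The phase by which the factor fails to be multiplicative is `π ω` of two tangent vectors,
    -- which vanishes.
    rw [← ofMul_mul, map_add, ℒ.factor_add, ℒ.factor_eq _ (0 + ι _), zero_add,
      T.form_isotropic _ (T.tangent_mem _) _ (T.tangent_mem _)]
    simp

/-- The Bohr–Sommerfeld condition in coordinates. -/
lemma trivialHolonomy_leafThrough_iff {τ : Fin g → LieAlg Λ}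
    (hτ : ∀ l, ℒ.factor (T.tangent l) 0
      = Circle.exp (-(2 * Real.pi * ∑ i, realForm K (1 ⊗ₜ l i) (τ i)))) (v : V) :
    TrivialHolonomy ℒ P (leafThrough ι P v) ↔
      ∀ (i : Fin g) (x : Λ), ∃ n : ℤ, realForm K (1 ⊗ₜ x) (T.coord v i - τ i) = n := by
  rw [trivialHolonomy_iff T.form_swap]
  have key : ∀ (v : V) (l : Fin g → Λ),
      ℒ.factor (T.tangent l) 0 = Circle.exp (2 * Real.pi * ω v (ι (T.tangent l))) ↔
      ∃ n : ℤ, ∑ i, realForm K (1 ⊗ₜ l i) (T.coord v i - τ i) = n := by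
    intro v l
    rw [hτ, ← mul_neg, exp_two_pi_eq_iff, T.form_swap, T.form_tangent]
    simp only [map_sub, Finset.sum_sub_distrib]
    refine exists_congr fun n => ?_
    rw [neg_sub_neg]
  constructor
  · intro h i x
    obtain ⟨n, hn⟩ := (key v (Pi.single i x)).1 (h v (mem_preim_self v) _ (T.tangent_mem _))
    refine ⟨n, ?_⟩
    rw [← hn, Finset.sum_eq_single i]
    · simp
    · intro k _ hk
      simp [hk]
    · simp
  · intro h v' hv' γ hγ
    obtain ⟨l, rfl⟩ := T.exists_tangent_eq γ hγ
    rw [key]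
    obtain ⟨w, hw, δ, rfl⟩ := mem_preim_leafThrough.1 hv'
    obtain ⟨l', hl'⟩ := T.coord_lattice δ
    have hw0 : T.coord w = 0 := by rwa [← T.ker_coord, LinearMap.mem_ker] at hw
    choose n hn using fun i => h i (l i)
    -- Moving the point within the leaf changes its coordinates by the lattice vectors `l' i` only,
    -- and `K` is integral on the lattice.
    refine ⟨∑ i, (n i + K (l i) (l' i)), ?_⟩
    push_cast
    refine Finset.sum_congr rfl fun i _ => ?_
    rw [map_add, map_add, hw0, hl', add_zero, Pi.add_apply, add_sub_right_comm, map_add, hn,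
      realForm_tmul]

lemma leafThrough_eq_iff_coord {v v' : V} : leafThrough ι P v = leafThrough ι P v' ↔
    ∃ l : Fin g → Λ, ∀ i, T.coord v i - T.coord v' i = 1 ⊗ₜ l i := by
  rw [leafThrough_eq_iff]
  simp only [← T.ker_coord, LinearMap.mem_ker, map_sub, sub_eq_zero]
  constructor
  · rintro ⟨γ, hγ⟩
    obtain ⟨l, hl⟩ := T.coord_lattice γ
    exact ⟨l, fun i => by rw [← Pi.sub_apply, hγ, hl]⟩
  · rintro ⟨l, hl⟩
    obtain ⟨γ, hγ⟩ := T.exists_coord_eq l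
    exact ⟨γ, by rw [hγ]; funext i; exact hl i⟩

variable [Module.Free ℤ Λ] [Module.Finite ℤ Λ]

/-- A character of the free group `Λ^g` lifts to a real functional by choosing angles on a basis,
and nondegeneracy represents this functional by `K`. -/
lemma exists_factor_eq (hK : K.Nondegenerate) : ∃ τ : Fin g → LieAlg Λ, ∀ l,
    ℒ.factor (T.tangent l) 0
      = Circle.exp (-(2 * Real.pi * ∑ i, realForm K (1 ⊗ₜ l i) (τ i))) := by
  let b := Module.finBasis ℤ Λ
  have hang : ∀ (c : Circle), ∃ r : ℝ, c = Circle.exp (-(2 * Real.pi * r)) := fun c => by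
    refine ⟨-(Complex.arg c / (2 * Real.pi)), ?_⟩
    rw [mul_neg, neg_neg, mul_div_cancel₀ _ (by positivity), Circle.exp_arg]
  choose r hr using fun (i : Fin g) (j : Fin (Module.finrank ℤ Λ)) =>
    hang (ℒ.factor (T.tangent (Pi.single i (b j))) 0)
  choose τ hτ using fun i => (existsUnique_realForm_eq hK (b.constr ℤ (r i))).exists
  refine ⟨τ, fun l => ?_⟩
  let ψ : (Fin g → Λ) →+ Additive Circle :=
    { toFun := fun l => Additive.ofMul
        (Circle.exp (-(2 * Real.pi * ∑ i, realForm K (1 ⊗ₜ l i) (τ i))))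
      map_zero' := by simp
      map_add' := fun l l' => by
        rw [← ofMul_mul, ← Circle.exp_add]
        simp only [Pi.add_apply, TensorProduct.tmul_add, map_add, LinearMap.add_apply,
          Finset.sum_add_distrib]
        congr 2
        ring }
  have h : (T.character ℒ).toIntLinearMap = ψ.toIntLinearMap := by
    refine LinearMap.pi_ext' fun i => b.ext fun j => ?_
    change Additive.ofMul (ℒ.factor (T.tangent (Pi.single i (b j))) 0)
      = Additive.ofMul (Circle.exp (-(2 * Real.pi *
        ∑ k, realForm K (1 ⊗ₜ (Pi.single i (b j) : Fin g → Λ) k) (τ k))))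
    rw [hr, Finset.sum_eq_single i]
    · simp [hτ]
    · intro k _ hk
      simp [hk]
    · simp
  exact congrArg (fun f => (f l).toMul) h

/-- The number of Bohr–Sommerfeld leaves. -/
theorem card_bohrSommerfeld (T : TransverseCoordinates K g ι ω P) (hs : K.IsSymm) (hK : K.Nondegenerate) :
    Nat.card (bohrSommerfeld ℒ P) = Nat.card (DiscriminantGroup K) ^ g := by
  obtain ⟨τ, hτ⟩ := T.exists_factor_eq ℒ hK
  have hBS := T.trivialHolonomy_leafThrough_iff ℒ hτ
  let toR : Module.Dual ℤ Λ → (Λ →ₗ[ℤ] ℝ) := fun m => (Int.castAddHom ℝ).toIntLinearMap.comp m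
  -- `ρ m` is `K⁻¹ m`. The Bohr–Sommerfeld leaves are those with coordinates `τ i + ρ (m i)`, and
  -- two of them coincide exactly when all `m i - m' i` lie in `KΛ`.
  choose ρ hρ using fun m : Module.Dual ℤ Λ => (existsUnique_realForm_eq hK (toR m)).exists
  have hρ' : ∀ m x, realForm K (1 ⊗ₜ x) (ρ m) = (m x : ℝ) := hρ
  choose p hp using fun m : Fin g → Module.Dual ℤ Λ =>
    T.coord_surjective fun i => τ i + ρ (m i)
  have hpBS : ∀ m, leafThrough ι P (p m) ∈ bohrSommerfeld ℒ P := fun m => by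
    refine ⟨⟨_, rfl⟩, (hBS _).2 fun i x => ⟨m i x, ?_⟩⟩
    rw [hp, add_sub_cancel_left, hρ']
  let Φ : (Fin g → Module.Dual ℤ Λ) → bohrSommerfeld ℒ P := fun m => ⟨_, hpBS m⟩
  let Ψ : (Fin g → Module.Dual ℤ Λ) → (Fin g → DiscriminantGroup K) :=
    fun m i => Submodule.Quotient.mk (m i)
  have hΦ : Function.Surjective Φ := by
    rintro ⟨ℓ, ⟨v, rfl⟩, hv⟩
    rw [hBS] at hv
    choose n hn using hv
    let m : Fin g → Module.Dual ℤ Λ := fun i =>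
      { toFun := n i
        map_add' := fun x y => by
          have : ((n i (x + y) : ℤ) : ℝ) = ((n i x + n i y : ℤ) : ℝ) := by
            push_cast
            rw [← hn, ← hn, ← hn, TensorProduct.tmul_add, map_add, LinearMap.add_apply]
          exact_mod_cast this
        map_smul' := fun k x => by
          have : ((n i (k • x) : ℤ) : ℝ) = ((k • n i x : ℤ) : ℝ) := by
            rw [smul_eq_mul]
            push_cast
            rw [← hn, ← hn, TensorProduct.tmul_smul, map_zsmul, LinearMap.smul_apply, zsmul_eq_mul]
          exact_mod_cast this }
    refine ⟨m, Subtype.ext ?_⟩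
    change leafThrough ι P (p m) = leafThrough ι P v
    rw [T.leafThrough_eq_iff_coord]
    refine ⟨0, fun i => ?_⟩
    rw [Pi.zero_apply, TensorProduct.tmul_zero]
    refine eq_zero_of_realForm hK fun x => ?_
    have h1 := hn i x
    rw [map_sub] at h1
    rw [hp, map_sub, map_add, hρ']
    change _ + ((n i x : ℤ) : ℝ) - _ = 0
    linarith
  have hΨ : Function.Surjective Ψ := fun y => by
    choose m hm using fun i => Submodule.Quotient.mk_surjective _ (y i)
    exact ⟨m, funext hm⟩
  rw [card_eq_of_surjective_of_fibers hΦ hΨ, Nat.card_fun, Nat.card_fin]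
  intro m m'
  rw [Subtype.ext_iff, funext_iff]
  change leafThrough ι P (p m) = leafThrough ι P (p m') ↔ _
  rw [T.leafThrough_eq_iff_coord]
  refine Iff.trans (Classical.skolem (p := fun i y =>
    T.coord (p m) i - T.coord (p m') i = 1 ⊗ₜ[ℤ] y)).symm (forall_congr' fun i => ?_)
  change _ ↔ (Submodule.Quotient.mk (m i) : DiscriminantGroup K) = Submodule.Quotient.mk (m' i)
  rw [Submodule.Quotient.eq, LinearMap.mem_range]
  refine exists_congr fun y => ?_
  rw [hp, hp, add_sub_add_left_eq_sub]
  have hx : ∀ x, realForm K (1 ⊗ₜ x) (ρ (m i) - ρ (m' i)) = ((m i - m' i) x : ℤ) := fun x => by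
    rw [map_sub, hρ', hρ', LinearMap.sub_apply, Int.cast_sub]
  constructor
  · intro h
    ext x
    have := hx x
    rw [h, realForm_tmul, hs.eq] at this
    exact_mod_cast this
  · intro h
    rw [← sub_eq_zero]
    refine eq_zero_of_realForm hK fun x => ?_
    rw [map_sub, hx, ← h, realForm_tmul, hs.eq, sub_self]

/-- The dimension of the quantum space. -/
theorem finrank_quantumSpace (T : TransverseCoordinates K g ι ω P) [Module.Finite ℝ V]
    (hs : K.IsSymm) (hK : K.Nondegenerate) :
    Module.finrank ℂ (QuantumSpace ℒ P) = Nat.card (DiscriminantGroup K) ^ g := by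
  have := finite_discriminantGroup hK
  have hcard := T.card_bohrSommerfeld ℒ hs hK
  -- `Nat.card` is zero on an infinite type, so the nonzero count proves finiteness of the set of
  -- leaves.
  have hfin : Finite (bohrSommerfeld ℒ P) := Nat.finite_of_card_ne_zero (by
    rw [hcard]; exact pow_ne_zero _ Nat.card_pos.ne')
  have := Fintype.ofFinite (bohrSommerfeld ℒ P)
  have h1 : ∀ ℓ : bohrSommerfeld ℒ P, Module.finrank ℂ (flatSections ℒ P ℓ.1) = 1 := by
    rintro ⟨ℓ, ⟨v, rfl⟩, hv⟩
    exact finrank_flatSections T.form_swap T.form_isotropic v hv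
  have : ∀ ℓ : bohrSommerfeld ℒ P, Module.Free ℂ (flatSections ℒ P ℓ.1) := fun ℓ =>
    Module.Free.of_divisionRing ℂ (flatSections ℒ P ℓ.1)
  have : ∀ ℓ : bohrSommerfeld ℒ P, Module.Finite ℂ (flatSections ℒ P ℓ.1) := fun ℓ =>
    Module.finite_of_finrank_pos (by rw [h1]; exact one_pos)
  rw [Module.finrank_directSum]
  simp only [h1, Finset.sum_const, Finset.card_univ, smul_eq_mul, mul_one]
  rw [← Nat.card_eq_fintype_card, hcard]

end TransverseCoordinates

/-! ### Transverse coordinates on the toral phase space -/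

section Toral

variable {g : ℕ} {X : Type u} [TopologicalSpace X] {Λ : Type v} [AddCommGroup Λ]

/-- Every class is a combination of the members of a frame. -/
lemma PolygonModel.exists_eq_sum_frame (M : PolygonModel g X) {R A : Type*} [CommRing R]
    [AddCommGroup A] [Module R A] {e f : Fin g → H1 (Sing X) ℤ ℤ}
    (hs : Function.Surjective (frameMap e f)) (v : H1 (Sing X) R A) :
    ∃ α β : Fin g → A, v = ∑ i, tens R (e i) (α i) + ∑ i, tens R (f i) (β i) := by
  let F : ((Fin g → A) × (Fin g → A)) →ₗ[R] H1 (Sing X) R A :=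
    (∑ i, (tensHom R (e i)).comp (LinearMap.proj i)).coprod
      (∑ i, (tensHom R (f i)).comp (LinearMap.proj i))
  have hF : ∀ α β, F (α, β) = ∑ i, tens R (e i) (α i) + ∑ i, tens R (f i) (β i) := fun α β => by
    simp [F, LinearMap.sum_apply]; rfl
  have hx : ∀ (x : H1 (Sing X) ℤ ℤ) (τ : A), tens R x τ ∈ LinearMap.range F := by
    intro x τ
    obtain ⟨⟨m, n⟩, rfl⟩ := hs x
    refine ⟨(fun i => m i • τ, fun i => n i • τ), ?_⟩
    rw [hF, frameMap_apply, tens_add_left, tens_sum_left, tens_sum_left]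
    simp only [tens_zsmul_left]
  have hv : v ∈ LinearMap.range F := by
    obtain ⟨α, β, rfl⟩ := M.exists_eq_sum_dualClass v
    exact Submodule.add_mem _ (Submodule.sum_mem _ fun i _ => hx _ _)
      (Submodule.sum_mem _ fun i _ => hx _ _)
  obtain ⟨⟨α, β⟩, h⟩ := hv
  exact ⟨α, β, by rw [← h, hF]⟩

lemma tens_zero_right {S : SSet} (R : Type*) {A : Type*} [CommRing R] [AddCommGroup A] [Module R A]
    (x : H1 S ℤ ℤ) : tens R x (0 : A) = 0 := by
  have h := tens_add_right R x (0 : A) 0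
  rw [add_zero] at h
  exact left_eq_add.1 h

/-- The pairing of `H¹(Σ; ℝ)` and `H¹(Σ; A)`. -/
def contraction (A : Type*) [AddCommGroup A] [Module ℝ A] (z : Cycle (Sing X)) :
    H1 (Sing X) ℝ ℝ →ₗ[ℝ] H1 (Sing X) ℝ A →ₗ[ℝ] A := cupPairing (LinearMap.lsmul ℝ A) z

lemma contraction_tens (A : Type*) [AddCommGroup A] [Module ℝ A] (z : Cycle (Sing X))
    (x y : H1 (Sing X) ℤ ℤ) (τ : A) :
    contraction A z (toReal x) (tens ℝ y τ) = intPairing z x y • τ := by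
  induction x using Submodule.Quotient.induction_on with | _ a => ?_
  induction y using Submodule.Quotient.induction_on with | _ b => ?_
  change evalChain (cup _ _ _) z.1 = (evalChain (cup _ _ _) z.1 : ℤ) • τ
  simp only [evalChain, Finsupp.linearCombination_apply, Finsupp.sum, cup, Finset.sum_smul]
  refine Finset.sum_congr rfl fun σ _ => ?_
  change _ • ((a.1 _ : ℤ) : ℝ) • (b.1 _ • τ) = (_ • (a.1 _ * b.1 _)) • τ
  rw [Int.cast_smul_eq_zsmul, smul_assoc, mul_smul]

lemma contraction_map (z : Cycle (Sing X)) (x y : H1 (Sing X) ℝ ℝ) (τ : LieAlg Λ) :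
    contraction (LieAlg Λ) z x (H1.map (LinearMap.toSpanSingleton ℝ _ τ) y) = cupForm z x y • τ := by
  induction x using Submodule.Quotient.induction_on with | _ a => ?_
  induction y using Submodule.Quotient.induction_on with | _ b => ?_
  change evalChain (cup _ _ _) z.1 = (evalChain (cup _ _ _) z.1 : ℝ) • τ
  simp only [evalChain, Finsupp.linearCombination_apply, Finsupp.sum, cup, Finset.sum_smul]
  refine Finset.sum_congr rfl fun σ _ => ?_
  change _ • (a.1 _ : ℝ) • (b.1 _ • τ) = (_ • (a.1 _ * b.1 _)) • τ
  rw [smul_assoc, mul_smul]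

variable {K : LinearMap.BilinForm ℤ Λ}

/-- This moves `K` outside the cup product, so that `ω` against `x ⊗ τ` depends on `v` only through
its contraction with `x`. -/
lemma toralForm_map (z : Cycle (Sing X)) (x : H1 (Sing X) ℝ ℝ) (τ : LieAlg Λ)
    (v : H1 (Sing X) ℝ (LieAlg Λ)) :
    toralForm K z (H1.map (LinearMap.toSpanSingleton ℝ _ τ) x) v
      = realForm K τ (contraction (LieAlg Λ) z x v) := by
  induction x using Submodule.Quotient.induction_on with | _ a => ?_
  induction v using Submodule.Quotient.induction_on with | _ b => ?_
  change evalChain (cup _ _ _) z.1 = realForm K τ (evalChain (cup _ _ _) z.1)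
  simp only [evalChain, Finsupp.linearCombination_apply, Finsupp.sum, cup, map_sum, map_zsmul]
  refine Finset.sum_congr rfl fun σ _ => ?_
  change _ • realForm K (a.1 _ • τ) _ = _ • realForm K τ (a.1 _ • _)
  rw [map_smul, map_smul, LinearMap.smul_apply]

lemma tens_real_eq (x : H1 (Sing X) ℤ ℤ) (τ : LieAlg Λ) :
    tens ℝ x τ = H1.map (LinearMap.toSpanSingleton ℝ _ τ) (toReal x) := by
  induction x using Submodule.Quotient.induction_on with | _ a => ?_
  rw [tens_mk]
  refine congrArg Submodule.Quotient.mk (Subtype.ext (funext fun σ => ?_))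
  exact (Int.cast_smul_eq_zsmul ℝ (a.1 σ) τ).symm

lemma latticeMap_tens (x : H1 (Sing X) ℤ ℤ) (l : Λ) :
    latticeMap X Λ (tens ℤ x l) = tens ℝ x (1 ⊗ₜ l) := by
  induction x using Submodule.Quotient.induction_on with | _ a => ?_
  rw [tens_mk, tens_mk]
  refine congrArg Submodule.Quotient.mk (Subtype.ext (funext fun σ => ?_))
  exact TensorProduct.tmul_smul (a.1 σ) (1 : ℝ) l

lemma toralForm_swap (hs : K.IsSymm) (z : Cycle (Sing X)) (x y : H1 (Sing X) ℝ (LieAlg Λ)) :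
    toralForm K z x y = - toralForm K z y x := by
  have h := cupPairing_swap (realForm K) z y x
  rwa [realForm_flip hs] at h

lemma toralForm_isotropic {z : Cycle (Sing X)} {L : Submodule ℝ (H1 (Sing X) ℝ ℝ)}
    (hL : IsLagrangian z L) (x : H1 (Sing X) ℝ (LieAlg Λ)) (hx : x ∈ polarization Λ L)
    (y : H1 (Sing X) ℝ (LieAlg Λ)) (hy : y ∈ polarization Λ L) : toralForm K z x y = 0 := by
  induction hx, hy using Submodule.span_induction₂ with
  | mem_mem x y hx hy =>
    obtain ⟨x, hx, τ, rfl⟩ := hx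
    obtain ⟨y, hy, τ', rfl⟩ := hy
    rw [toralForm_map, contraction_map, (hL x).1 hx y hy, zero_smul, map_zero]
  | zero_left => simp
  | zero_right => simp
  | add_left x y w _ _ _ h h' => rw [map_add, LinearMap.add_apply, h, h', add_zero]
  | add_right x y w _ _ _ h h' => rw [map_add, h, h', add_zero]
  | smul_left r x y _ _ h => rw [map_smul, LinearMap.smul_apply, h, smul_zero]
  | smul_right r x y _ _ h => rw [map_smul, h, smul_zero]

lemma finite_H1_lieAlg [Module.Finite ℤ Λ] (M : PolygonModel g X) : Module.Finite ℝ (H1 (Sing X) ℝ (LieAlg Λ)) := by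
  let F : ((Fin g → LieAlg Λ) × (Fin g → LieAlg Λ)) →ₗ[ℝ] H1 (Sing X) ℝ (LieAlg Λ) :=
    (∑ i, (tensHom ℝ (M.dualClass i 0)).comp (LinearMap.proj i)).coprod
      (∑ i, (tensHom ℝ (M.dualClass i 1)).comp (LinearMap.proj i))
  refine Module.Finite.of_surjective F fun v => ?_
  obtain ⟨α, β, rfl⟩ := M.exists_eq_sum_dualClass v
  refine ⟨(α, β), ?_⟩
  simp [F, LinearMap.sum_apply]; rfl

/-- The coordinates transverse to the polarization `L ⊗ 𝔱` defined by a rational Lagrangian. -/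
lemma exists_transverseCoordinates [Module.Free ℤ Λ] [Module.Finite ℤ Λ] (M : PolygonModel g X) {z : Cycle (Sing X)}
    (hz : IsFundamentalCycle (Sing X) z) (hs : K.IsSymm) {L : Submodule ℝ (H1 (Sing X) ℝ ℝ)}
    (hL : IsLagrangian z L) (hLrat : IsRational L) :
    Nonempty (TransverseCoordinates K g (latticeMap X Λ) (toralForm K z) (polarization Λ L)) := by
  obtain ⟨e, f, he, hef, hfr⟩ := hL.exists_frame M hz hLrat
  have hee : ∀ i j, intPairing z (e i) (e j) = 0 := fun i j => by
    have := (hL _).1 (he i) _ (he j)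
    rw [cupForm_toReal] at this
    exact_mod_cast this
  -- Contraction with the `e i` reads off the coefficients of the `f i`, because the `e i` are
  -- mutually orthogonal and dual to the `f i`.
  let β : H1 (Sing X) ℝ (LieAlg Λ) →ₗ[ℝ] (Fin g → LieAlg Λ) :=
    LinearMap.pi fun i => contraction (LieAlg Λ) z (toReal (e i))
  have hβ : ∀ a b : Fin g → LieAlg Λ,
      β (∑ i, tens ℝ (e i) (a i) + ∑ i, tens ℝ (f i) (b i)) = b := by
    intro a b
    funext i
    simp only [β, LinearMap.pi_apply, map_add, map_sum, contraction_tens, hee, hef]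
    simp
  let E : (Fin g → Λ) →+ H1 (Sing X) ℤ Λ :=
    (∑ i, (tensHom ℤ (e i)).comp (LinearMap.proj i)).toAddMonoidHom
  have hE : ∀ l, E l = ∑ i, tens ℤ (e i) (l i) := fun l => by
    simp [E, LinearMap.sum_apply]; rfl
  have hιE : ∀ l, latticeMap X Λ (E l) = ∑ i, tens ℝ (e i) (1 ⊗ₜ l i) := fun l => by
    rw [hE, map_sum]
    simp only [latticeMap_tens]
  have heP : ∀ i (τ : LieAlg Λ), tens ℝ (e i) τ ∈ polarization Λ L := fun i τ =>
    Submodule.subset_span ⟨_, he i, τ, tens_real_eq _ _⟩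
  have hker : LinearMap.ker β = polarization Λ L := by
    apply le_antisymm
    · intro v hv
      obtain ⟨a, b, rfl⟩ := M.exists_eq_sum_frame hfr v
      rw [LinearMap.mem_ker, hβ] at hv
      have h0 : ∑ i, tens ℝ (f i) (b i) = 0 := by
        refine Finset.sum_eq_zero fun i _ => ?_
        rw [hv, Pi.zero_apply, tens_zero_right]
      rw [h0, add_zero]
      exact Submodule.sum_mem _ fun i _ => heP i _
    · refine Submodule.span_le.2 ?_
      rintro _ ⟨x, hx, τ, rfl⟩
      rw [SetLike.mem_coe, LinearMap.mem_ker]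
      funext i
      change contraction (LieAlg Λ) z (toReal (e i)) _ = 0
      rw [contraction_map, (hL _).1 (he i) x hx, zero_smul]
  have hlat : ∀ l l' : Fin g → Λ, β (latticeMap X Λ
      (∑ i, tens ℤ (e i) (l i) + ∑ i, tens ℤ (f i) (l' i))) = fun i => 1 ⊗ₜ l' i := fun l l' => by
    rw [map_add, map_sum, map_sum]
    simp only [latticeMap_tens]
    exact hβ _ _
  refine ⟨{
    coord := β
    coord_surjective := fun b => ⟨_, hβ 0 b⟩
    ker_coord := hker
    coord_lattice := fun γ => ?_
    exists_coord_eq := fun l => ⟨_, hlat 0 l⟩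
    tangent := E
    tangent_mem := fun l => ?_
    exists_tangent_eq := fun γ hγ => ?_
    form_tangent := fun l v => ?_
    form_swap := toralForm_swap hs z
    form_isotropic := toralForm_isotropic hL }⟩
  · obtain ⟨l, l', rfl⟩ := M.exists_eq_sum_frame hfr γ
    exact ⟨l', hlat l l'⟩
  · rw [hιE]
    exact Submodule.sum_mem _ fun i _ => heP i _
  · obtain ⟨l, l', rfl⟩ := M.exists_eq_sum_frame hfr γ
    rw [← hker, LinearMap.mem_ker, hlat] at hγ
    refine ⟨l, ?_⟩
    have h0 : ∑ i, tens ℤ (f i) (l' i) = 0 := by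
      refine Finset.sum_eq_zero fun i _ => ?_
      rw [eq_zero_of_one_tmul (congrFun hγ i), tens_zero_right]
    rw [h0, add_zero, hE]
  · rw [hιE, map_sum, LinearMap.sum_apply]
    refine Finset.sum_congr rfl fun i _ => ?_
    rw [tens_real_eq, toralForm_map]
    rfl

end Toral

end ToralCS

end

theorem mainTheorem2 {X : Type*} [TopologicalSpace X] (g : ℕ) (hX : ToralCS.IsClosedSurface g X)
    (z : ToralCS.Cycle (ToralCS.Sing X)) (hz : ToralCS.IsFundamentalCycle (ToralCS.Sing X) z)
    {Λ : Type*} [AddCommGroup Λ] [Module.Free ℤ Λ] [Module.Finite ℤ Λ]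
    (K : LinearMap.BilinForm ℤ Λ) (hs : K.IsSymm) (he : ∀ x, Even (K x x)) (hK : K.Nondegenerate)
    {n : ℕ} (b : Module.Basis (Fin n) ℤ Λ)
    (L : Submodule ℝ (ToralCS.H1 (ToralCS.Sing X) ℝ ℝ))
    (hL : ToralCS.IsLagrangian z L) (hLrat : ToralCS.IsRational L) :
    Module.finrank ℂ (ToralCS.QuantumSpace (ToralCS.chernSimonsBundle hs he z)
        (ToralCS.polarization Λ L)) = Nat.card (ToralCS.DiscriminantGroup K) ^ g ∧
      Nat.card (ToralCS.DiscriminantGroup K) ^ g =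
        (LinearMap.BilinForm.toMatrix b K).det.natAbs ^ g ∧
      ∀ ℒ : ToralCS.PrequantumBundle (ToralCS.latticeMap X Λ) (ToralCS.toralForm K z),
        Module.finrank ℂ (ToralCS.QuantumSpace ℒ (ToralCS.polarization Λ L)) =
          (LinearMap.BilinForm.toMatrix b K).det.natAbs ^ g := by
  have M := hX.polygonModel.some
  have T := (ToralCS.exists_transverseCoordinates (K := K) M hz hs hL hLrat).some
  have := ToralCS.finite_H1_lieAlg (Λ := Λ) M
  have hcard := ToralCS.card_discriminantGroup hK b
  refine ⟨T.finrank_quantumSpace _ hs hK, by rw [hcard], fun ℒ => ?_⟩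
  rw [T.finrank_quantumSpace ℒ hs hK, hcard]
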